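/- Let $A\to M$ be a Lie algebroid of rank $N$ over a smooth manifold $M$, with anchor $\rho$, bracket $[\,,]$ and differential $d_A$ on $\Gamma(\wedge^\bullet A^*)$. The Gerstenhaber bracket on $\Gamma(\wedge^\bullet A)$, the extension of the bracket of $\Gamma(A)$ and of $[X,f]=\rho(X)f$ as a graded biderivation, is also denoted $[\,,]$. **Conventions.** Forms and multivectors are evaluated by determinants, $(\alpha\wedge\beta)(X,Y)=\alpha(X)\beta(Y)-\alpha(Y)\beta(X)$. The interior product $i_X$ by a vector is the contraction with the first argument, and $i_{X\wedge Y}=i_X\circ i_Y$. For a bivector $\pi$, the map $\pi^\sharp:A^*\to A$ is given by $\langle\beta,\pi^\sharp\alpha\rangle=\pi(\alpha,\beta)$. Let $(\pi,\psi)$ be a twisted Poisson structure on $A$, i.e. $\pi\in\Gamma(\wedge^2A)$, $\psi\in\Gamma(\wedge^3A^*)$, $d_A\psi=0$ and $\tfrac12[\pi,\pi]=(\wedge^3\pi^\sharp)\psi$. Define $\psi^{(2)}\in\Gamma(A^*\otimes\wedge^2A)$ by $\psi^{(2)}(\xi,\eta)(X)=\psi(\pi^\sharp\xi,\pi^\sharp\eta,X)$.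 Let $[\,,]_{\pi,\psi}$ be the bracket on $\Gamma(A^*)$ $$[\alpha,\beta]_{\pi,\psi}=\mathcal L_{\pi^\sharp\alpha}\beta-\mathcal L_{\pi^\sharp\beta}\alpha-d_A(\pi(\alpha,\beta))+\psi^{(2)}(\alpha,\beta),$$ with anchor $\rho\circ\pi^\sharp$, extended as a graded biderivation to $\Gamma(\wedge^\bullet A^*)$. Set: * $d_{\pi,\psi}V=[\pi,V]-\underline d_{\pi,\psi}V$ for $V\in\Gamma(\wedge^\bullet A)$, where $\underline d_{\pi,\psi}$ is the interior product by $\psi^{(2)}$ regarded as a bivector-valued $1$-form, $i_{\xi\otimes Q}V=Q\wedge i_\xi V$; * $\partial_\pi=d_A\circ i_\pi-i_\pi\circ d_A$ on $\Gamma(\wedge^\bullet A^*)$; * $\underline\partial_{\pi,\psi}$, the interior product of forms by $\psi^{(2)}$ regarded as a $1$-form-valued bivector, $i_{\xi\otimes Q}\omega=\xi\wedge i_Q\omega$; * $Y_{\pi,\psi}=-\pi^\sharp(i_\pi\psi)\in\Gamma(A)$, equivalently $\langle\alpha,Y_{\pi,\psi}\rangle=\tfrac12\operatorname{Tr}\bigl(\beta\mapsto\psi^{(2)}(\alpha,\beta)\bigr)$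 for $\alpha\in\Gamma(A^*)$. Let $\lambda\in\Gamma(\wedge^NA^*)$ be a volume form, i.e. nowhere vanishing. Then $*_\lambda:\Gamma(\wedge^\bullet A)\to\Gamma(\wedge^\bullet A^*)$, $*_\lambda V=i_V\lambda$, is bijective. There is a unique $X_{\pi,\lambda}\in\Gamma(A)$ with $$\langle\alpha,X_{\pi,\lambda}\rangle\lambda=\mathcal L_{\pi^\sharp\alpha}\lambda-(i_\pi d_A\alpha)\lambda\qquad\text{for all }\alpha\in\Gamma(A^*),$$ where $\mathcal L_X=i_X\circ d_A+d_A\circ i_X$. Put $Z_{\pi,\psi,\lambda}=X_{\pi,\lambda}+Y_{\pi,\psi}$ and $\partial_{\pi,\psi,\lambda}=-*_\lambda\circ d_{\pi,\psi}\circ *_\lambda^{-1}$. **Proposition.** $(\Gamma(\wedge^\bullet A^*),[\,,]_{\pi,\psi})$ is a Gerstenhaber algebra, namely that of a Lie algebroid structure on $A^*$ whose differential on $\Gamma(\wedge^\bullet A)$ is $d_{\pi,\psi}$. The operator $u=\partial_{\pi,\psi,\lambda}$ is a generator of square zero of it, i.e. $u\circ u=0$ and $$[a,b]_{\pi,\psi}=(-1)^{|a|}\bigl(u(a\wedge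 b)-u(a)\wedge b-(-1)^{|a|}a\wedge u(b)\bigr)$$ for all $a,b\in\Gamma(\wedge^\bullet A^*)$ with $a$ homogeneous. Moreover $$\partial_{\pi,\psi,\lambda}-\bigl(\partial_\pi+\underline\partial_{\pi,\psi}+i_{Y_{\pi,\psi}}\bigr)=i_{Z_{\pi,\psi,\lambda}}.$$ -/

import Mathlib

open scoped Manifold ContDiff TensorProduct
open Bundle

noncomputable section

/-! ## Algebra of brackets, forms and multivectors

`R` plays the role of `C^∞(M)` and `L` that of the `R`-module `Γ(A)` of smooth sections of a vector
bundle of finite rank. Then `Module.Dual R L` is `Γ(A*)`, `⋀[R]^p L` is `Γ(∧^p A)` and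
`⋀[R]^q (Module.Dual R L)` is `Γ(∧^q A*)`; the exterior algebras are the full graded algebras. -/

/-- An anchor together with a skew-symmetric bracket satisfying the Leibniz rule
`[X, fY] = f [X, Y] + (ρ(X) f) Y`. The Jacobi identity is *not* part of this structure. -/
structure AnchoredBracket (R L : Type*) [CommRing R] [Algebra ℝ R] [AddCommGroup L] [Module R L]
    [Module ℝ L] where
  anchor : L →ₗ[R] Derivation ℝ R R
  bracket : L →ₗ[ℝ] L →ₗ[ℝ] L
  bracket_self : ∀ X, bracket X X = 0
  leibniz : ∀ (X Y : L) (f : R), bracket X (f • Y) = f • bracket X Y + anchor X f • Y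

namespace AnchoredBracket

/-! ### Gerstenhaber brackets -/

section Gerstenhaber

variable {R E : Type*} [CommRing R] [Algebra ℝ R] [AddCommGroup E] [Module R E] [Module ℝ E]
  [IsScalarTower ℝ R E]

/-- A graded skew-symmetric biderivation of degree `-1` of the graded commutative algebra
`⋀ E`: for `a`, `b` of degrees `p`, `q`, one has `[a, b] = - (-1)^((p-1)(q-1)) [b, a]`, and `[a, ·]`
is a derivation of degree `p - 1`. (Signs only depend on parities, so `p - 1` is written `p + 1`.) -/
structure IsGradedBiderivation
    (B : ExteriorAlgebra R E →ₗ[ℝ] ExteriorAlgebra R E →ₗ[ℝ] ExteriorAlgebra R E) : Prop where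
  mem : ∀ (p q r : ℕ), p + q = r + 1 → ∀ a ∈ ⋀[R]^p E, ∀ b ∈ ⋀[R]^q E, B a b ∈ ⋀[R]^r E
  functions : ∀ a ∈ ⋀[R]^0 E, ∀ b ∈ ⋀[R]^0 E, B a b = 0
  skew : ∀ (p q : ℕ), ∀ a ∈ ⋀[R]^p E, ∀ b ∈ ⋀[R]^q E,
    B a b = -((-1 : ℝ) ^ ((p + 1) * (q + 1)) • B b a)
  leibniz : ∀ (p q : ℕ), ∀ a ∈ ⋀[R]^p E, ∀ b ∈ ⋀[R]^q E, ∀ c,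
    B a (b * c) = B a b * c + (-1 : ℝ) ^ ((p + 1) * q) • (b * B a c)

/-- `B` is the extension, as a graded biderivation of `⋀ E`, of the bracket of `E` and of the
action `[X, f] = ρ(X) f` of `E` on functions. -/
structure IsGerstenhaberExtension (D : AnchoredBracket R E)
    (B : ExteriorAlgebra R E →ₗ[ℝ] ExteriorAlgebra R E →ₗ[ℝ] ExteriorAlgebra R E) : Prop
    extends IsGradedBiderivation B where
  sections : ∀ X Y : E,
    B (ExteriorAlgebra.ι R X) (ExteriorAlgebra.ι R Y) = ExteriorAlgebra.ι R (D.bracket X Y)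
  anchor : ∀ (X : E) (f : R),
    B (ExteriorAlgebra.ι R X) (algebraMap R _ f) = algebraMap R _ (D.anchor X f)

/-- The graded Jacobi identity, in the form: `[a, ·]` is a derivation of the bracket. -/
def GradedJacobi
    (B : ExteriorAlgebra R E →ₗ[ℝ] ExteriorAlgebra R E →ₗ[ℝ] ExteriorAlgebra R E) : Prop :=
  ∀ (p q : ℕ), ∀ a ∈ ⋀[R]^p E, ∀ b ∈ ⋀[R]^q E, ∀ c,
    B a (B b c) = B (B a b) c + (-1 : ℝ) ^ ((p + 1) * (q + 1)) • B b (B a c)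

/-- The Gerstenhaber bracket of `⋀ E`: the unique extension of the bracket of `E` as a graded
biderivation. -/
def gerstenhaber (D : AnchoredBracket R E) :
    ExteriorAlgebra R E →ₗ[ℝ] ExteriorAlgebra R E →ₗ[ℝ] ExteriorAlgebra R E :=
  Classical.epsilon D.IsGerstenhaberExtension

/-- A generator of square zero of the bracket `B`: an operator `u` with
`[a, b] = (-1)^|a| (u(ab) - u(a) b - (-1)^|a| a u(b))` and `u ∘ u = 0`. -/
structure IsSquareZeroGenerator
    (B : ExteriorAlgebra R E →ₗ[ℝ] ExteriorAlgebra R E →ₗ[ℝ] ExteriorAlgebra R E)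
    (u : ExteriorAlgebra R E → ExteriorAlgebra R E) : Prop where
  linear : IsLinearMap ℝ u
  generates : ∀ (p : ℕ), ∀ a ∈ ⋀[R]^p E, ∀ b,
    B a b = (-1 : ℝ) ^ p • (u (a * b) - u a * b - (-1 : ℝ) ^ p • (a * u b))
  square_zero : ∀ a, u (u a) = 0

end Gerstenhaber

/-! ### The differential -/

section Differential

variable {R E E' : Type*} [CommRing R] [Algebra ℝ R]
  [AddCommGroup E] [Module R E] [Module ℝ E] [IsScalarTower ℝ R E]
  [AddCommGroup E'] [Module R E'] [Module ℝ E'] [IsScalarTower ℝ R E']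

/-- The value `ω(a₀, …, a_{q-1})` of `ω ∈ ⋀^q E'` on elements of `E`, where `E'` is paired with `E`
by `ev`; for `ω = α₀ ∧ … ∧ α_{q-1}` it is the determinant of the matrix of the `⟨αᵢ, aⱼ⟩`. -/
def formValue (ev : E' →ₗ[R] Module.Dual R E) {q : ℕ} (w : ⋀[R]^q E') (a : Fin q → E) : R :=
  exteriorPower.pairingDual R E q (exteriorPower.map q ev w) (exteriorPower.ιMulti R q a)

/-- The right-hand side of the formula for the Lie algebroid differential of the `q`-form `φ`:
`∑ₖ (-1)^k ρ(aₖ) φ(…, âₖ, …) + ∑_{k < l} (-1)^(k+l) φ([aₖ, aₗ], …, âₖ, …, âₗ, …)`. -/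
def koszul (D : AnchoredBracket R E) : (q : ℕ) → ((Fin q → E) → R) → (Fin (q + 1) → E) → R
  | 0, φ, a => D.anchor (a 0) (φ Fin.elim0)
  | q + 1, φ, a =>
      (∑ k : Fin (q + 2), (-1) ^ (k : ℕ) * D.anchor (a k) (φ (a ∘ k.succAbove))) +
      ∑ l : Fin (q + 2), ∑ k : Fin (q + 1), if k.castSucc < l then
        (-1) ^ ((k : ℕ) + (l : ℕ)) *
          φ (Fin.cons (D.bracket (a k.castSucc) (a l)) (a ∘ l.succAbove ∘ k.succAbove))
      else 0

/-- `d` is the differential, on `⋀ E'`, of the bracket and anchor `D` of `E`. -/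
def IsDifferential (D : AnchoredBracket R E) (ev : E' →ₗ[R] Module.Dual R E)
    (d : ExteriorAlgebra R E' →ₗ[ℝ] ExteriorAlgebra R E') : Prop :=
  ∀ (q : ℕ) (w : ⋀[R]^q E'), ∃ η : ⋀[R]^(q + 1) E', d (w : ExteriorAlgebra R E') = η ∧
    ∀ a, formValue ev η a = D.koszul q (formValue ev w) a

end Differential

/-! ### Operators defined by a bracket, a bivector, a `3`-form and a volume form -/

section Interior

variable {R L : Type*} [CommRing R] [AddCommGroup L] [Module R L]

/-- The interior product of forms by multivectors, `V ↦ i_V`, with `i_{X ∧ Y} = i_X ∘ i_Y`. -/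
def interior : ExteriorAlgebra R L →ₐ[R] Module.End R (ExteriorAlgebra R (Module.Dual R L)) :=
  ExteriorAlgebra.lift R
    ⟨(CliffordAlgebra.contractLeft (Q := (0 : QuadraticForm R (Module.Dual R L)))) ∘ₗ
      Module.Dual.eval R L, fun X => by
        refine LinearMap.ext fun w => ?_
        exact CliffordAlgebra.contractLeft_contractLeft 
          (Q := (0 : QuadraticForm R (Module.Dual R L))) (Module.Dual.eval R L X) w⟩

/-- The interior product of multivectors by a `1`-form. -/
def contract (α : Module.Dual R L) : ExteriorAlgebra R L →ₗ[R] ExteriorAlgebra R L :=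
  CliffordAlgebra.contractLeft (Q := (0 : QuadraticForm R L)) α

/-- The map `P^♯ : Γ(A*) → Γ(A)` of a bivector `P`, with `⟨β, P^♯ α⟩ = P(α, β)`; it is given by contracting
`α` with `P`. -/
def sharp (P : ⋀[R]^2 L) : Module.Dual R L →ₗ[R] L :=
  (ExteriorAlgebra.ιInv ∘ₗ LinearMap.flip
    (CliffordAlgebra.contractLeft (Q := (0 : QuadraticForm R L)))
      (P : ExteriorAlgebra R L) : Module.Dual R L →ₗ[R] L)

theorem ιInv_algebraMap (r : R) :
    ExteriorAlgebra.ιInv (algebraMap R (ExteriorAlgebra R L) r) = (0 : L) := by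
  let _ : Module Rᵐᵒᵖ L := Module.compHom _ ((RingHom.id R).fromOpposite mul_comm)
  have _ : IsCentralScalar R L := ⟨fun r m => rfl⟩
  change (ExteriorAlgebra.toTrivSqZeroExt (algebraMap R (ExteriorAlgebra R L) r)).snd = 0
  rw [AlgHom.commutes, TrivSqZeroExt.algebraMap_eq_inl, TrivSqZeroExt.snd_inl]

theorem ιInv_ι_mul (x : L) (y : ExteriorAlgebra R L) :
    ExteriorAlgebra.ιInv (ExteriorAlgebra.ι R x * y) = ExteriorAlgebra.algebraMapInv y • x := by
  let _ : Module Rᵐᵒᵖ L := Module.compHom _ ((RingHom.id R).fromOpposite mul_comm)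
  have _ : IsCentralScalar R L := ⟨fun r m => rfl⟩
  have h : ∀ y : ExteriorAlgebra R L, (ExteriorAlgebra.toTrivSqZeroExt y).fst =
      ExteriorAlgebra.algebraMapInv y := by
    intro y
    have : (TrivSqZeroExt.fstHom R R L).comp ExteriorAlgebra.toTrivSqZeroExt =
        ExteriorAlgebra.algebraMapInv := by
      ext x
      simp [ExteriorAlgebra.algebraMapInv, ExteriorAlgebra.toTrivSqZeroExt_ι]
    exact DFunLike.congr_fun this y
  change (ExteriorAlgebra.toTrivSqZeroExt (ExteriorAlgebra.ι R x * y)).snd = _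
  rw [map_mul, ExteriorAlgebra.toTrivSqZeroExt_ι, TrivSqZeroExt.snd_mul, h]
  simp

theorem apply_ιInv (β : Module.Dual R L) (z : ExteriorAlgebra R L) :
    β (ExteriorAlgebra.ιInv z) = ExteriorAlgebra.algebraMapInv (contract β z) := by
  induction z using CliffordAlgebra.left_induction with
  | algebraMap r => 
    have h := ιInv_algebraMap (L := L) r
    rw [show (algebraMap R (CliffordAlgebra (0 : QuadraticForm R L)) r) = algebraMap R (ExteriorAlgebra R L) r from rfl, h]
    simp [contract]
  | add x y hx hy => simp [hx, hy]
  | ι_mul x m hx =>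
    rw [ιInv_ι_mul]
    simp [contract, CliffordAlgebra.contractLeft_ι_mul, ExteriorAlgebra.algebraMapInv]
    simp [mul_comm]

theorem apply_sharp_swap (P : ⋀[R]^2 L) (α β : Module.Dual R L) :
    β (sharp P α) = - α (sharp P β) := by
  change β (ExteriorAlgebra.ιInv (contract α P)) = - α (ExteriorAlgebra.ιInv (contract β P))
  rw [apply_ιInv, apply_ιInv, ← map_neg]
  exact congrArg _ (CliffordAlgebra.contractLeft_comm β α _)

theorem apply_sharp_self (P : ⋀[R]^2 L) (α : Module.Dual R L) : α (sharp P α) = 0 := by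
  change α (ExteriorAlgebra.ιInv (contract α P)) = 0
  rw [apply_ιInv, ← map_zero (ExteriorAlgebra.algebraMapInv (R := R) (M := L))]
  exact congrArg _ (CliffordAlgebra.contractLeft_contractLeft α _)

/-- The defining property of `P^♯`. -/
theorem apply_sharp (P : ⋀[R]^2 L) (α β : Module.Dual R L) :
    β (sharp P α) = exteriorPower.pairingDual R (Module.Dual R L) 2
      (exteriorPower.map 2 (Module.Dual.eval R L) P) (exteriorPower.ιMulti R 2 ![α, β]) := by
  let f : ⋀[R]^2 L →ₗ[R] R := β ∘ₗ ExteriorAlgebra.ιInv ∘ₗ contract α ∘ₗ (⋀[R]^2 L).subtype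
  let g : ⋀[R]^2 L →ₗ[R] R := LinearMap.applyₗ (exteriorPower.ιMulti R 2 ![α, β]) ∘ₗ
    exteriorPower.pairingDual R (Module.Dual R L) 2 ∘ₗ exteriorPower.map 2 (Module.Dual.eval R L)
  suffices h : f = g from DFunLike.congr_fun h P
  ext v
  simp only [f, g, LinearMap.compAlternatingMap_apply, LinearMap.comp_apply, apply_ιInv]
  simp [contract, ExteriorAlgebra.ιMulti_apply, CliffordAlgebra.contractLeft_ι_mul, Matrix.det_fin_two]
  rw [show Matrix.vecTail v 0 = v 1 from rfl]
  ring

/-- The value `w(X₀, …, X_{q-1})` of a `q`-form. -/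
def eval {q : ℕ} (w : ⋀[R]^q (Module.Dual R L)) (X : Fin q → L) : R :=
  formValue LinearMap.id w X

theorem eval_eq {q : ℕ} (w : ⋀[R]^q (Module.Dual R L)) (X : Fin q → L) :
    eval w X = exteriorPower.pairingDual R L q w (exteriorPower.ιMulti R q X) := by
  simp [eval, formValue]

/-- The `1`-form `ψ^(2)(ξ, η)`, with `ψ^(2)(ξ, η)(X) = ψ(P^♯ ξ, P^♯ η, X)`. -/
def psiTwo (P : ⋀[R]^2 L) (ψ : ⋀[R]^3 (Module.Dual R L)) (ξ η : Module.Dual R L) :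
    Module.Dual R L where
  toFun X := eval ψ ![sharp P ξ, sharp P η, X]
  map_add' X Y := by
    have h := ((exteriorPower.ιMulti R 3 (M := L)).toMultilinearMap).map_update_add
      ![sharp P ξ, sharp P η, 0] 2 X Y
    have e : ∀ Z : L, Function.update ![sharp P ξ, sharp P η, 0] 2 Z =
        ![sharp P ξ, sharp P η, Z] := by
      intro Z; ext i; fin_cases i <;> rfl
    simp only [e, AlternatingMap.coe_multilinearMap] at h
    rw [eval_eq, eval_eq, eval_eq, h, map_add]
  map_smul' f X := by
    have h := ((exteriorPower.ιMulti R 3 (M := L)).toMultilinearMap).map_update_smul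
      ![sharp P ξ, sharp P η, 0] 2 f X
    have e : ∀ Z : L, Function.update ![sharp P ξ, sharp P η, 0] 2 Z =
        ![sharp P ξ, sharp P η, Z] := by
      intro Z; ext i; fin_cases i <;> rfl
    simp only [e, AlternatingMap.coe_multilinearMap] at h
    rw [eval_eq, eval_eq, h, map_smul]; rfl

theorem psiTwo_add (P : ⋀[R]^2 L) (ψ : ⋀[R]^3 (Module.Dual R L)) (ξ ξ' η : Module.Dual R L) :
    psiTwo P ψ (ξ + ξ') η = psiTwo P ψ ξ η + psiTwo P ψ ξ' η := by
  ext X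
  have h := ((exteriorPower.ιMulti R 3 (M := L)).toMultilinearMap).map_update_add
    ![0, sharp P η, X] 0 (sharp P ξ) (sharp P ξ')
  have e : ∀ Z : L, Function.update ![0, sharp P η, X] 0 Z = ![Z, sharp P η, X] := by
    intro Z; ext i; fin_cases i <;> rfl
  simp only [e, AlternatingMap.coe_multilinearMap] at h
  change eval ψ _ = eval ψ _ + eval ψ _
  rw [eval_eq, eval_eq, eval_eq, map_add, h, map_add]

theorem psiTwo_smul (P : ⋀[R]^2 L) (ψ : ⋀[R]^3 (Module.Dual R L)) (f : R)
    (ξ η : Module.Dual R L) : psiTwo P ψ (f • ξ) η = f • psiTwo P ψ ξ η := by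
  ext X
  have h := ((exteriorPower.ιMulti R 3 (M := L)).toMultilinearMap).map_update_smul
    ![0, sharp P η, X] 0 f (sharp P ξ)
  have e : ∀ Z : L, Function.update ![0, sharp P η, X] 0 Z = ![Z, sharp P η, X] := by
    intro Z; ext i; fin_cases i <;> rfl
  simp only [e, AlternatingMap.coe_multilinearMap] at h
  change eval ψ _ = f • eval ψ _
  rw [eval_eq, eval_eq, map_smul, h, map_smul]

theorem psiTwo_self (P : ⋀[R]^2 L) (ψ : ⋀[R]^3 (Module.Dual R L)) (ξ : Module.Dual R L) :
    psiTwo P ψ ξ ξ = 0 := by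
  ext X
  change eval ψ _ = 0
  rw [eval_eq, (exteriorPower.ιMulti R 3 (M := L)).map_eq_zero_of_eq _ (i := 0) (j := 1) rfl
    (by decide), map_zero]

theorem psiTwo_swap (P : ⋀[R]^2 L) (ψ : ⋀[R]^3 (Module.Dual R L)) (ξ η : Module.Dual R L) :
    psiTwo P ψ ξ η = - psiTwo P ψ η ξ := by
  ext X
  have h := (exteriorPower.ιMulti R 3 (M := L)).map_swap ![sharp P η, sharp P ξ, X]
    (i := 0) (j := 1) (by decide)
  have e : ![sharp P η, sharp P ξ, X] ∘ Equiv.swap (0 : Fin 3) 1 = ![sharp P ξ, sharp P η, X] := by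
    ext i; fin_cases i <;> rfl
  change eval ψ _ = - eval ψ _
  rw [eval_eq, eval_eq, ← e, h, map_neg]

/-- `(α, β, γ) ↦ α ⊗ P^♯β ∧ P^♯γ + β ⊗ P^♯γ ∧ P^♯α + γ ⊗ P^♯α ∧ P^♯β`. -/
def psiTwoTensorAux (P : ⋀[R]^2 L) :
    Module.Dual R L [⋀^Fin 3]→ₗ[R] (Module.Dual R L ⊗[R] ExteriorAlgebra R L) where
  toFun a :=
    let s := fun i => ExteriorAlgebra.ι R (sharp P (a i))
    a 0 ⊗ₜ (s 1 * s 2) + a 1 ⊗ₜ (s 2 * s 0) + a 2 ⊗ₜ (s 0 * s 1)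
  map_update_add' := by
    intro inst a i x y
    obtain rfl : inst = instDecidableEqFin 3 := Subsingleton.elim _ _
    fin_cases i <;>
    simp [TensorProduct.add_tmul, TensorProduct.tmul_add, add_mul, mul_add, Function.update] <;> abel
  map_update_smul' := by
    intro inst a i c x
    obtain rfl : inst = instDecidableEqFin 3 := Subsingleton.elim _ _
    fin_cases i <;> simp [TensorProduct.smul_tmul', Function.update]
  map_eq_zero_of_eq' a i j h hij := by
    have sw : ∀ x y : L, ExteriorAlgebra.ι R x * ExteriorAlgebra.ι R y =
      - (ExteriorAlgebra.ι R y * ExteriorAlgebra.ι R x) :=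
      fun x y => eq_neg_of_add_eq_zero_left (ExteriorAlgebra.ι_add_mul_swap x y)
    have sq : ∀ x : L, ExteriorAlgebra.ι R x * ExteriorAlgebra.ι R x = 0 :=
      ExteriorAlgebra.ι_sq_zero
    fin_cases i <;> fin_cases j <;> simp at hij h ⊢
    · rw [h, sw (sharp P (a 2)) (sharp P (a 1)), sq]
      simp only [TensorProduct.tmul_neg, TensorProduct.tmul_zero]
      abel
    · rw [h, sw (sharp P (a 1)) (sharp P (a 2)), sq]
      simp only [TensorProduct.tmul_neg, TensorProduct.tmul_zero]
      abel
    · rw [h, sw (sharp P (a 2)) (sharp P (a 0)), sq]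
      simp only [TensorProduct.tmul_neg, TensorProduct.tmul_zero]
      abel
    · rw [h, sw (sharp P (a 2)) (sharp P (a 0)), sq]
      simp only [TensorProduct.tmul_neg, TensorProduct.tmul_zero]
      abel
    · rw [h, sw (sharp P (a 1)) (sharp P (a 0)), sq]
      simp only [TensorProduct.tmul_neg, TensorProduct.tmul_zero]
      abel
    · rw [h, sw (sharp P (a 1)) (sharp P (a 0)), sq]
      simp only [TensorProduct.tmul_neg, TensorProduct.tmul_zero]
      abel

/-- `ψ^(2)` as a section of `A* ⊗ ∧²A`; in a local frame it is
`(1/2) π^{kp} π^{lq} ψ_{pqm} ε^m ⊗ e_k ∧ e_l`. -/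
def psiTwoTensor (P : ⋀[R]^2 L) (ψ : ⋀[R]^3 (Module.Dual R L)) :
    Module.Dual R L ⊗[R] ExteriorAlgebra R L :=
  exteriorPower.alternatingMapLinearEquiv (R := R)
    (N := Module.Dual R L ⊗[R] ExteriorAlgebra R L) (psiTwoTensorAux P) ψ

/-- The tensor `ψ^(2)` takes the value `ψ^(2)(ξ, η)(X)` on `ξ`, `η` and `X`. -/
theorem psiTwoTensor_value (P : ⋀[R]^2 L) (ψ : ⋀[R]^3 (Module.Dual R L))
    (ξ η : Module.Dual R L) (X : L) :
    TensorProduct.lift ((LinearMap.lsmul R R).compl₁₂ (Module.Dual.eval R L X)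
      (ExteriorAlgebra.algebraMapInv.toLinearMap ∘ₗ contract η ∘ₗ contract ξ))
      (psiTwoTensor P ψ) = psiTwo P ψ ξ η X := by
  let f : ⋀[R]^3 (Module.Dual R L) →ₗ[R] R :=
    TensorProduct.lift ((LinearMap.lsmul R R).compl₁₂ (Module.Dual.eval R L X)
      (ExteriorAlgebra.algebraMapInv.toLinearMap ∘ₗ contract η ∘ₗ contract ξ)) ∘ₗ
      exteriorPower.alternatingMapLinearEquiv (R := R)
        (N := Module.Dual R L ⊗[R] ExteriorAlgebra R L) (psiTwoTensorAux P)
  let g : ⋀[R]^3 (Module.Dual R L) →ₗ[R] R :=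
    LinearMap.applyₗ (exteriorPower.ιMulti R 3 ![sharp P ξ, sharp P η, X]) ∘ₗ
      exteriorPower.pairingDual R L 3
  have hg : psiTwo P ψ ξ η X = g ψ := eval_eq _ _
  rw [hg]
  suffices h : f = g from DFunLike.congr_fun h ψ
  ext a
  simp only [f, g, LinearMap.compAlternatingMap_apply, LinearMap.comp_apply,
    exteriorPower.alternatingMapLinearEquiv_apply_ιMulti, LinearMap.applyₗ_apply_apply,
    exteriorPower.pairingDual_ιMulti_ιMulti, Matrix.det_fin_three]
  have sg : ∀ x y : Module.Dual R L, x (sharp P y) = - y (sharp P x) := fun x y => apply_sharp_swap P y x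
  simp [psiTwoTensorAux, contract, CliffordAlgebra.contractLeft_ι_mul, sg _ ξ, sg _ η,
    ExteriorAlgebra.algebraMapInv]
  ring

/-- The operator `∂̲` on forms: the interior product by the `1`-form-valued bivector `ψ^(2)`,
where `i_{ξ ⊗ Q} w = ξ ∧ i_Q w`. -/
def partialUnderline (P : ⋀[R]^2 L) (ψ : ⋀[R]^3 (Module.Dual R L)) :
    ExteriorAlgebra R (Module.Dual R L) →ₗ[R] ExteriorAlgebra R (Module.Dual R L) :=
  TensorProduct.lift ((LinearMap.mul R (Module.End R (ExteriorAlgebra R (Module.Dual R L)))).compl₁₂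
    ((LinearMap.mul R (ExteriorAlgebra R (Module.Dual R L))) ∘ₗ ExteriorAlgebra.ι R)
    (interior (R := R) (L := L)).toLinearMap) (psiTwoTensor P ψ)

/-- The operator `d̲` on multivectors: the interior product by the bivector-valued `1`-form `ψ^(2)`,
where `i_{ξ ⊗ Q} V = Q ∧ i_ξ V`. -/
def dUnderline (P : ⋀[R]^2 L) (ψ : ⋀[R]^3 (Module.Dual R L)) :
    ExteriorAlgebra R L →ₗ[R] ExteriorAlgebra R L :=
  TensorProduct.lift (((LinearMap.mul R (Module.End R (ExteriorAlgebra R L))).compl₁₂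
    (LinearMap.mul R (ExteriorAlgebra R L))
    (CliffordAlgebra.contractLeft (Q := (0 : QuadraticForm R L)))).flip) (psiTwoTensor P ψ)

/-- The map `*_λ V = i_V λ`. -/
def star {N : ℕ} (lam : ⋀[R]^N (Module.Dual R L)) :
    ExteriorAlgebra R L →ₗ[R] ExteriorAlgebra R (Module.Dual R L) :=
  LinearMap.applyₗ (lam : ExteriorAlgebra R (Module.Dual R L)) ∘ₗ interior.toLinearMap

/-- The section `Y = - P^♯ (i_P ψ)`, where the degree-one form `i_P ψ` is regarded as a section of
the dual; equivalently `⟨α, Y⟩` is half the trace of `β ↦ ψ^(2)(α, β)`. -/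
def sectionY (P : ⋀[R]^2 L) (ψ : ⋀[R]^3 (Module.Dual R L)) : L :=
  - sharp P (ExteriorAlgebra.ιInv
      (interior (P : ExteriorAlgebra R L) (ψ : ExteriorAlgebra R (Module.Dual R L))))

end Interior

section Operators

variable {R L : Type*} [CommRing R] [Algebra ℝ R] [AddCommGroup L] [Module R L] [Module ℝ L]
  [IsScalarTower ℝ R L]

set_option linter.unusedSectionVars false in
theorem bracket_smul_left (D : AnchoredBracket R L) (f : R) (X Y : L) :
    D.bracket (f • X) Y = f • D.bracket X Y - D.anchor Y f • X := by
  have sw : ∀ X Y, D.bracket X Y = - D.bracket Y X := fun X Y => by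
    have h := D.bracket_self (X + Y)
    simp only [map_add, LinearMap.add_apply, D.bracket_self, zero_add, add_zero] at h
    exact eq_neg_of_add_eq_zero_right h
  rw [sw, D.leibniz, sw Y X]
  simp [sub_eq_add_neg, add_comm]

/-- The Lie derivative of a `1`-form: `(L_X β)(Y) = ρ(X)(β(Y)) - β([X, Y])`. -/
def lieOneForm (D : AnchoredBracket R L) (X : L) (β : Module.Dual R L) : Module.Dual R L where
  toFun Y := D.anchor X (β Y) - β (D.bracket X Y)
  map_add' Y Z := by simp only [map_add]; ring
  map_smul' f Y := by
    simp only [map_smul, D.leibniz, map_add, smul_eq_mul, Derivation.leibniz, RingHom.id_apply]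
    ring

/-- The differential of a function as a `1`-form: `(d f)(X) = ρ(X) f`. -/
def dFun (D : AnchoredBracket R L) (f : R) : Module.Dual R L where
  toFun X := D.anchor X f
  map_add' X Y := by simp
  map_smul' g X := by simp

/-- The bracket `[α, β] = L_{P^♯α} β - L_{P^♯β} α - d(P(α, β)) + ψ^(2)(α, β)` on `Γ(A*)`, with
anchor `ρ ∘ P^♯`. Here `P(α, β) = ⟨β, P^♯α⟩`. -/
def twistedDual (D : AnchoredBracket R L) (P : ⋀[R]^2 L) (ψ : ⋀[R]^3 (Module.Dual R L)) :
    AnchoredBracket R (Module.Dual R L) where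
  anchor := D.anchor ∘ₗ sharp P
  bracket := LinearMap.mk₂ ℝ
    (fun α β => D.lieOneForm (sharp P α) β - D.lieOneForm (sharp P β) α - D.dFun (β (sharp P α))
      + psiTwo P ψ α β)
    (fun α α' β => by
      ext X
      simp [lieOneForm, dFun, psiTwo_add]
      ring)
    (fun c α β => by
      rw [← algebraMap_smul R c α, psiTwo_smul, algebraMap_smul, algebraMap_smul]
      ext X
      simp [lieOneForm, dFun, smul_sub, smul_add])
    (fun α β β' => by
      rw [psiTwo_swap, psiTwo_add, psiTwo_swap P ψ β, psiTwo_swap P ψ β']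
      ext X
      simp [lieOneForm, dFun]
      ring)
    (fun c α β => by
      rw [psiTwo_swap, ← algebraMap_smul R c β, psiTwo_smul, psiTwo_swap P ψ β, algebraMap_smul,
        algebraMap_smul]
      ext X
      simp [lieOneForm, dFun, smul_sub, smul_add])
  bracket_self α := by
    ext X
    simp [lieOneForm, dFun, psiTwo_self, apply_sharp_self]
  leibniz α β f := by
    rw [LinearMap.mk₂_apply, LinearMap.mk₂_apply, psiTwo_swap, psiTwo_smul, psiTwo_swap P ψ β]
    ext X
    simp [lieOneForm, dFun, bracket_smul_left, apply_sharp_swap P β α]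
    ring

/-- The differential `d_A` on forms: the unique operator given by the usual formula. -/
def dA (D : AnchoredBracket R L) :
    ExteriorAlgebra R (Module.Dual R L) →ₗ[ℝ] ExteriorAlgebra R (Module.Dual R L) :=
  Classical.epsilon (D.IsDifferential LinearMap.id)

/-- `(A, P, ψ)` is a twisted Poisson structure: `d_A ψ = 0` and `(1/2) [P, P] = (∧³ P^♯) ψ`. -/
structure IsTwistedPoisson (D : AnchoredBracket R L) (P : ⋀[R]^2 L)
    (ψ : ⋀[R]^3 (Module.Dual R L)) : Prop where
  closed : D.dA (ψ : ExteriorAlgebra R (Module.Dual R L)) = 0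
  twisted : (1 / 2 : ℝ) • D.gerstenhaber (P : ExteriorAlgebra R L) (P : ExteriorAlgebra R L) =
    ExteriorAlgebra.map (sharp P) (ψ : ExteriorAlgebra R (Module.Dual R L))

/-- `∂_P = [d_A, i_P] = d_A ∘ i_P - i_P ∘ d_A`. -/
def partialBivector (D : AnchoredBracket R L) (P : ⋀[R]^2 L)
    (w : ExteriorAlgebra R (Module.Dual R L)) : ExteriorAlgebra R (Module.Dual R L) :=
  D.dA (interior (P : ExteriorAlgebra R L) w) - interior (P : ExteriorAlgebra R L) (D.dA w)

/-- The Lie derivative of forms `L_X = [i_X, d_A] = i_X ∘ d_A + d_A ∘ i_X`. -/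
def lieDerivative (D : AnchoredBracket R L) (X : L)
    (w : ExteriorAlgebra R (Module.Dual R L)) : ExteriorAlgebra R (Module.Dual R L) :=
  interior (ExteriorAlgebra.ι R X) (D.dA w) + D.dA (interior (ExteriorAlgebra.ι R X) w)

/-- The differential `d_{P,ψ} V = [P, V] - d̲ V` of `Γ(∧A)`. -/
def dTwisted (D : AnchoredBracket R L) (P : ⋀[R]^2 L) (ψ : ⋀[R]^3 (Module.Dual R L)) :
    ExteriorAlgebra R L →ₗ[ℝ] ExteriorAlgebra R L :=
  D.gerstenhaber (P : ExteriorAlgebra R L) - (dUnderline P ψ).restrictScalars ℝ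

/-- `∂_{P,ψ,λ} = - *_λ ∘ d_{P,ψ} ∘ *_λ⁻¹`. -/
def partialVolume (D : AnchoredBracket R L) (P : ⋀[R]^2 L) (ψ : ⋀[R]^3 (Module.Dual R L))
    {N : ℕ} (lam : ⋀[R]^N (Module.Dual R L)) (w : ExteriorAlgebra R (Module.Dual R L)) :
    ExteriorAlgebra R (Module.Dual R L) :=
  - star lam (D.dTwisted P ψ (Function.invFun (star lam) w))

/-- `X` is the section `X_{P,λ}`: `⟨α, X⟩ λ = L_{P^♯α} λ - (i_P d_A α) λ` for all `1`-forms `α`. -/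
def IsSectionX (D : AnchoredBracket R L) (P : ⋀[R]^2 L) {N : ℕ}
    (lam : ⋀[R]^N (Module.Dual R L)) (X : L) : Prop :=
  ∀ α : Module.Dual R L, (α X) • (lam : ExteriorAlgebra R (Module.Dual R L)) =
    D.lieDerivative (sharp P α) lam -
      interior (P : ExteriorAlgebra R L) (D.dA (ExteriorAlgebra.ι R α)) * lam

end Operators

end AnchoredBracket

/-! ## Lie algebroids -/

open scoped Manifold ContDiff

section Algebroid

variable {E : Type*} [NormedAddCommGroup E] [NormedSpace ℝ E] {H : Type*} [TopologicalSpace H]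
  {I : ModelWithCorners ℝ E H} {M : Type*} [TopologicalSpace M] [ChartedSpace H M]
  {F : Type*} [NormedAddCommGroup F] [NormedSpace ℝ F]
  {A : M → Type*} [TopologicalSpace (TotalSpace F A)] [∀ x, TopologicalSpace (A x)]
  [∀ x, AddCommGroup (A x)] [∀ x, Module ℝ (A x)] [FiberBundle F A] [VectorBundle ℝ F A]

/-- The product of a smooth function and a smooth section. -/
instance sectionSMul : SMul C^∞⟮I, M; 𝓘(ℝ, ℝ), ℝ⟯ Cₛ^∞⟮I; F, A⟯ where
  smul f s := ⟨fun x => f x • s x, f.contMDiff.smul_section s.contMDiff⟩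

theorem section_smul_apply (f : C^∞⟮I, M; 𝓘(ℝ, ℝ), ℝ⟯) (s : Cₛ^∞⟮I; F, A⟯) (x : M) :
    (f • s) x = f x • s x := rfl

/-- Smooth sections form a module over smooth functions. -/
instance sectionModule : Module C^∞⟮I, M; 𝓘(ℝ, ℝ), ℝ⟯ Cₛ^∞⟮I; F, A⟯ where
  one_smul s := by ext x; exact one_smul ℝ (s x)
  mul_smul f g s := by ext x; exact mul_smul (f x) (g x) (s x)
  smul_zero f := by ext x; exact smul_zero (f x)
  smul_add f s t := by ext x; exact smul_add (f x) (s x) (t x)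
  add_smul f g s := by ext x; exact add_smul (f x) (g x) (s x)
  zero_smul s := by ext x; exact zero_smul ℝ (s x)

instance sectionScalarTower : IsScalarTower ℝ C^∞⟮I, M; 𝓘(ℝ, ℝ), ℝ⟯ Cₛ^∞⟮I; F, A⟯ where
  smul_assoc c f s := by ext x; exact smul_assoc c (f x) (s x)

/-- The derivative `v f` of a smooth function `f` along a tangent vector `v`. -/
def derivAlong {x : M} (v : TangentSpace I x) (f : C^∞⟮I, M; 𝓘(ℝ, ℝ), ℝ⟯) : ℝ :=
  mfderiv I 𝓘(ℝ, ℝ) f x v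

theorem derivAlong_add {x : M} (v : TangentSpace I x) (f g : C^∞⟮I, M; 𝓘(ℝ, ℝ), ℝ⟯) :
    derivAlong v (f + g) = derivAlong v f + derivAlong v g := by
  have hf : MDifferentiableAt I 𝓘(ℝ, ℝ) f x := f.contMDiff.mdifferentiable (by simp) x
  have hg : MDifferentiableAt I 𝓘(ℝ, ℝ) g x := g.contMDiff.mdifferentiable (by simp) x
  exact congrArg (fun T => T v) (mfderiv_add hf hg)

theorem derivAlong_smul {x : M} (v : TangentSpace I x) (c : ℝ) (f : C^∞⟮I, M; 𝓘(ℝ, ℝ), ℝ⟯) :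
    derivAlong v (c • f) = c * derivAlong v f := by
  have hf : MDifferentiableAt I 𝓘(ℝ, ℝ) f x := f.contMDiff.mdifferentiable (by simp) x
  exact congrArg (fun T => T v) (const_smul_mfderiv hf c)

theorem derivAlong_mul {x : M} (v : TangentSpace I x) (f g : C^∞⟮I, M; 𝓘(ℝ, ℝ), ℝ⟯) :
    derivAlong v (f * g) = f x * derivAlong v g + g x * derivAlong v f := by
  have hf : MDifferentiableAt I 𝓘(ℝ, ℝ) f x := f.contMDiff.mdifferentiable (by simp) x
  have hg : MDifferentiableAt I 𝓘(ℝ, ℝ) g x := g.contMDiff.mdifferentiable (by simp) x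
  exact congrArg (fun T => T v) (hf.hasMFDerivAt.mul hg.hasMFDerivAt).mfderiv

variable (I F A) in
/-- A Lie algebroid structure on the vector bundle `A` over `M`: a smooth bundle map `ρ : A → TM`
and a Lie bracket on the smooth sections of `A` with `[X, fY] = f [X, Y] + (ρ(X) f) Y`. -/
structure LieAlgebroid [IsManifold I ∞ M] where
  anchor : ∀ x : M, A x →ₗ[ℝ] TangentSpace I x
  contMDiff_anchor : ContMDiff (I.prod 𝓘(ℝ, F)) I.tangent ∞
    (fun v : TotalSpace F A => (⟨v.1, anchor v.1 v.2⟩ : TangentBundle I M))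
  bracket : Cₛ^∞⟮I; F, A⟯ →ₗ[ℝ] Cₛ^∞⟮I; F, A⟯ →ₗ[ℝ] Cₛ^∞⟮I; F, A⟯
  bracket_self : ∀ X, bracket X X = 0
  jacobi : ∀ X Y Z, bracket X (bracket Y Z) = bracket (bracket X Y) Z + bracket Y (bracket X Z)
  leibniz : ∀ (X Y : Cₛ^∞⟮I; F, A⟯) (f : C^∞⟮I, M; 𝓘(ℝ, ℝ), ℝ⟯) (x : M),
    bracket X (f • Y) x = f x • bracket X Y x +
      derivAlong (anchor x (X x)) f • Y x

namespace LieAlgebroid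

variable [IsManifold I ∞ M]

theorem contMDiff_anchor_apply (𝔸 : LieAlgebroid I F A) (X : Cₛ^∞⟮I; F, A⟯)
    (f : C^∞⟮I, M; 𝓘(ℝ, ℝ), ℝ⟯) : ContMDiff I 𝓘(ℝ, ℝ) ∞
      (fun x => derivAlong (𝔸.anchor x (X x)) f) := by
  have h1 : ContMDiff I I.tangent ∞
      (fun x => (⟨x, 𝔸.anchor x (X x)⟩ : TangentBundle I M)) :=
    𝔸.contMDiff_anchor.comp X.contMDiff
  have h2 := (f.contMDiff.contMDiff_tangentMap (m := ∞) (by simp)).comp h1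
  exact (contMDiff_snd_tangentBundle_modelSpace ℝ 𝓘(ℝ, ℝ)).comp h2

/-- The bracket of sections together with the derivations `f ↦ ρ(X) f` of `C^∞(M)`. -/
def toAnchoredBracket (𝔸 : LieAlgebroid I F A) :
    AnchoredBracket C^∞⟮I, M; 𝓘(ℝ, ℝ), ℝ⟯ Cₛ^∞⟮I; F, A⟯ where
  anchor :=
    { toFun := fun X => Derivation.mk'
        { toFun := fun f => ⟨_, 𝔸.contMDiff_anchor_apply X f⟩
          map_add' := fun f g => by
            ext x
            exact derivAlong_add _ f g
          map_smul' := fun c f => by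
            ext x
            exact derivAlong_smul _ c f } fun f g => by
            ext x
            exact derivAlong_mul _ f g
      map_add' := fun X Y => by
        ext f x
        change derivAlong (𝔸.anchor x (X x + Y x)) f = _
        rw [map_add]
        exact map_add (mfderiv I 𝓘(ℝ, ℝ) f x) _ _
      map_smul' := fun g X => by
        ext f x
        change derivAlong (𝔸.anchor x (g x • X x)) f = _
        rw [map_smul]
        exact map_smul (mfderiv I 𝓘(ℝ, ℝ) f x) _ _ }
  bracket := 𝔸.bracket
  bracket_self := 𝔸.bracket_self
  leibniz X Y f := by
    ext x
    exact 𝔸.leibniz X Y f x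

end LieAlgebroid

/-- A volume form: a form of degree `N` which vanishes at no point. -/
def IsVolumeForm {N : ℕ}
    (lam : ⋀[C^∞⟮I, M; 𝓘(ℝ, ℝ), ℝ⟯]^N (Module.Dual C^∞⟮I, M; 𝓘(ℝ, ℝ), ℝ⟯ Cₛ^∞⟮I; F, A⟯)) : Prop :=
  ∀ x : M, ∃ X : Fin N → Cₛ^∞⟮I; F, A⟯, AnchoredBracket.eval lam X x ≠ 0

end Algebroid
end

noncomputable section

set_option linter.unusedSectionVars false

namespace AnchoredBracket

/-! ### Exterior algebras: induction principles, grading involution, contractions -/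

section ExteriorBasics

variable {R M : Type*} [CommRing R] [AddCommGroup M] [Module R M]

/-! Everything is read off from one operator on forms, θ = `thetaOp` = [i_P, d] - ∂̲ - i_Y, that is,
θ = -(∂_P + ∂̲ + i_Y). All commutators here are graded; e_a denotes exterior multiplication by a
form a and i_V the interior product by a multivector V. Four facts carry the proof.

Bracket. On 1-forms, [[e_α, θ], e_β] = e_{[α,β]}, with the twisted bracket on the right
(`DualFrame.isDerivedGenerator_thetaOp`). An operator with this property determines the whole
Gerstenhaber bracket as a derived bracket, and the graded Jacobi identity follows when θ² = 0
(`IsDerivedGenerator.gradedJacobi`). The bracket of multivectors is derived from d in the same way,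
through V ↦ i_V.

Differential. i_{d_{P,ψ} V} = [θ, i_V] (`DualFrame.iOp_dTwisted`). Together with i_{i_α V} = [e_α,
i_V], this turns the Cartan relations for d_{P,ψ} into Jacobi identities for commutators, and
d_{P,ψ}² = 0 into θ² = 0.

Square zero. Since dψ = 0 and ψ ∧ ψ = 0, the operator d - e_ψ squares to zero. Its conjugate by
exp(i_P) also squares to zero and has components of degrees 3, 1, -1, -3. The component of degree -1
is θ, because [i_P, [i_P, e_ψ]] = 2(∂̲ + i_Y); the component of degree -3 vanishes exactly by ½[P,P]
= (∧³P^♯)ψ. Hence θ² = 0. `sq_eq_zero_of_commutators` does this with iterated commutators in place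
of the exponential.

Volume form. θλ = i_Z λ, from ∂_P λ = -i_X λ and ∂̲λ = -2 i_Y λ. Applying i_{d_{P,ψ} V} = [θ, i_V]
to λ gives ∂_{P,ψ,λ} = -θ + i_Z, which is the last assertion. Since θ(1) = 0, evaluating the derived
bracket at 1 shows that -θ generates the bracket, and adding the derivation i_Z changes nothing. The
square vanishes because ∂_{P,ψ,λ} is conjugate to -d_{P,ψ}.

The algebra only needs finite dual frames of Γ(A) and Γ(A*) and a multivector Λ with i_Λ λ = 1. Both
come from the volume form: λ is a finite sum of products of 1-forms, these 1-forms separate the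
points of each fibre, and the metric that is the sum of their squares gives the frame. -/

theorem exterior_left_induction {p : ExteriorAlgebra R M → Prop}
    (algebraMap : ∀ r, p (algebraMap R _ r)) (add : ∀ x y, p x → p y → p (x + y))
    (ι_mul : ∀ m w, p w → p (ExteriorAlgebra.ι R m * w)) (w : ExteriorAlgebra R M) : p w :=
  CliffordAlgebra.left_induction (Q := (0 : QuadraticForm R M)) (P := p) algebraMap add
    (fun w m h => ι_mul m w h) w

theorem exteriorPower_left_induction {p : ℕ → ExteriorAlgebra R M → Prop}
    (algebraMap : ∀ r, p 0 (algebraMap R _ r)) (add : ∀ n x y, p n x → p n y → p n (x + y))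
    (ι_mul : ∀ n m w, w ∈ ⋀[R]^n M → p n w → p (n + 1) (ExteriorAlgebra.ι R m * w))
    (n : ℕ) (w : ExteriorAlgebra R M) (hw : w ∈ ⋀[R]^n M) : p n w := by
  refine Submodule.pow_induction_on_left' (C := fun n w _ => p n w) _ algebraMap
    (fun x y i _ _ hx hy => add i x y hx hy) ?_ hw
  rintro _ ⟨m, rfl⟩ i x hx h
  exact ι_mul i m x hx h

theorem ι_mem (m : M) : ExteriorAlgebra.ι R m ∈ ⋀[R]^1 M := by
  rw [ExteriorAlgebra.exteriorPower, pow_one]; exact ⟨m, rfl⟩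

theorem algebraMap_mem (r : R) : algebraMap R (ExteriorAlgebra R M) r ∈ ⋀[R]^0 M := by
  rw [ExteriorAlgebra.exteriorPower, pow_zero]; exact ⟨r, (Algebra.algebraMap_eq_smul_one r).symm⟩

theorem exists_algebraMap_of_mem {w : ExteriorAlgebra R M} (hw : w ∈ ⋀[R]^0 M) :
    ∃ r, w = algebraMap R _ r := by
  rw [ExteriorAlgebra.exteriorPower, pow_zero] at hw
  obtain ⟨r, rfl⟩ := Submodule.mem_one.mp hw
  exact ⟨r, rfl⟩

theorem exists_ι_of_mem {w : ExteriorAlgebra R M} (hw : w ∈ ⋀[R]^1 M) :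
    ∃ m, w = ExteriorAlgebra.ι R m := by
  rw [ExteriorAlgebra.exteriorPower, pow_one] at hw
  obtain ⟨r, rfl⟩ := hw
  exact ⟨r, rfl⟩

theorem exteriorPower_mul_mem {p q r : ℕ} (h : p + q = r) {a b : ExteriorAlgebra R M}
    (ha : a ∈ ⋀[R]^p M) (hb : b ∈ ⋀[R]^q M) : a * b ∈ ⋀[R]^r M := by
  subst h
  rw [ExteriorAlgebra.exteriorPower, pow_add]
  exact Submodule.mul_mem_mul ha hb

theorem smul_eq_algebraMap_mul (r : R) (w : ExteriorAlgebra R M) :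
    r • w = algebraMap R _ r * w := Algebra.smul_def r w

/-- Induction on homogeneous components. -/
theorem exterior_homogeneous_induction {p : ExteriorAlgebra R M → Prop}
    (add : ∀ x y, p x → p y → p (x + y))
    (mem : ∀ (n : ℕ), ∀ w ∈ ⋀[R]^n M, p w) (w : ExteriorAlgebra R M) : p w := by
  classical
  refine DirectSum.Decomposition.inductionOn (fun n : ℕ => ⋀[R]^n M) ?_ ?_ ?_ w
  · exact mem 0 0 (Submodule.zero_mem _)
  · intro i m; exact mem i m m.2
  · intro a b; exact add a b

/-- The grading involution. -/
def invol : ExteriorAlgebra R M →ₐ[R] ExteriorAlgebra R M :=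
  CliffordAlgebra.involute (Q := (0 : QuadraticForm R M))

@[simp] theorem invol_ι (m : M) :
    invol (ExteriorAlgebra.ι R m) = - ExteriorAlgebra.ι R m :=
  CliffordAlgebra.involute_ι m

@[simp] theorem invol_invol (w : ExteriorAlgebra R M) : invol (invol w) = w :=
  CliffordAlgebra.involute_involute w

theorem invol_of_mem {n : ℕ} {w : ExteriorAlgebra R M} (hw : w ∈ ⋀[R]^n M) :
    invol w = (-1 : R) ^ n • w := by
  refine exteriorPower_left_induction (p := fun n w => invol w = (-1 : R) ^ n • w) ?_ ?_ ?_ n w hw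
  · intro r; simp
  · intro n x y hx hy; rw [map_add, hx, hy, smul_add]
  · intro n m w _ h
    rw [map_mul, h, invol_ι, pow_succ]; simp

theorem ι_mul_eq (m : M) (w : ExteriorAlgebra R M) :
    ExteriorAlgebra.ι R m * w = invol w * ExteriorAlgebra.ι R m := by
  induction w using exterior_left_induction with
  | algebraMap r => simp [Algebra.commutes]
  | add x y hx hy => simp [mul_add, add_mul, hx, hy]
  | ι_mul n w h =>
    have := ExteriorAlgebra.ι_add_mul_swap (R := R) m n
    rw [← mul_assoc, eq_neg_of_add_eq_zero_left this, map_mul, mul_assoc (invol _), ← h, invol_ι]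
    simp [mul_assoc]

/-- Graded commutativity. Parity is expressed through the grading involution rather than a degree,
so that inhomogeneous elements are covered. -/
theorem mul_eq_of_invol_eq {b : ExteriorAlgebra R M} (hb : invol b = b)
    (a : ExteriorAlgebra R M) : a * b = b * a := by
  induction a using exterior_left_induction with
  | algebraMap r => exact Algebra.commutes r b
  | add x y hx hy => simp [mul_add, add_mul, hx, hy]
  | ι_mul n w h => rw [mul_assoc, h, ← mul_assoc, ι_mul_eq, hb, mul_assoc]

theorem mul_eq_of_invol_eq_neg {b : ExteriorAlgebra R M} (hb : invol b = -b)
    (a : ExteriorAlgebra R M) : a * b = b * invol a := by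
  induction a using exterior_left_induction with
  | algebraMap r => simpa using Algebra.commutes r b
  | add x y hx hy => simp [mul_add, add_mul, hx, hy]
  | ι_mul n w h => rw [mul_assoc, h, ← mul_assoc, ι_mul_eq, hb, map_mul, invol_ι]; simp [mul_assoc]

theorem ι_mul_invol (m : M) (w : ExteriorAlgebra R M) :
    invol w * ExteriorAlgebra.ι R m = ExteriorAlgebra.ι R m * w := (ι_mul_eq m w).symm

/-! ### Contractions -/

theorem contract_ι_mul (α : Module.Dual R M) (m : M) (w : ExteriorAlgebra R M) :
    contract α (ExteriorAlgebra.ι R m * w) =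
      α m • w - ExteriorAlgebra.ι R m * contract α w :=
  CliffordAlgebra.contractLeft_ι_mul (Q := (0 : QuadraticForm R M)) (d := α) m w

@[simp] theorem contract_algebraMap (α : Module.Dual R M) (r : R) :
    contract α (algebraMap R (ExteriorAlgebra R M) r) = 0 :=
  CliffordAlgebra.contractLeft_algebraMap (0 : QuadraticForm R M) (d := α) r

@[simp] theorem contract_one (α : Module.Dual R M) :
    contract α (1 : ExteriorAlgebra R M) = 0 :=
  CliffordAlgebra.contractLeft_one (0 : QuadraticForm R M) (d := α)

@[simp] theorem contract_ι (α : Module.Dual R M) (m : M) :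
    contract α (ExteriorAlgebra.ι R m) = algebraMap R _ (α m) :=
  CliffordAlgebra.contractLeft_ι (0 : QuadraticForm R M) (d := α) m

theorem contract_comm (α β : Module.Dual R M) (w : ExteriorAlgebra R M) :
    contract α (contract β w) = - contract β (contract α w) :=
  CliffordAlgebra.contractLeft_comm α β w

theorem contract_add (α β : Module.Dual R M) : contract (α + β) = contract α + contract β :=
  map_add (CliffordAlgebra.contractLeft (Q := (0 : QuadraticForm R M))) α β

theorem contract_smul (r : R) (α : Module.Dual R M) : contract (r • α) = r • contract α :=
  map_smul (CliffordAlgebra.contractLeft (Q := (0 : QuadraticForm R M))) r α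

theorem contract_invol (α : Module.Dual R M) (w : ExteriorAlgebra R M) :
    contract α (invol w) = - invol (contract α w) := by
  induction w using exterior_left_induction with
  | algebraMap r => simp
  | add x y hx hy => rw [map_add, map_add, hx, hy, map_add, map_add, neg_add]
  | ι_mul n w h =>
    rw [map_mul, invol_ι, neg_mul, map_neg, contract_ι_mul, contract_ι_mul, h, map_sub, map_mul]
    simp

theorem contract_mul (α : Module.Dual R M) (a b : ExteriorAlgebra R M) :
    contract α (a * b) = contract α a * b + invol a * contract α b := by
  induction a using exterior_left_induction with
  | algebraMap r => rw [← smul_eq_algebraMap_mul, map_smul]; simp [smul_eq_algebraMap_mul]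
  | add x y hx hy => simp only [add_mul, map_add, hx, hy]; abel
  | ι_mul n w h =>
    rw [mul_assoc, contract_ι_mul, h, contract_ι_mul, map_mul, invol_ι]
    simp [mul_add, sub_mul, mul_assoc]; abel

theorem contract_mem_zero (α : Module.Dual R M) {w : ExteriorAlgebra R M} (hw : w ∈ ⋀[R]^0 M) :
    contract α w = 0 := by
  obtain ⟨r, rfl⟩ := exists_algebraMap_of_mem hw
  simp

theorem contract_mem (α : Module.Dual R M) {n : ℕ} {w : ExteriorAlgebra R M}
    (hw : w ∈ ⋀[R]^(n + 1) M) : contract α w ∈ ⋀[R]^n M := by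
  suffices H : ∀ n, ∀ w ∈ ⋀[R]^n M, ∀ k, n = k + 1 → contract α w ∈ ⋀[R]^k M from H _ w hw n rfl
  intro n w hw
  refine exteriorPower_left_induction
    (p := fun n w => ∀ k, n = k + 1 → contract α w ∈ ⋀[R]^k M) ?_ ?_ ?_ n w hw
  · intro r k h; omega
  · intro n x y hx hy k h
    rw [map_add]; exact Submodule.add_mem _ (hx k h) (hy k h)
  · intro n m w hw ih k h
    obtain rfl : n = k := by omega
    rw [contract_ι_mul]
    refine Submodule.sub_mem _ (Submodule.smul_mem _ _ hw) ?_
    cases n with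
    | zero => rw [contract_mem_zero α hw, mul_zero]; exact Submodule.zero_mem _
    | succ j => exact exteriorPower_mul_mem (by omega) (ι_mem m) (ih j rfl)

end ExteriorBasics

/-! ### Paired modules with finite dual frames -/

section Frames

variable {R E E' : Type*} [CommRing R] [AddCommGroup E] [Module R E] [AddCommGroup E'] [Module R E']

/-- Finite families of `E` and `E'` which are dual frames for the pairing `ev`. -/
structure DualFrame (ev : E' →ₗ[R] Module.Dual R E) (n : ℕ) where
  x : Fin n → E
  ξ : Fin n → E'
  sum_x : ∀ X, ∑ i, ev (ξ i) X • x i = X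
  sum_ξ : ∀ ζ, ∑ i, ev ζ (x i) • ξ i = ζ

variable {ev : E' →ₗ[R] Module.Dual R E} {n : ℕ}

/-- Contraction of forms on `E` by an element of `E`. -/
def ctr (ev : E' →ₗ[R] Module.Dual R E) (X : E) : ExteriorAlgebra R E' →ₗ[R] ExteriorAlgebra R E' :=
  contract (ev.flip X)

theorem ctr_ι_mul (X : E) (ζ : E') (w : ExteriorAlgebra R E') :
    ctr ev X (ExteriorAlgebra.ι R ζ * w) = ev ζ X • w - ExteriorAlgebra.ι R ζ * ctr ev X w :=
  contract_ι_mul _ _ _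

@[simp] theorem ctr_algebraMap (X : E) (r : R) :
    ctr ev X (algebraMap R (ExteriorAlgebra R E') r) = 0 := contract_algebraMap _ _

@[simp] theorem ctr_ι (X : E) (ζ : E') :
    ctr ev X (ExteriorAlgebra.ι R ζ) = algebraMap R _ (ev ζ X) := contract_ι _ _

theorem ctr_comm (X Y : E) (w : ExteriorAlgebra R E') :
    ctr ev X (ctr ev Y w) = - ctr ev Y (ctr ev X w) := contract_comm _ _ _

theorem ctr_mul (X : E) (a b : ExteriorAlgebra R E') :
    ctr ev X (a * b) = ctr ev X a * b + invol a * ctr ev X b := contract_mul _ _ _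

theorem ctr_mem (X : E) {q : ℕ} {w : ExteriorAlgebra R E'} (hw : w ∈ ⋀[R]^(q + 1) E') :
    ctr ev X w ∈ ⋀[R]^q E' := contract_mem _ hw

/-- Euler's identity: the operator on the left is an even derivation, zero on functions and the
identity in degree one, so it counts the degree. -/
theorem DualFrame.euler (F : DualFrame ev n) {q : ℕ} {w : ExteriorAlgebra R E'}
    (hw : w ∈ ⋀[R]^q E') :
    ∑ i, ExteriorAlgebra.ι R (F.ξ i) * ctr ev (F.x i) w = (q : R) • w := by
  refine exteriorPower_left_induction (p := fun q w =>
    ∑ i, ExteriorAlgebra.ι R (F.ξ i) * ctr ev (F.x i) w = (q : R) • w) ?_ ?_ ?_ q w hw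
  · intro r; simp
  · intro q x y hx hy
    simp only [map_add, mul_add, Finset.sum_add_distrib, hx, hy, smul_add]
  · intro q ζ w _ h
    have e : ∀ i, ExteriorAlgebra.ι R (F.ξ i) * ctr ev (F.x i) (ExteriorAlgebra.ι R ζ * w) =
        ExteriorAlgebra.ι R (ev ζ (F.x i) • F.ξ i) * w +
        ExteriorAlgebra.ι R ζ * (ExteriorAlgebra.ι R (F.ξ i) * ctr ev (F.x i) w) := by
      intro i
      have := eq_neg_of_add_eq_zero_left (ExteriorAlgebra.ι_add_mul_swap (R := R) (F.ξ i) ζ)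
      rw [ctr_ι_mul, mul_sub, ← mul_assoc, ← mul_assoc (ExteriorAlgebra.ι R ζ), this]
      simp
    simp only [e, Finset.sum_add_distrib, ← Finset.sum_mul, ← map_sum, F.sum_ξ, ← Finset.mul_sum,
      h, Nat.cast_add, Nat.cast_one, add_smul, one_smul, mul_smul_comm]
    abel

end Frames

/-! ### Forms are determined by their values -/

section FramesReal

variable {R E E' : Type*} [CommRing R] [Algebra ℝ R] [AddCommGroup E] [Module R E]
  [AddCommGroup E'] [Module R E'] {ev : E' →ₗ[R] Module.Dual R E} {n : ℕ}

theorem natCast_succ_smul_eq_zero {V : Type*} [AddCommGroup V] [Module R V] {q : ℕ} {v : V}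
    (h : ((q + 1 : ℕ) : R) • v = 0) : v = 0 := by
  have hu : IsUnit ((q + 1 : ℕ) : R) := by
    have : IsUnit ((q + 1 : ℕ) : ℝ) := isUnit_iff_ne_zero.mpr (by positivity)
    simpa using this.map (algebraMap ℝ R)
  exact (hu.smul_eq_zero).mp h

/-- Immediate from Euler's identity, positive integers being invertible in an `ℝ`-algebra. -/
theorem DualFrame.eq_zero_of_ctr (F : DualFrame ev n) {q : ℕ} {w : ExteriorAlgebra R E'}
    (hw : w ∈ ⋀[R]^(q + 1) E') (h : ∀ X, ctr ev X w = 0) : w = 0 := by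
  have := F.euler hw
  simp only [h, mul_zero, Finset.sum_const_zero] at this
  exact natCast_succ_smul_eq_zero this.symm

/-- Iterated contraction of `w` by the `a i`, starting with the first one, followed by the
projection to functions. -/
def formEval (ev : E' →ₗ[R] Module.Dual R E) :
    (q : ℕ) → ExteriorAlgebra R E' →ₗ[R] ((Fin q → E) → R)
  | 0 => LinearMap.pi fun _ => ExteriorAlgebra.algebraMapInv.toLinearMap
  | q + 1 => LinearMap.pi fun a => LinearMap.proj (Fin.tail a) ∘ₗ formEval ev q ∘ₗ ctr ev (a 0)

theorem formEval_zero (w : ExteriorAlgebra R E') (a : Fin 0 → E) :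
    formEval ev 0 w a = ExteriorAlgebra.algebraMapInv w := rfl

theorem formEval_succ {q : ℕ} (w : ExteriorAlgebra R E') (a : Fin (q + 1) → E) :
    formEval ev (q + 1) w a = formEval ev q (ctr ev (a 0) w) (Fin.tail a) := rfl

theorem formEval_cons {q : ℕ} (w : ExteriorAlgebra R E') (X : E) (a : Fin q → E) :
    formEval ev (q + 1) w (Fin.cons X a) = formEval ev q (ctr ev X w) a := by
  rw [formEval_succ]; rfl

theorem ctr_ιMulti (X : E) : ∀ {q : ℕ} (v : Fin (q + 1) → E'),
    ctr ev X (ExteriorAlgebra.ιMulti R (q + 1) v) =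
      ∑ i : Fin (q + 1), ((-1 : R) ^ (i : ℕ) * ev (v i) X) •
        ExteriorAlgebra.ιMulti R q (v ∘ i.succAbove)
  | 0, v => by
    rw [ExteriorAlgebra.ιMulti_succ_apply, ctr_ι_mul]
    have : ctr ev X (ExteriorAlgebra.ιMulti R 0 (Matrix.vecTail v)) = 0 := by
      rw [ExteriorAlgebra.ιMulti_zero_apply]; exact contract_one _
    rw [this]; simp
  | q + 1, v => by
    rw [ExteriorAlgebra.ιMulti_succ_apply, ctr_ι_mul, ctr_ιMulti X,
      Fin.sum_univ_succ (fun i : Fin (q + 2) => _), sub_eq_add_neg]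
    congr 1
    · rw [Fin.val_zero, pow_zero, one_mul]; rfl
    · rw [Finset.mul_sum, ← Finset.sum_neg_distrib]
      refine Finset.sum_congr rfl fun i _ => ?_
      rw [ExteriorAlgebra.ιMulti_succ_apply, mul_smul_comm, ← neg_smul]
      congr 1
      · simp [Matrix.vecTail, pow_succ]
      · congr 2
        funext j
        simp [Matrix.vecTail, Fin.succ_succAbove_succ]

/-- Contracting with the first vector is the Laplace expansion of the determinant along its first
row. -/
theorem formEval_ιMulti : ∀ {q : ℕ} (v : Fin q → E') (a : Fin q → E),
    formEval ev q (ExteriorAlgebra.ιMulti R q v) a = Matrix.det (Matrix.of fun i j => ev (v j) (a i))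
  | 0, v, a => by
    rw [formEval_zero, ExteriorAlgebra.ιMulti_zero_apply]; simp
  | q + 1, v, a => by
    rw [formEval_succ, ctr_ιMulti, map_sum, Finset.sum_apply, Matrix.det_succ_row_zero]
    refine Finset.sum_congr rfl fun i _ => ?_
    rw [map_smul, Pi.smul_apply, formEval_ιMulti, smul_eq_mul]
    rfl

end FramesReal

section FormValue

variable {R E E' : Type*} [CommRing R] [Algebra ℝ R]
  [AddCommGroup E] [Module R E] [Module ℝ E] [IsScalarTower ℝ R E]
  [AddCommGroup E'] [Module R E'] [Module ℝ E'] [IsScalarTower ℝ R E']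
  {ev : E' →ₗ[R] Module.Dual R E} {n : ℕ}

/-- Replaces the determinant pairing by iterated contractions, which makes inductions on the degree
possible. -/
theorem formValue_eq_formEval {q : ℕ} (w : ⋀[R]^q E') (a : Fin q → E) :
    formValue ev w a = formEval ev q (w : ExteriorAlgebra R E') a := by
  let f : ⋀[R]^q E' →ₗ[R] R := LinearMap.applyₗ (exteriorPower.ιMulti R q a) ∘ₗ
    exteriorPower.pairingDual R E q ∘ₗ exteriorPower.map q ev
  let g : ⋀[R]^q E' →ₗ[R] R := LinearMap.proj a ∘ₗ formEval ev q ∘ₗ (⋀[R]^q E').subtype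
  suffices h : f = g from DFunLike.congr_fun h w
  ext v
  simp only [f, g, LinearMap.compAlternatingMap_apply, LinearMap.comp_apply,
    exteriorPower.map_apply_ιMulti, LinearMap.applyₗ_apply_apply,
    exteriorPower.pairingDual_ιMulti_ιMulti, Submodule.subtype_apply,
    exteriorPower.ιMulti_apply_coe, formEval_ιMulti, LinearMap.proj_apply]
  rfl

theorem DualFrame.eq_zero_of_formEval (F : DualFrame ev n) : ∀ {q : ℕ} {w : ExteriorAlgebra R E'},
    w ∈ ⋀[R]^q E' → (∀ a, formEval ev q w a = 0) → w = 0
  | 0, w, hw, h => by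
    obtain ⟨r, rfl⟩ := exists_algebraMap_of_mem hw
    have := h Fin.elim0
    rw [formEval_zero, ExteriorAlgebra.algebraMap_leftInverse] at this
    rw [this, map_zero]
  | q + 1, w, hw, h => F.eq_zero_of_ctr hw fun X =>
      F.eq_zero_of_formEval (ctr_mem X hw) fun a => by rw [← formEval_cons, h]

theorem DualFrame.eq_of_formEval (F : DualFrame ev n) {q : ℕ} {w w' : ExteriorAlgebra R E'}
    (hw : w ∈ ⋀[R]^q E') (hw' : w' ∈ ⋀[R]^q E')
    (h : ∀ a, formEval ev q w a = formEval ev q w' a) : w = w' :=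
  sub_eq_zero.mp <| F.eq_zero_of_formEval (Submodule.sub_mem _ hw hw') fun a => by
    rw [map_sub, Pi.sub_apply, h, sub_self]

end FormValue

end AnchoredBracket
end

noncomputable section

set_option linter.unusedSectionVars false

namespace AnchoredBracket

/-! ### The Cartan relations imply the Koszul formula -/

section Cartan

variable {R E E' : Type*} [CommRing R] [Algebra ℝ R]
  [AddCommGroup E] [Module R E] [Module ℝ E] [IsScalarTower ℝ R E]
  [AddCommGroup E'] [Module R E'] [Module ℝ E'] [IsScalarTower ℝ R E']
  {ev : E' →ₗ[R] Module.Dual R E} {n : ℕ}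

/-- An operator of degree one satisfying the Cartan relations with the contractions. -/
structure IsCartanDifferential (D : AnchoredBracket R E) (ev : E' →ₗ[R] Module.Dual R E)
    (d : ExteriorAlgebra R E' →ₗ[ℝ] ExteriorAlgebra R E') : Prop where
  mem : ∀ (q : ℕ), ∀ w ∈ ⋀[R]^q E', d w ∈ ⋀[R]^(q + 1) E'
  functions : ∀ (X : E) (f : R), ctr ev X (d (algebraMap R _ f)) = algebraMap R _ (D.anchor X f)
  cartan : ∀ (X Y : E) (w : ExteriorAlgebra R E'),
    ctr ev X (d (ctr ev Y w)) + d (ctr ev X (ctr ev Y w)) -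
      ctr ev Y (ctr ev X (d w) + d (ctr ev X w)) = ctr ev (D.bracket X Y) w

/-- The terms of the Lie derivative of a form which involve the bracket. -/
def lieTerm (D : AnchoredBracket R E) (X : E) :
    (q : ℕ) → ((Fin q → E) → R) → (Fin q → E) → R
  | 0, _, _ => 0
  | q + 1, φ, a => ∑ l : Fin (q + 1), (-1) ^ (l : ℕ) *
      φ (Fin.cons (D.bracket X (a l)) (a ∘ l.succAbove))

theorem comp_succ_succAbove {q : ℕ} (a : Fin (q + 2) → E) (l : Fin (q + 1)) :
    a ∘ l.succ.succAbove = Fin.cons (a 0) (Fin.tail a ∘ l.succAbove) := by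
  funext j
  refine Fin.cases ?_ (fun j => ?_) j
  · simp
  · simp [Fin.tail, Fin.succ_succAbove_succ]

theorem comp_zero_succAbove {q : ℕ} (a : Fin (q + 1) → E) :
    a ∘ (0 : Fin (q + 1)).succAbove = Fin.tail a := by
  funext j; simp [Fin.tail]

/-- Antisymmetry is needed only in the first two arguments, to move the bracket past `a 0`.
Quantifying over `q = r + 1` makes the hypothesis vacuous when there is a single argument. -/
theorem lieTerm_succ (D : AnchoredBracket R E) (X : E) : ∀ {q : ℕ} (φ : (Fin (q + 1) → E) → R)
    (_ : ∀ r (h : q = r + 1) Y Z (b : Fin r → E),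
      φ (Fin.cons Y (h ▸ Fin.cons Z b)) = - φ (Fin.cons Z (h ▸ Fin.cons Y b)))
    (a : Fin (q + 1) → E),
    D.lieTerm X (q + 1) φ a = φ (Fin.cons (D.bracket X (a 0)) (Fin.tail a)) +
      D.lieTerm X q (fun b => φ (Fin.cons (a 0) b)) (Fin.tail a)
  | 0, φ, _, a => by simp [lieTerm]; rfl
  | q + 1, φ, h, a => by
    rw [lieTerm, Fin.sum_univ_succ, lieTerm]
    congr 1
    · rw [comp_zero_succAbove]; simp
    · refine Finset.sum_congr rfl fun l _ => ?_
      rw [comp_succ_succAbove, h q rfl]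
      simp [pow_succ, Fin.tail]

/-- The combinatorial form of i_X d = L_X - d i_X with X = `a 0`: peeling off the first argument
leaves a Lie derivative and a Koszul sum of one degree less. -/
theorem koszul_succ (D : AnchoredBracket R E) : ∀ {q : ℕ} (φ : (Fin (q + 1) → E) → R)
    (_ : ∀ r (h : q = r + 1) Y Z (b : Fin r → E),
      φ (Fin.cons Y (h ▸ Fin.cons Z b)) = - φ (Fin.cons Z (h ▸ Fin.cons Y b)))
    (a : Fin (q + 2) → E),
    D.koszul (q + 1) φ a = D.anchor (a 0) (φ (Fin.tail a)) -
      D.lieTerm (a 0) (q + 1) φ (Fin.tail a) -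
      D.koszul q (fun b => φ (Fin.cons (a 0) b)) (Fin.tail a)
  | 0, φ, _, a => by
    have h1 : a ∘ Fin.succAbove 1 = fun _ => a 0 := by
      funext j; fin_cases j; simp
    have h2 : ∀ (X : E) (g : Fin 0 → E), (Fin.cons X g : Fin 1 → E) = fun _ => X := by
      intro X g; funext j; fin_cases j; rfl
    have h3 : a ∘ Fin.succ = fun _ => a 1 := by
      funext j; fin_cases j; rfl
    have h4 : Fin.tail a = fun _ => a 1 := h3
    simp [koszul, lieTerm, Fin.sum_univ_two, h1, h2, h3, h4]
    ring
  | q + 1, φ, h, a => by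
    rw [koszul, Fin.sum_univ_succ, Fin.sum_univ_succ (n := q + 2) (fun l : Fin (q + 3) => _)]
    simp only [Fin.not_lt_zero, if_false, Finset.sum_const_zero, zero_add]
    rw [koszul, lieTerm]
    -- For the pairs with larger index `l.succ`, `k = 0` gives the bracket with `a 0`. The other `k`
    -- give terms of the smaller Koszul sum, with a sign from exchanging the bracket and `a 0`.
    have e1 : ∀ l : Fin (q + 2),
        (∑ k : Fin (q + 2), if k.castSucc < l.succ then (-1 : R) ^ ((k : ℕ) + (l.succ : ℕ)) *
          φ (Fin.cons (D.bracket (a k.castSucc) (a l.succ)) (a ∘ l.succ.succAbove ∘ k.succAbove))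
          else 0) =
        - ((-1) ^ (l : ℕ) * φ (Fin.cons (D.bracket (a 0) (Fin.tail a l)) (Fin.tail a ∘ l.succAbove)))
        - ∑ k : Fin (q + 1), if k.castSucc < l then (-1 : R) ^ ((k : ℕ) + (l : ℕ)) *
          φ (Fin.cons (a 0) (Fin.cons (D.bracket (Fin.tail a k.castSucc) (Fin.tail a l))
            (Fin.tail a ∘ l.succAbove ∘ k.succAbove))) else 0 := by
      intro l
      rw [Fin.sum_univ_succ, sub_eq_add_neg, ← Finset.sum_neg_distrib]
      congr 1
      · rw [if_pos (by simp), ← Function.comp_assoc, comp_zero_succAbove, comp_succ_succAbove]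
        simp [pow_succ, Fin.tail]
      · refine Finset.sum_congr rfl fun k _ => ?_
        have : k.succ.castSucc < l.succ ↔ k.castSucc < l := by
          simp [Fin.lt_def]
        simp only [this]
        split_ifs
        · rw [← Function.comp_assoc, comp_succ_succAbove a l]
          have e2 : (Fin.cons (a 0) (Fin.tail a ∘ l.succAbove) : Fin (q + 2) → E) ∘
              k.succ.succAbove = Fin.cons (a 0) (Fin.tail a ∘ l.succAbove ∘ k.succAbove) := by
            rw [comp_succ_succAbove]; rfl
          rw [e2, h q rfl]
          simp [pow_add, Fin.tail]
        · simp
    rw [Finset.sum_congr rfl fun l _ => e1 l]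
    simp only [Finset.sum_sub_distrib, Finset.sum_neg_distrib, comp_zero_succAbove,
      comp_succ_succAbove, Fin.val_zero, pow_zero, one_mul, Fin.val_succ, pow_succ, mul_neg, mul_one,
      neg_mul]
    simp only [Fin.tail]
    ring

theorem formEval_swap {q r : ℕ} (w : ExteriorAlgebra R E') (h : q = r + 1) (Y Z : E)
    (b : Fin r → E) :
    formEval ev (q + 1) w (Fin.cons Y (h ▸ Fin.cons Z b)) =
      - formEval ev (q + 1) w (Fin.cons Z (h ▸ Fin.cons Y b)) := by
  subst h
  simp only [formEval_cons]
  rw [ctr_comm, map_neg, Pi.neg_apply]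

namespace IsCartanDifferential

variable {D : AnchoredBracket R E} {d : ExteriorAlgebra R E' →ₗ[ℝ] ExteriorAlgebra R E'}

/-- The relation [L_X, i_Y] = i_{[X,Y]} moves L_X past the successive contractions, each producing
one bracket term, until it acts on a function. -/
theorem formEval_lie (h : D.IsCartanDifferential ev d) (X : E) :
    ∀ {q : ℕ} {w : ExteriorAlgebra R E'} (_ : w ∈ ⋀[R]^q E') (a : Fin q → E),
    formEval ev q (ctr ev X (d w) + d (ctr ev X w)) a =
      D.anchor X (formEval ev q w a) - D.lieTerm X q (formEval ev q w) a
  | 0, w, hw, a => by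
    obtain ⟨f, rfl⟩ := exists_algebraMap_of_mem hw
    rw [ctr_algebraMap, map_zero, add_zero, h.functions]
    simp [formEval_zero, lieTerm, ExteriorAlgebra.algebraMapInv]
  | q + 1, w, hw, a => by
    have e := h.cartan X (a 0) w
    rw [sub_eq_iff_eq_add, ← sub_eq_iff_eq_add'] at e
    rw [formEval_succ, ← e, map_sub, Pi.sub_apply, h.formEval_lie X (ctr_mem _ hw),
      D.lieTerm_succ X _ (fun r hr Y Z b => formEval_swap w hr Y Z b)]
    have e2 : formEval ev q (ctr ev (a 0) w) = fun b => formEval ev (q + 1) w (Fin.cons (a 0) b) :=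
      funext fun b => (formEval_cons w (a 0) b).symm
    rw [e2, formEval_cons]
    simp only [Fin.cons_self_tail]
    ring

/-- Induction through i_X d = L_X - d i_X, matched term by term with `koszul_succ`. -/
theorem formEval_d (h : D.IsCartanDifferential ev d) :
    ∀ {q : ℕ} {w : ExteriorAlgebra R E'} (_ : w ∈ ⋀[R]^q E') (a : Fin (q + 1) → E),
    formEval ev (q + 1) (d w) a = D.koszul q (formEval ev q w) a
  | 0, w, hw, a => by
    obtain ⟨f, rfl⟩ := exists_algebraMap_of_mem hw
    rw [formEval_succ, h.functions]
    simp [formEval_zero, koszul, ExteriorAlgebra.algebraMapInv]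
  | q + 1, w, hw, a => by
    have e : ctr ev (a 0) (d w) = (ctr ev (a 0) (d w) + d (ctr ev (a 0) w)) - d (ctr ev (a 0) w) := by
      abel
    rw [formEval_succ, e, map_sub, Pi.sub_apply, h.formEval_lie _ hw, h.formEval_d (ctr_mem _ hw),
      D.koszul_succ _ (fun r hr Y Z b => formEval_swap w hr Y Z b)]
    have e2 : formEval ev q (ctr ev (a 0) w) = fun b => formEval ev (q + 1) w (Fin.cons (a 0) b) :=
      funext fun b => (formEval_cons w (a 0) b).symm
    rw [e2]

theorem isDifferential (h : D.IsCartanDifferential ev d) : D.IsDifferential ev d := by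
  intro q w
  refine ⟨⟨d w, h.mem q w w.2⟩, rfl, fun a => ?_⟩
  rw [formValue_eq_formEval]
  have : formValue ev w = formEval ev q (w : ExteriorAlgebra R E') :=
    funext fun a => formValue_eq_formEval w a
  rw [this]
  exact h.formEval_d w.2 a

end IsCartanDifferential

theorem IsDifferential.unique (F : DualFrame ev n) {D : AnchoredBracket R E}
    {d d' : ExteriorAlgebra R E' →ₗ[ℝ] ExteriorAlgebra R E'}
    (h : D.IsDifferential ev d) (h' : D.IsDifferential ev d') : d = d' := by
  ext w
  induction w using exterior_homogeneous_induction with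
  | add x y hx hy => rw [map_add, map_add, hx, hy]
  | mem q w hw =>
    obtain ⟨η, e, hη⟩ := h q ⟨w, hw⟩
    obtain ⟨η', e', hη'⟩ := h' q ⟨w, hw⟩
    dsimp only at e e'
    rw [e, e']
    refine F.eq_of_formEval η.2 η'.2 fun a => ?_
    rw [← formValue_eq_formEval, ← formValue_eq_formEval, hη, hη']

end Cartan

end AnchoredBracket
end

noncomputable section

set_option linter.unusedSectionVars false

namespace AnchoredBracket

/-! ### Construction of odd derivations by a twisted square-zero extension -/

section OddDerivation

variable {R E : Type*} [CommRing R] [AddCommGroup E] [Module R E]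

variable (R E) in
/-- The exterior algebra as a bimodule over itself, with left action twisted by the grading
involution. -/
def TwistedBimodule : Type _ := ExteriorAlgebra R E

instance : AddCommGroup (TwistedBimodule R E) := inferInstanceAs (AddCommGroup (ExteriorAlgebra R E))

instance : Module (ExteriorAlgebra R E) (TwistedBimodule R E) :=
  Module.compHom (ExteriorAlgebra R E) (invol (R := R) (M := E)).toRingHom

instance : Module (ExteriorAlgebra R E)ᵐᵒᵖ (TwistedBimodule R E) :=
  inferInstanceAs (Module (ExteriorAlgebra R E)ᵐᵒᵖ (ExteriorAlgebra R E))

/-- The identity map, as an additive equivalence. -/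
def toTwisted : ExteriorAlgebra R E ≃+ TwistedBimodule R E := AddEquiv.refl _

theorem smul_toTwisted (a w : ExteriorAlgebra R E) :
    a • toTwisted w = toTwisted (invol a * w) := rfl

theorem op_smul_toTwisted (a w : ExteriorAlgebra R E) :
    MulOpposite.op a • toTwisted w = toTwisted (w * a) := rfl

instance : SMulCommClass (ExteriorAlgebra R E) (ExteriorAlgebra R E)ᵐᵒᵖ (TwistedBimodule R E) where
  smul_comm a b w := by
    obtain ⟨b, rfl⟩ := MulOpposite.op_surjective b
    obtain ⟨w, rfl⟩ := toTwisted.surjective w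
    rw [op_smul_toTwisted, smul_toTwisted, smul_toTwisted, op_smul_toTwisted, mul_assoc]

variable [Algebra ℝ R] [Module ℝ E] [IsScalarTower ℝ R E]

/-- A derivation of `R` with values in `E`, as a ring homomorphism to the twisted square-zero
extension of `⋀ E`. -/
def twistedScalars (δ : Derivation ℝ R E) :
    R →+* TrivSqZeroExt (ExteriorAlgebra R E) (TwistedBimodule R E) where
  toFun f := (algebraMap R _ f, toTwisted (ExteriorAlgebra.ι R (δ f)))
  map_one' := by
    refine TrivSqZeroExt.ext ?_ ?_
    · exact map_one _
    · change toTwisted (ExteriorAlgebra.ι R (δ 1)) = 0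
      rw [Derivation.map_one_eq_zero, map_zero, map_zero]
  map_zero' := by
    refine TrivSqZeroExt.ext ?_ ?_
    · exact map_zero _
    · change toTwisted (ExteriorAlgebra.ι R (δ 0)) = 0
      rw [map_zero, map_zero, map_zero]
  map_add' f g := by
    refine TrivSqZeroExt.ext ?_ ?_
    · exact map_add _ _ _
    · change toTwisted (ExteriorAlgebra.ι R (δ (f + g))) = toTwisted _ + toTwisted _
      rw [map_add, map_add, map_add]
  map_mul' f g := by
    refine TrivSqZeroExt.ext ?_ ?_
    · exact map_mul _ _ _
    · change toTwisted (ExteriorAlgebra.ι R (δ (f * g))) =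
        algebraMap R (ExteriorAlgebra R E) f • toTwisted (ExteriorAlgebra.ι R (δ g)) +
        MulOpposite.op (algebraMap R (ExteriorAlgebra R E) g) •
          toTwisted (ExteriorAlgebra.ι R (δ f))
      rw [smul_toTwisted, op_smul_toTwisted, ← map_add, AlgHom.commutes, ← Algebra.commutes,
        ← Algebra.smul_def, ← Algebra.smul_def, ← map_smul (ExteriorAlgebra.ι R),
        ← map_smul (ExteriorAlgebra.ι R), ← map_add (ExteriorAlgebra.ι R), Derivation.leibniz]

/-- Existence of odd derivations of the exterior algebra with prescribed values on functions and on
elements of degree one. -/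
theorem exists_odd_derivation (δ : Derivation ℝ R E) (τ : E →+ ExteriorAlgebra R E)
    (hτ : ∀ (f : R) (X : E), τ (f • X) =
      f • τ X + ExteriorAlgebra.ι R (δ f) * ExteriorAlgebra.ι R X)
    (hτ' : ∀ X, invol (τ X) = τ X) :
    ∃ d : ExteriorAlgebra R E →ₗ[ℝ] ExteriorAlgebra R E,
      (∀ f, d (algebraMap R _ f) = ExteriorAlgebra.ι R (δ f)) ∧
      (∀ X, d (ExteriorAlgebra.ι R X) = τ X) ∧
      ∀ a b, d (a * b) = d a * b + invol a * d b := by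
  let T := TrivSqZeroExt (ExteriorAlgebra R E) (TwistedBimodule R E)
  -- The scalars act through f ↦ (f, δf), so that an `R`-algebra map into `T` has a second component
  -- that differentiates scalars. Centrality holds because δf has degree one and the left action is
  -- twisted.
  let _ : Algebra R T := (twistedScalars δ).toAlgebra' fun f t => by
    obtain ⟨a, w⟩ := t
    obtain ⟨w, rfl⟩ := toTwisted.surjective w
    refine TrivSqZeroExt.ext (Algebra.commutes _ _) ?_
    change algebraMap R (ExteriorAlgebra R E) f • toTwisted w +
      MulOpposite.op a • toTwisted (ExteriorAlgebra.ι R (δ f)) =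
      a • toTwisted (ExteriorAlgebra.ι R (δ f)) +
        MulOpposite.op (algebraMap R (ExteriorAlgebra R E) f) • toTwisted w
    rw [smul_toTwisted, op_smul_toTwisted, smul_toTwisted, op_smul_toTwisted, ι_mul_invol,
      AlgHom.commutes, Algebra.commutes, add_comm]
  let g : E →ₗ[R] T :=
    { toFun := fun X => (ExteriorAlgebra.ι R X, toTwisted (τ X))
      map_add' := fun X Y => by
        refine TrivSqZeroExt.ext (map_add _ _ _) ?_
        change toTwisted (τ (X + Y)) = toTwisted (τ X) + toTwisted (τ Y)
        rw [map_add, map_add]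
      map_smul' := fun f X => by
        refine Eq.trans (TrivSqZeroExt.ext ?_ ?_) (Algebra.smul_def (A := T) f _).symm
        · change ExteriorAlgebra.ι R (f • X) = algebraMap R _ f * ExteriorAlgebra.ι R X
          rw [map_smul, Algebra.smul_def]
        · change toTwisted (τ (f • X)) = algebraMap R (ExteriorAlgebra R E) f • toTwisted (τ X) +
            MulOpposite.op (ExteriorAlgebra.ι R X) • toTwisted (ExteriorAlgebra.ι R (δ f))
          rw [smul_toTwisted, op_smul_toTwisted, hτ, AlgHom.commutes, ← Algebra.smul_def, map_add] }
  -- The second component of the square is -X τ(X) + τ(X) X, and τ(X) is even, hence central.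
  have hg : ∀ X, g X * g X = 0 := fun X => by
    refine TrivSqZeroExt.ext (ExteriorAlgebra.ι_sq_zero X) ?_
    change ExteriorAlgebra.ι R X • toTwisted (τ X) +
      MulOpposite.op (ExteriorAlgebra.ι R X) • toTwisted (τ X) = 0
    rw [smul_toTwisted, op_smul_toTwisted, ← map_add, invol_ι, neg_mul,
      mul_eq_of_invol_eq (hτ' X), neg_add_cancel, map_zero]
  let Φ : ExteriorAlgebra R E →ₐ[R] T := ExteriorAlgebra.lift R ⟨g, hg⟩
  have hΦι : ∀ X, Φ (ExteriorAlgebra.ι R X) = g X := fun X =>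
    ExteriorAlgebra.lift_ι_apply R g hg X
  have hΦr : ∀ f, Φ (algebraMap R _ f) = twistedScalars δ f := fun f => Φ.commutes f
  have hfst : ∀ w, (Φ w).fst = w := by
    intro w
    induction w using exterior_left_induction with
    | algebraMap r => rw [hΦr]; rfl
    | add x y hx hy => rw [map_add, TrivSqZeroExt.fst_add, hx, hy]
    | ι_mul m w h => rw [map_mul, TrivSqZeroExt.fst_mul, h, hΦι]; rfl
  let D : ExteriorAlgebra R E → ExteriorAlgebra R E := fun w => toTwisted.symm (Φ w).snd
  -- The product of the twisted extension, read in its second component, is the odd Leibniz rule.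
  have hmul : ∀ a b, D (a * b) = D a * b + invol a * D b := by
    intro a b
    apply toTwisted.injective
    change (Φ (a * b)).snd = _
    rw [map_mul, TrivSqZeroExt.snd_mul, hfst, hfst, map_add, ← smul_toTwisted, ← op_smul_toTwisted,
      add_comm]
    rfl
  have hr : ∀ f, D (algebraMap R _ f) = ExteriorAlgebra.ι R (δ f) := fun f => by
    change toTwisted.symm (Φ _).snd = _
    rw [hΦr]; rfl
  refine ⟨{ toFun := D, map_add' := fun x y => ?_, map_smul' := fun c x => ?_ }, hr, ?_, hmul⟩
  · change toTwisted.symm (Φ (x + y)).snd = _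
    rw [map_add, TrivSqZeroExt.snd_add, map_add]
  · rw [← algebraMap_smul R c x, Algebra.smul_def, hmul, hr, Derivation.map_algebraMap, map_zero,
      zero_mul, zero_add, AlgHom.commutes, ← Algebra.smul_def, RingHom.id_apply, algebraMap_smul]
  · intro X
    change toTwisted.symm (Φ _).snd = _
    rw [hΦι]; rfl

end OddDerivation

/-! ### Existence of the differential, and when it squares to zero -/

section Existence

variable {R E E' : Type*} [CommRing R] [Algebra ℝ R]
  [AddCommGroup E] [Module R E] [Module ℝ E] [IsScalarTower ℝ R E]
  [AddCommGroup E'] [Module R E'] [Module ℝ E'] [IsScalarTower ℝ R E']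
  {ev : E' →ₗ[R] Module.Dual R E} {n : ℕ}

/-- The `2`-form with values `b X Y - b Y X`, up to the factor `1 / 2`. -/
def DualFrame.twoForm (F : DualFrame ev n) (b : E →ₗ[R] E →ₗ[R] R) : ExteriorAlgebra R E' :=
  (1 / 2 : ℝ) • ∑ i, ∑ j, b (F.x i) (F.x j) • (ExteriorAlgebra.ι R (F.ξ i) * ExteriorAlgebra.ι R (F.ξ j))

theorem DualFrame.twoForm_mem (F : DualFrame ev n) (b : E →ₗ[R] E →ₗ[R] R) :
    F.twoForm b ∈ ⋀[R]^2 E' := by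
  rw [twoForm, ← algebraMap_smul R]
  exact Submodule.smul_mem _ _ (Submodule.sum_mem _ fun i _ => Submodule.sum_mem _ fun j _ =>
    Submodule.smul_mem _ _ (exteriorPower_mul_mem rfl (ι_mem _) (ι_mem _)))

theorem ctr_ctr_ι_mul_ι (X Y : E) (ξ ζ : E') :
    ctr ev Y (ctr ev X (ExteriorAlgebra.ι R ξ * ExteriorAlgebra.ι R ζ)) =
      algebraMap R _ (ev ξ X * ev ζ Y - ev ζ X * ev ξ Y) := by
  rw [ctr_ι_mul, ctr_ι, map_sub, map_smul, ctr_ι, ctr_ι_mul, ctr_algebraMap, mul_zero, sub_zero,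
    Algebra.smul_def, Algebra.smul_def, map_sub, map_mul, map_mul,
    ← Algebra.commutes (ev ζ X)]


theorem DualFrame.sum_bilin (F : DualFrame ev n) (b : E →ₗ[R] E →ₗ[R] R) (X Y : E) :
    ∑ i, ∑ j, b (F.x i) (F.x j) * (ev (F.ξ i) X * ev (F.ξ j) Y) = b X Y := by
  conv_rhs => rw [← F.sum_x X, ← F.sum_x Y]
  simp only [map_sum, map_smul, LinearMap.sum_apply, LinearMap.smul_apply, smul_eq_mul,
    Finset.mul_sum]
  rw [Finset.sum_comm]
  exact Finset.sum_congr rfl fun i _ => Finset.sum_congr rfl fun j _ => by ring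

/-- The factor 1/2 compensates for the wedge product antisymmetrizing a form that is already skew.
-/
theorem DualFrame.ctr_ctr_twoForm (F : DualFrame ev n) (b : E →ₗ[R] E →ₗ[R] R)
    (hb : ∀ X Y, b X Y = - b Y X) (X Y : E) :
    ctr ev Y (ctr ev X (F.twoForm b)) = algebraMap R _ (b X Y) := by
  have h : ∑ i, ∑ j, b (F.x i) (F.x j) * (ev (F.ξ i) X * ev (F.ξ j) Y -
      ev (F.ξ j) X * ev (F.ξ i) Y) = b X Y + b X Y := by
    simp only [mul_sub, Finset.sum_sub_distrib, F.sum_bilin]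
    have : ∀ i j, b (F.x i) (F.x j) * (ev (F.ξ j) X * ev (F.ξ i) Y) =
        - (b (F.x j) (F.x i) * (ev (F.ξ j) X * ev (F.ξ i) Y)) := fun i j => by
      rw [hb (F.x i) (F.x j)]; ring
    simp only [this, Finset.sum_neg_distrib]
    rw [Finset.sum_comm, F.sum_bilin, sub_neg_eq_add]
  rw [twoForm, ← algebraMap_smul R, map_smul, map_smul]
  simp only [map_sum, map_smul, ctr_ctr_ι_mul_ι]
  simp only [Algebra.smul_def, ← map_mul, ← map_sum, h]
  rw [← two_mul, ← mul_assoc, ← map_ofNat (algebraMap ℝ R) 2, ← map_mul]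
  norm_num

/-- The values of the differential of the `1`-form `ζ`. -/
def dOneValue (D : AnchoredBracket R E) (ev : E' →ₗ[R] Module.Dual R E) (ζ : E') :
    E →ₗ[R] E →ₗ[R] R :=
  LinearMap.mk₂ R
    (fun X Y => D.anchor X (ev ζ Y) - D.anchor Y (ev ζ X) - ev ζ (D.bracket X Y))
    (fun X X' Y => by simp; ring)
    (fun f X Y => by simp [bracket_smul_left]; ring)
    (fun X Y Y' => by simp; ring)
    (fun f X Y => by simp [D.leibniz]; ring)

theorem dOneValue_apply (D : AnchoredBracket R E) (ζ : E') (X Y : E) :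
    D.dOneValue ev ζ X Y =
      D.anchor X (ev ζ Y) - D.anchor Y (ev ζ X) - ev ζ (D.bracket X Y) := rfl

theorem bracket_swap (D : AnchoredBracket R E) (X Y : E) : D.bracket X Y = - D.bracket Y X := by
  have h := D.bracket_self (X + Y)
  simp only [map_add, LinearMap.add_apply, D.bracket_self, zero_add, add_zero] at h
  exact eq_neg_of_add_eq_zero_right h

theorem dOneValue_swap (D : AnchoredBracket R E) (ζ : E') (X Y : E) :
    D.dOneValue ev ζ X Y = - D.dOneValue ev ζ Y X := by
  rw [dOneValue_apply, dOneValue_apply, D.bracket_swap X Y, map_neg]; ring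

/-- The differential of functions. -/
def DualFrame.dFunction (F : DualFrame ev n) (D : AnchoredBracket R E) : Derivation ℝ R E' :=
  Derivation.mk'
    { toFun := fun f => ∑ i, D.anchor (F.x i) f • F.ξ i
      map_add' := fun f g => by simp [add_smul, Finset.sum_add_distrib]
      map_smul' := fun c f => by simp [Finset.smul_sum] }
    fun f g => by
      simp [add_smul, Finset.sum_add_distrib, Finset.smul_sum, mul_smul]

theorem DualFrame.ev_dFunction (F : DualFrame ev n) (D : AnchoredBracket R E) (f : R) (X : E) :
    ev (F.dFunction D f) X = D.anchor X f := by
  change ev (∑ i, D.anchor (F.x i) f • F.ξ i) X = _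
  conv_rhs => rw [← F.sum_x X, map_sum, ← Derivation.coeFnAddMonoidHom_apply, map_sum]
  simp [mul_comm]

/-- Odd derivations of degree one with the values on functions and `1`-forms prescribed by the
bracket satisfy the Cartan relations. -/
theorem isCartanDifferential_of_derivation {D : AnchoredBracket R E}
    {d : ExteriorAlgebra R E' →ₗ[ℝ] ExteriorAlgebra R E'}
    (hmul : ∀ a b, d (a * b) = d a * b + invol a * d b)
    (h0 : ∀ f, d (algebraMap R _ f) ∈ ⋀[R]^1 E') (h1 : ∀ ζ, d (ExteriorAlgebra.ι R ζ) ∈ ⋀[R]^2 E')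
    (hf : ∀ X f, ctr ev X (d (algebraMap R _ f)) = algebraMap R _ (D.anchor X f))
    (hζ : ∀ X Y ζ, ctr ev Y (ctr ev X (d (ExteriorAlgebra.ι R ζ))) =
      algebraMap R _ (D.dOneValue ev ζ X Y)) : D.IsCartanDifferential ev d where
  functions := hf
  mem q w hw := by
    refine exteriorPower_left_induction (p := fun q w => d w ∈ ⋀[R]^(q + 1) E') h0 ?_ ?_ q w hw
    · intro q x y hx hy
      rw [map_add]; exact Submodule.add_mem _ hx hy
    · intro q ζ w hw h
      rw [hmul, invol_ι, neg_mul, ← sub_eq_add_neg]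
      exact Submodule.sub_mem _ (exteriorPower_mul_mem (by ring) (h1 ζ) hw)
        (exteriorPower_mul_mem (by ring) (ι_mem ζ) h)
  cartan X Y w := by
    have h1' : ∀ ζ, invol (d (ExteriorAlgebra.ι R ζ)) = d (ExteriorAlgebra.ι R ζ) := fun ζ => by
      rw [invol_of_mem (h1 ζ)]; simp
    have hsmul : ∀ f w, d (f • w) = d (algebraMap R _ f) * w + f • d w := fun f w => by
      rw [Algebra.smul_def, hmul, AlgHom.commutes, ← Algebra.smul_def]
    have h0' : ∀ f, invol (d (algebraMap R _ f)) = - d (algebraMap R _ f) := fun f => by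
      rw [invol_of_mem (h0 f)]; simp
    have hfc : ∀ X f w, ctr ev X (d (algebraMap R _ f) * w) =
        D.anchor X f • w - d (algebraMap R _ f) * ctr ev X w := fun X f w => by
      rw [ctr_mul, hf, h0', ← Algebra.smul_def]; simp [sub_eq_add_neg]
    -- Both sides are odd derivations in `w` that vanish on functions, so the relation reduces to
    -- its value on 1-forms, which is the formula `e` below.
    induction w using exterior_left_induction with
    | algebraMap r => simp [hf]
    | add x y hx hy =>
      simp only [map_add] at hx hy ⊢
      rw [← hx, ← hy]; abel
    | ι_mul ζ w ih =>
      have e := hζ X Y ζ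
      simp only [dOneValue_apply] at e
      have hA : ∀ X w, ctr ev X (d (ExteriorAlgebra.ι R ζ) * w) =
          ctr ev X (d (ExteriorAlgebra.ι R ζ)) * w + d (ExteriorAlgebra.ι R ζ) * ctr ev X w :=
        fun X w => by rw [ctr_mul, h1']
      have hB : ∀ X Y w, ctr ev Y (ctr ev X (d (ExteriorAlgebra.ι R ζ)) * w) =
          ctr ev Y (ctr ev X (d (ExteriorAlgebra.ι R ζ))) * w -
            ctr ev X (d (ExteriorAlgebra.ι R ζ)) * ctr ev Y w := fun X Y w => by
        rw [ctr_mul, invol_of_mem (ctr_mem X (h1 ζ))]; simp [sub_eq_add_neg]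
      simp only [ctr_ι_mul, hmul, map_sub, map_add, hsmul, hfc, hA, hB, invol_ι, map_smul,
        neg_mul, map_neg]
      rw [e, ← Algebra.smul_def, ← ih]
      simp only [mul_sub, mul_add, sub_smul, map_add]
      abel

/-- The frame produces df and dζ for functions and 1-forms. As 2-forms are determined by their
contractions, additivity and the Leibniz rule for f • ζ can be checked on values, and the derivation
is then supplied by `exists_odd_derivation`. -/
theorem DualFrame.exists_differential (F : DualFrame ev n) (D : AnchoredBracket R E) :
    ∃ d : ExteriorAlgebra R E' →ₗ[ℝ] ExteriorAlgebra R E',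
      (∀ a b, d (a * b) = d a * b + invol a * d b) ∧
      (∀ f, d (algebraMap R _ f) = ExteriorAlgebra.ι R (F.dFunction D f)) ∧
      (∀ X Y ζ, ctr ev Y (ctr ev X (d (ExteriorAlgebra.ι R ζ))) =
        algebraMap R _ (D.dOneValue ev ζ X Y)) ∧ D.IsCartanDifferential ev d := by
  have key : ∀ {w w' : ExteriorAlgebra R E'}, w ∈ ⋀[R]^2 E' → w' ∈ ⋀[R]^2 E' →
      (∀ X Y, ctr ev Y (ctr ev X w) = ctr ev Y (ctr ev X w')) → w = w' := by
    intro w w' hw hw' h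
    refine sub_eq_zero.mp (F.eq_zero_of_ctr (Submodule.sub_mem _ hw hw') fun X =>
      F.eq_zero_of_ctr (q := 0) (ctr_mem X (Submodule.sub_mem _ hw hw')) fun Y => ?_)
    rw [map_sub, map_sub, h, sub_self]
  have hc : ∀ ζ X Y, ctr ev Y (ctr ev X (F.twoForm (D.dOneValue ev ζ))) =
      algebraMap R _ (D.dOneValue ev ζ X Y) := fun ζ X Y =>
    F.ctr_ctr_twoForm _ (D.dOneValue_swap ζ) X Y
  obtain ⟨d, h0, h1, hmul⟩ := exists_odd_derivation (F.dFunction D)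
    (AddMonoidHom.mk' (fun ζ => F.twoForm (D.dOneValue ev ζ)) fun ζ ζ' =>
      key (F.twoForm_mem _) (Submodule.add_mem _ (F.twoForm_mem _) (F.twoForm_mem _)) fun X Y => by
        rw [map_add, map_add, hc, hc, hc]
        simp only [dOneValue_apply, map_add, map_sub, LinearMap.add_apply]
        abel)
    (fun f ζ => key (F.twoForm_mem _) (Submodule.add_mem _
        (Submodule.smul_mem _ _ (F.twoForm_mem _)) (exteriorPower_mul_mem rfl (ι_mem _) (ι_mem _)))
        fun X Y => by
      simp only [AddMonoidHom.mk'_apply]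
      rw [map_add, map_add, map_smul, map_smul, hc, hc, ctr_ctr_ι_mul_ι, Algebra.smul_def,
        ← map_mul, ← map_add, F.ev_dFunction, F.ev_dFunction]
      simp only [dOneValue_apply, map_smul, LinearMap.smul_apply, smul_eq_mul, Derivation.leibniz]
      congr 1; ring)
    (fun ζ => by
      change invol (F.twoForm (D.dOneValue ev ζ)) = F.twoForm (D.dOneValue ev ζ)
      rw [invol_of_mem (F.twoForm_mem _)]; simp)
  have hζ : ∀ X Y ζ, ctr ev Y (ctr ev X (d (ExteriorAlgebra.ι R ζ))) =
      algebraMap R _ (D.dOneValue ev ζ X Y) := fun X Y ζ => by rw [h1]; exact hc ζ X Y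
  refine ⟨d, hmul, h0, hζ, isCartanDifferential_of_derivation hmul (fun f => ?_) (fun ζ => ?_)
    (fun X f => ?_) hζ⟩
  · rw [h0]; exact ι_mem _
  · rw [h1]; exact F.twoForm_mem _
  · rw [h0, ctr_ι, F.ev_dFunction]

/-- The Jacobi identity for the bracket of sections, together with the compatibility of the anchor
with brackets. -/
structure IsLie (D : AnchoredBracket R E) : Prop where
  jacobi : ∀ X Y Z, D.bracket X (D.bracket Y Z) =
    D.bracket (D.bracket X Y) Z + D.bracket Y (D.bracket X Z)
  anchor : ∀ X Y f, D.anchor (D.bracket X Y) f =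
    D.anchor X (D.anchor Y f) - D.anchor Y (D.anchor X f)

/-- The square of an odd derivation is a derivation, so only functions and 1-forms matter: there d²
expresses the compatibility of the anchor with brackets and the Jacobi identity. -/
theorem DualFrame.differential_sq (F : DualFrame ev n) {D : AnchoredBracket R E} (hD : D.IsLie)
    {d : ExteriorAlgebra R E' →ₗ[ℝ] ExteriorAlgebra R E'}
    (hmul : ∀ a b, d (a * b) = d a * b + invol a * d b)
    (h0 : ∀ f, d (algebraMap R _ f) = ExteriorAlgebra.ι R (F.dFunction D f))
    (hζ : ∀ X Y ζ, ctr ev Y (ctr ev X (d (ExteriorAlgebra.ι R ζ))) =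
        algebraMap R _ (D.dOneValue ev ζ X Y)) (hc : D.IsCartanDifferential ev d)
    (w : ExteriorAlgebra R E') : d (d w) = 0 := by
  have ha : ∀ f, d (d (algebraMap R _ f)) = 0 := fun f => by
    refine F.eq_zero_of_ctr (hc.mem 1 _ (hc.mem 0 _ (algebraMap_mem f))) fun X => ?_
    refine F.eq_zero_of_ctr (q := 0) (ctr_mem X (hc.mem 1 _ (hc.mem 0 _ (algebraMap_mem f))))
      fun Y => ?_
    rw [h0, hζ, dOneValue_apply, F.ev_dFunction, F.ev_dFunction, F.ev_dFunction, hD.anchor,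
      sub_self, map_zero]
  have hb : ∀ ζ, d (d (ExteriorAlgebra.ι R ζ)) = 0 := fun ζ => by
    have m2 : d (ExteriorAlgebra.ι R ζ) ∈ ⋀[R]^2 E' := hc.mem 1 _ (ι_mem ζ)
    have m3 := hc.mem 2 _ m2
    refine F.eq_zero_of_ctr m3 fun X => F.eq_zero_of_ctr (q := 1) (ctr_mem X m3) fun Y =>
      F.eq_zero_of_ctr (q := 0) (ctr_mem Y (ctr_mem X m3)) fun Z => ?_
    -- The contraction i_X dζ is itself a 1-form, so the formula for d on 1-forms applies to it
    -- again in the Cartan relation.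
    have hβ : ∀ X, ∃ β, ctr ev X (d (ExteriorAlgebra.ι R ζ)) = ExteriorAlgebra.ι R β ∧
        ∀ Y, ev β Y = D.dOneValue ev ζ X Y := fun X => by
      obtain ⟨β, hβ⟩ := exists_ι_of_mem (ctr_mem X m2)
      refine ⟨β, hβ, fun Y => ?_⟩
      have := hζ X Y ζ
      rw [hβ, ctr_ι] at this
      exact (ExteriorAlgebra.algebraMap_inj E' _ _).mp this
    obtain ⟨β, hX, hXv⟩ := hβ X
    obtain ⟨γ, hY, hYv⟩ := hβ Y
    have e1 := hc.cartan X Y (d (ExteriorAlgebra.ι R ζ))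
    rw [hX, hY, map_add] at e1
    have e2 := congrArg (ctr ev Z) e1
    simp only [map_add, map_sub, hζ, ctr_ι, hc.functions] at e2
    have e3 : ctr ev Z (ctr ev Y (ctr ev X (d (d (ExteriorAlgebra.ι R ζ))))) =
      algebraMap R _ (D.dOneValue ev γ X Z + D.anchor Z (ev γ X) - D.dOneValue ev β Y Z -
        D.dOneValue ev ζ (D.bracket X Y) Z) := by
      simp only [map_sub, map_add]
      rw [← e2]; abel
    have e4 : D.dOneValue ev γ X Z + D.anchor Z (ev γ X) - D.dOneValue ev β Y Z -
        D.dOneValue ev ζ (D.bracket X Y) Z = 0 := by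
      simp only [dOneValue_apply, hXv, hYv, hD.anchor, map_sub, hD.jacobi X Y Z, map_add]
      ring
    rw [e3, e4, map_zero]
  induction w using exterior_left_induction with
  | algebraMap r => exact ha r
  | add x y hx hy => rw [map_add, map_add, hx, hy, add_zero]
  | ι_mul ζ w h =>
    have : invol (d (ExteriorAlgebra.ι R ζ)) = d (ExteriorAlgebra.ι R ζ) := by
      rw [invol_of_mem (hc.mem 1 _ (ι_mem ζ))]; simp
    rw [hmul, map_add, hmul, hmul, hb, h, this]
    simp

end Existence

end AnchoredBracket
end

noncomputable section

set_option linter.unusedSectionVars false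

namespace AnchoredBracket

/-! ### Gerstenhaber brackets as derived brackets -/

section DerivedBracket

variable {R E : Type*} [CommRing R] [Algebra ℝ R] [AddCommGroup E] [Module R E] [Module ℝ E]
  [IsScalarTower ℝ R E] {𝓔 : Type*} [Ring 𝓔] [Algebra ℝ 𝓔]

theorem invol_real_smul (r : ℝ) (w : ExteriorAlgebra R E) : invol (r • w) = r • invol w := by
  rw [← algebraMap_smul R r w, map_smul, algebraMap_smul]

theorem invol_of_mem_real {n : ℕ} {w : ExteriorAlgebra R E} (hw : w ∈ ⋀[R]^n E) :
    invol w = (-1 : ℝ) ^ n • w := by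
  rw [invol_of_mem hw, ← algebraMap_smul R ((-1 : ℝ) ^ n) w]; simp

theorem real_smul_mem {n : ℕ} (r : ℝ) {w : ExteriorAlgebra R E} (hw : w ∈ ⋀[R]^n E) :
    r • w ∈ ⋀[R]^n E := by
  rw [← algebraMap_smul R r w]; exact Submodule.smul_mem _ _ hw

theorem neg_one_pow_cases (p : ℕ) : (-1 : ℝ) ^ p = 1 ∨ (-1 : ℝ) ^ p = -1 :=
  neg_one_pow_eq_or ℝ p

/-- The bracket `[[c a, Δ], c b]` of graded commutators. -/
def derivedBracket (c : ExteriorAlgebra R E →ₐ[ℝ] 𝓔) (Δ : 𝓔) :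
    ExteriorAlgebra R E →ₗ[ℝ] ExteriorAlgebra R E →ₗ[ℝ] 𝓔 :=
  -- The sign in the outer commutator depends on the parity of [c a, Δ], opposite to that of `a`.
  -- The half-sums select the even and odd parts of `a`, which makes the formula bilinear on all
  -- elements.
  LinearMap.mk₂ ℝ (fun a b => (1 / 2 : ℝ) •
      (((c a * Δ - Δ * c (invol a)) * c b - c (invol b) * (c a * Δ - Δ * c (invol a)) +
        (c (invol a) * Δ - Δ * c a) * c b - c (invol b) * (c (invol a) * Δ - Δ * c a)) +
      ((c a * Δ - Δ * c (invol a)) * c b - c b * (c a * Δ - Δ * c (invol a)) -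
        ((c (invol a) * Δ - Δ * c a) * c b - c b * (c (invol a) * Δ - Δ * c a)))))
    (fun a a' b => by simp only [map_add, ← smul_add]; congr 1; noncomm_ring)
    (fun r a b => by
      simp only [map_smul, invol_real_smul, smul_mul_assoc, mul_smul_comm, ← smul_sub, ← smul_add]
      rw [smul_comm])
    (fun a b b' => by simp only [map_add, ← smul_add]; congr 1; noncomm_ring)
    (fun r a b => by
      simp only [map_smul, invol_real_smul, smul_mul_assoc, mul_smul_comm, ← smul_sub, ← smul_add]
      rw [smul_comm])

variable (c : ExteriorAlgebra R E →ₐ[ℝ] 𝓔) (Δ : 𝓔)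

theorem derivedBracket_even {a : ExteriorAlgebra R E} (ha : invol a = a)
    (b : ExteriorAlgebra R E) : derivedBracket c Δ a b =
      (c a * Δ - Δ * c a) * c b - c (invol b) * (c a * Δ - Δ * c a) := by
  rw [derivedBracket, LinearMap.mk₂_apply, ha]
  rw [one_div, inv_smul_eq_iff₀ two_ne_zero, two_smul]
  abel

theorem derivedBracket_odd {a : ExteriorAlgebra R E} (ha : invol a = -a)
    (b : ExteriorAlgebra R E) : derivedBracket c Δ a b =
      (c a * Δ + Δ * c a) * c b - c b * (c a * Δ + Δ * c a) := by
  rw [derivedBracket, LinearMap.mk₂_apply, ha, map_neg]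
  rw [one_div, inv_smul_eq_iff₀ two_ne_zero, two_smul]
  noncomm_ring

theorem derivedBracket_even_mul {a : ExteriorAlgebra R E} (ha : invol a = a)
    (b b' : ExteriorAlgebra R E) : derivedBracket c Δ a (b * b') =
      derivedBracket c Δ a b * c b' + c (invol b) * derivedBracket c Δ a b' := by
  simp only [derivedBracket_even c Δ ha, map_mul]
  noncomm_ring

theorem derivedBracket_odd_mul {a : ExteriorAlgebra R E} (ha : invol a = -a)
    (b b' : ExteriorAlgebra R E) : derivedBracket c Δ a (b * b') =
      derivedBracket c Δ a b * c b' + c b * derivedBracket c Δ a b' := by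
  simp only [derivedBracket_odd c Δ ha, map_mul]
  noncomm_ring

/-- The graded commutator of c a and c b vanishes, so the graded Jacobi identity exchanges the roles
of `a` and `b`; likewise in the other parities. -/
theorem derivedBracket_even_even {a b : ExteriorAlgebra R E} (ha : invol a = a) (hb : invol b = b) :
    derivedBracket c Δ a b = derivedBracket c Δ b a := by
  have h : c a * c b = c b * c a := by rw [← map_mul, mul_eq_of_invol_eq hb, map_mul]
  have h' : ∀ x, c a * (c b * x) = c b * (c a * x) := fun x => by
    rw [← mul_assoc, h, mul_assoc]
  rw [derivedBracket_even c Δ ha, derivedBracket_even c Δ hb, ha, hb]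
  simp only [mul_sub, sub_mul, mul_assoc, h, h']
  abel

theorem derivedBracket_even_odd {a b : ExteriorAlgebra R E} (ha : invol a = a)
    (hb : invol b = -b) : derivedBracket c Δ a b = - derivedBracket c Δ b a := by
  have h : c a * c b = c b * c a := by rw [← map_mul, ← mul_eq_of_invol_eq ha, map_mul]
  have h' : ∀ x, c a * (c b * x) = c b * (c a * x) := fun x => by
    rw [← mul_assoc, h, mul_assoc]
  rw [derivedBracket_even c Δ ha, derivedBracket_odd c Δ hb, hb]
  simp only [mul_sub, sub_mul, mul_add, add_mul, mul_assoc, h, h', map_neg, neg_mul]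
  abel

theorem derivedBracket_odd_odd {a b : ExteriorAlgebra R E} (ha : invol a = -a)
    (hb : invol b = -b) : derivedBracket c Δ a b = - derivedBracket c Δ b a := by
  have h : c a * c b = - (c b * c a) := by
    rw [← map_mul, mul_eq_of_invol_eq_neg hb, ha, mul_neg, map_neg, map_mul]
  have h' : ∀ x, c a * (c b * x) = - (c b * (c a * x)) := fun x => by
    rw [← mul_assoc, h, neg_mul, mul_assoc]
  rw [derivedBracket_odd c Δ ha, derivedBracket_odd c Δ hb]
  simp only [mul_add, add_mul, mul_assoc, h, h', mul_neg]
  abel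

theorem derivedBracket_skew {p q : ℕ} {a b : ExteriorAlgebra R E} (ha : a ∈ ⋀[R]^p E)
    (hb : b ∈ ⋀[R]^q E) : derivedBracket c Δ a b =
      -((-1 : ℝ) ^ ((p + 1) * (q + 1)) • derivedBracket c Δ b a) := by
  have ia := invol_of_mem_real ha
  have ib := invol_of_mem_real hb
  rcases neg_one_pow_cases p with hp | hp <;> rcases neg_one_pow_cases q with hq | hq <;>
    simp only [hp, hq, one_smul, neg_smul] at ia ib <;>
    simp only [pow_mul, pow_succ, hp, hq, mul_neg, mul_one, neg_neg, one_pow, one_smul,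
      neg_smul]
  · exact derivedBracket_even_even c Δ ia ib
  · exact derivedBracket_even_odd c Δ ia ib
  · rw [derivedBracket_even_odd c Δ ib ia, neg_neg]
  · exact derivedBracket_odd_odd c Δ ia ib

/-- Commutation with [c a, Δ] is a graded derivation of the operator ring, and `c` is
multiplicative. -/
theorem derivedBracket_mul {p q : ℕ} {a b : ExteriorAlgebra R E} (ha : a ∈ ⋀[R]^p E)
    (hb : b ∈ ⋀[R]^q E) (b' : ExteriorAlgebra R E) : derivedBracket c Δ a (b * b') =
      derivedBracket c Δ a b * c b' +
        (-1 : ℝ) ^ ((p + 1) * q) • (c b * derivedBracket c Δ a b') := by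
  have ia := invol_of_mem_real ha
  have ib := invol_of_mem_real hb
  rcases neg_one_pow_cases p with hp | hp <;>
    simp only [hp, one_smul, neg_smul] at ia <;>
    simp only [pow_mul, pow_succ, hp, mul_neg, mul_one, neg_neg, one_pow, one_smul]
  · rw [derivedBracket_even_mul c Δ ia, ib, map_smul, smul_mul_assoc]
  · exact derivedBracket_odd_mul c Δ ia b b'

/-- `c` represents the exterior algebra by operators in such a way that the bracket derived from `Δ`
restricts to the bracket `D` on generators. -/
structure IsDerivedGenerator (D : AnchoredBracket R E) (c : ExteriorAlgebra R E →ₐ[ℝ] 𝓔) (Δ : 𝓔) :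
    Prop where
  injective : Function.Injective c
  sections : ∀ X Y, derivedBracket c Δ (ExteriorAlgebra.ι R X) (ExteriorAlgebra.ι R Y) =
    c (ExteriorAlgebra.ι R (D.bracket X Y))
  anchor : ∀ X f, derivedBracket c Δ (ExteriorAlgebra.ι R X) (algebraMap R _ f) =
    c (algebraMap R _ (D.anchor X f))
  functions : ∀ f g, derivedBracket c Δ (algebraMap R _ f) (algebraMap R _ g) = 0

namespace IsDerivedGenerator

variable {D : AnchoredBracket R E} {c : ExteriorAlgebra R E →ₐ[ℝ] 𝓔} {Δ : 𝓔}

/-- The bracket derived from `Δ` of elements of degrees `p` and `q` has degree `p + q - 1`. -/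
def HasValue (c : ExteriorAlgebra R E →ₐ[ℝ] 𝓔) (Δ : 𝓔) (p q : ℕ) (a b : ExteriorAlgebra R E) :
    Prop :=
  ∃ e, c e = derivedBracket c Δ a b ∧ (∀ r, p + q = r + 1 → e ∈ ⋀[R]^r E) ∧
    (p = 0 → q = 0 → e = 0)

theorem HasValue.add {p q : ℕ} {a b b' : ExteriorAlgebra R E} (h : HasValue c Δ p q a b)
    (h' : HasValue c Δ p q a b') : HasValue c Δ p q a (b + b') := by
  obtain ⟨e, h1, h2, h3⟩ := h
  obtain ⟨e', h1', h2', h3'⟩ := h'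
  refine ⟨e + e', by rw [map_add, map_add, h1, h1'],
    fun r hr => Submodule.add_mem _ (h2 r hr) (h2' r hr), fun hp hq => ?_⟩
  rw [h3 hp hq, h3' hp hq, add_zero]

theorem HasValue.symm {p q : ℕ} {a b : ExteriorAlgebra R E} (ha : a ∈ ⋀[R]^p E)
    (hb : b ∈ ⋀[R]^q E) (h : HasValue c Δ p q a b) : HasValue c Δ q p b a := by
  obtain ⟨e, h1, h2, h3⟩ := h
  refine ⟨-((-1 : ℝ) ^ ((q + 1) * (p + 1)) • e), ?_, fun r hr => ?_, fun hq hp => ?_⟩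
  · rw [map_neg, map_smul, h1, ← derivedBracket_skew c Δ hb ha]
  · exact Submodule.neg_mem _ (real_smul_mem _ (h2 r (by omega)))
  · rw [h3 hp hq, smul_zero, neg_zero]

theorem HasValue.ι_mul {p q : ℕ} {a b : ExteriorAlgebra R E} {X : E} (ha : a ∈ ⋀[R]^p E)
    (hb : b ∈ ⋀[R]^q E) (hX : HasValue c Δ p 1 a (ExteriorAlgebra.ι R X))
    (h : HasValue c Δ p q a b) : HasValue c Δ p (q + 1) a (ExteriorAlgebra.ι R X * b) := by
  obtain ⟨e, h1, h2, h3⟩ := h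
  obtain ⟨x, h1', h2', -⟩ := hX
  refine ⟨x * b + (-1 : ℝ) ^ ((p + 1) * 1) • (ExteriorAlgebra.ι R X * e), ?_, fun r hr => ?_,
    fun _ h => by omega⟩
  · rw [derivedBracket_mul c Δ ha (ι_mem X), map_add, map_smul, map_mul, map_mul, h1, h1']
  · refine Submodule.add_mem _ (exteriorPower_mul_mem (by omega) (h2' p rfl) hb)
      (real_smul_mem _ ?_)
    -- Here the bracket of `a` and `b` would have degree -1; the last clause of `HasValue` provides
    -- its vanishing.
    by_cases h0 : p = 0 ∧ q = 0
    · rw [h3 h0.1 h0.2, mul_zero]; exact Submodule.zero_mem _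
    · obtain ⟨k, hk⟩ : ∃ k, p + q = k + 1 := ⟨p + q - 1, by omega⟩
      exact exteriorPower_mul_mem (by omega) (ι_mem X) (h2 k hk)

variable (h : D.IsDerivedGenerator c Δ)
include h

theorem hasValue_ι (X : E) {q : ℕ} {b : ExteriorAlgebra R E} (hb : b ∈ ⋀[R]^q E) :
    HasValue c Δ 1 q (ExteriorAlgebra.ι R X) b := by
  refine exteriorPower_left_induction (p := fun q b => HasValue c Δ 1 q (ExteriorAlgebra.ι R X) b)
    ?_ (fun q x y => HasValue.add) (fun q Y w hw => HasValue.ι_mul (ι_mem X) hw ?_) q b hb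
  · intro f
    refine ⟨_, (h.anchor X f).symm, fun r hr => ?_, fun h => by omega⟩
    obtain rfl : r = 0 := by omega
    exact algebraMap_mem _
  · refine ⟨_, (h.sections X Y).symm, fun r hr => ?_, fun h => by omega⟩
    obtain rfl : r = 1 := by omega
    exact ι_mem _

theorem hasValue_algebraMap (f : R) {q : ℕ} {b : ExteriorAlgebra R E} (hb : b ∈ ⋀[R]^q E) :
    HasValue c Δ 0 q (algebraMap R _ f) b := by
  refine exteriorPower_left_induction (p := fun q b => HasValue c Δ 0 q (algebraMap R _ f) b)
    ?_ (fun q x y => HasValue.add) (fun q Y w hw => HasValue.ι_mul (algebraMap_mem f) hw ?_) q b hb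
  · intro g
    exact ⟨0, by rw [h.functions, map_zero], fun r hr => by omega, fun _ _ => rfl⟩
  · exact (h.hasValue_ι Y (algebraMap_mem f)).symm (ι_mem Y) (algebraMap_mem f)

/-- A derived bracket is a priori only an operator; it must be shown to lie in the image of `c`. By
the Leibniz rule this reduces to generators in one argument, and by skew symmetry to generators in
the other. -/
theorem hasValue {p q : ℕ} {a b : ExteriorAlgebra R E} (ha : a ∈ ⋀[R]^p E) (hb : b ∈ ⋀[R]^q E) :
    HasValue c Δ p q a b := by
  refine exteriorPower_left_induction (p := fun q b => HasValue c Δ p q a b)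
    ?_ (fun q x y => HasValue.add) (fun q Y w hw => HasValue.ι_mul ha hw ?_) q b hb
  · intro g
    exact (h.hasValue_algebraMap g ha).symm (algebraMap_mem g) ha
  · exact (h.hasValue_ι Y ha).symm (ι_mem Y) ha

theorem exists_value (a b : ExteriorAlgebra R E) : ∃ e, c e = derivedBracket c Δ a b := by
  induction a using exterior_homogeneous_induction with
  | add x y hx hy =>
    obtain ⟨e, he⟩ := hx
    obtain ⟨e', he'⟩ := hy
    exact ⟨e + e', by rw [map_add, he, he', map_add, LinearMap.add_apply]⟩
  | mem p a ha =>
    induction b using exterior_homogeneous_induction with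
    | add x y hx hy =>
      obtain ⟨e, he⟩ := hx
      obtain ⟨e', he'⟩ := hy
      exact ⟨e + e', by rw [map_add, he, he', map_add]⟩
    | mem q b hb =>
      obtain ⟨e, he, -⟩ := h.hasValue ha hb
      exact ⟨e, he⟩

/-- Existence of the Gerstenhaber bracket, given as a derived bracket. -/
theorem exists_extension : ∃ B, D.IsGerstenhaberExtension B ∧
    ∀ a b, c (B a b) = derivedBracket c Δ a b := by
  choose v hv using h.exists_value
  let B : ExteriorAlgebra R E →ₗ[ℝ] ExteriorAlgebra R E →ₗ[ℝ] ExteriorAlgebra R E :=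
    LinearMap.mk₂ ℝ v
      (fun a a' b => h.injective (by
        rw [map_add, hv, hv, hv, map_add, LinearMap.add_apply]))
      (fun r a b => h.injective (by rw [map_smul, hv, hv, map_smul, LinearMap.smul_apply]))
      (fun a b b' => h.injective (by rw [map_add, hv, hv, hv, map_add]))
      (fun r a b => h.injective (by rw [map_smul, hv, hv, map_smul]))
  have hB : ∀ a b, c (B a b) = derivedBracket c Δ a b := hv
  refine ⟨B, ⟨⟨?_, ?_, ?_, ?_⟩, ?_, ?_⟩, hB⟩
  · intro p q r hr a ha b hb
    obtain ⟨e, he, hm, -⟩ := h.hasValue ha hb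
    rw [h.injective ((hB a b).trans he.symm)]
    exact hm r hr
  · intro a ha b hb
    obtain ⟨e, he, -, h0⟩ := h.hasValue ha hb
    rw [h.injective ((hB a b).trans he.symm), h0 rfl rfl]
  · intro p q a ha b hb
    apply h.injective
    rw [map_neg, map_smul, hB, hB, derivedBracket_skew c Δ ha hb]
  · intro p q a ha b hb b'
    apply h.injective
    rw [map_add, map_smul, map_mul c, map_mul c, hB, hB, hB, derivedBracket_mul c Δ ha hb]
  · intro X Y
    exact h.injective ((hB _ _).trans (h.sections X Y))
  · intro X f
    exact h.injective ((hB _ _).trans (h.anchor X f))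

end IsDerivedGenerator

/-- A biderivation is determined by its values on functions and on degree one. Skew symmetry
transfers the Leibniz rule to the first argument. -/
theorem IsGerstenhaberExtension.unique {D : AnchoredBracket R E}
    {B B' : ExteriorAlgebra R E →ₗ[ℝ] ExteriorAlgebra R E →ₗ[ℝ] ExteriorAlgebra R E}
    (h : D.IsGerstenhaberExtension B) (h' : D.IsGerstenhaberExtension B') : B = B' := by
  have ext' : ∀ (p : ℕ), ∀ a ∈ ⋀[R]^p E, (∀ f, B a (algebraMap R _ f) = B' a (algebraMap R _ f)) →
      (∀ X, B a (ExteriorAlgebra.ι R X) = B' a (ExteriorAlgebra.ι R X)) → ∀ b, B a b = B' a b := by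
    intro p a ha hf hX b
    induction b using exterior_left_induction with
    | algebraMap r => exact hf r
    | add x y hx hy => rw [map_add, map_add, hx, hy]
    | ι_mul X w hw => rw [h.leibniz p 1 a ha _ (ι_mem X), h'.leibniz p 1 a ha _ (ι_mem X), hX, hw]
  have hι : ∀ X b, B (ExteriorAlgebra.ι R X) b = B' (ExteriorAlgebra.ι R X) b := fun X =>
    ext' 1 _ (ι_mem X) (fun f => by rw [h.anchor, h'.anchor])
      (fun Y => by rw [h.sections, h'.sections])
  have hr : ∀ f b, B (algebraMap R _ f) b = B' (algebraMap R _ f) b := fun f =>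
    ext' 0 _ (algebraMap_mem f)
      (fun g => by rw [h.functions _ (algebraMap_mem f) _ (algebraMap_mem g),
        h'.functions _ (algebraMap_mem f) _ (algebraMap_mem g)])
      (fun X => by rw [h.skew 0 1 _ (algebraMap_mem f) _ (ι_mem X),
        h'.skew 0 1 _ (algebraMap_mem f) _ (ι_mem X), hι])
  ext a b
  induction a using exterior_homogeneous_induction with
  | add x y hx hy => rw [map_add, map_add, LinearMap.add_apply, LinearMap.add_apply, hx, hy]
  | mem p a ha =>
    exact ext' p a ha
      (fun f => by rw [h.skew p 0 _ ha _ (algebraMap_mem f),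
        h'.skew p 0 _ ha _ (algebraMap_mem f), hr])
      (fun X => by rw [h.skew p 1 _ ha _ (ι_mem X), h'.skew p 1 _ ha _ (ι_mem X), hι]) b

theorem IsDerivedGenerator.existsUnique {D : AnchoredBracket R E}
    {c : ExteriorAlgebra R E →ₐ[ℝ] 𝓔} {Δ : 𝓔} (h : D.IsDerivedGenerator c Δ) :
    ∃! B, D.IsGerstenhaberExtension B := by
  obtain ⟨B, hB, -⟩ := h.exists_extension
  exact ⟨B, hB, fun B' hB' => hB'.unique hB⟩

theorem gerstenhaber_eq {D : AnchoredBracket R E}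
    {B : ExteriorAlgebra R E →ₗ[ℝ] ExteriorAlgebra R E →ₗ[ℝ] ExteriorAlgebra R E}
    (h : D.IsGerstenhaberExtension B) : D.gerstenhaber = B :=
  (Classical.epsilon_spec (p := D.IsGerstenhaberExtension) ⟨B, h⟩).unique h

theorem IsDerivedGenerator.apply_gerstenhaber {D : AnchoredBracket R E}
    {c : ExteriorAlgebra R E →ₐ[ℝ] 𝓔} {Δ : 𝓔} (h : D.IsDerivedGenerator c Δ)
    (a b : ExteriorAlgebra R E) : c (D.gerstenhaber a b) = derivedBracket c Δ a b := by
  obtain ⟨B, hB, hv⟩ := h.exists_extension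
  rw [gerstenhaber_eq hB, hv]

theorem IsDerivedGenerator.isGerstenhaberExtension {D : AnchoredBracket R E}
    {c : ExteriorAlgebra R E →ₐ[ℝ] 𝓔} {Δ : 𝓔} (h : D.IsDerivedGenerator c Δ) :
    D.IsGerstenhaberExtension D.gerstenhaber := by
  obtain ⟨B, hB, hv⟩ := h.exists_extension
  rwa [gerstenhaber_eq hB]

theorem IsGerstenhaberExtension.invol_apply {D : AnchoredBracket R E}
    {B : ExteriorAlgebra R E →ₗ[ℝ] ExteriorAlgebra R E →ₗ[ℝ] ExteriorAlgebra R E}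
    (h : D.IsGerstenhaberExtension B) {p q : ℕ} {a b : ExteriorAlgebra R E} (ha : a ∈ ⋀[R]^p E)
    (hb : b ∈ ⋀[R]^q E) : invol (B a b) = -((-1 : ℝ) ^ (p + q) • B a b) := by
  by_cases h0 : p = 0 ∧ q = 0
  · obtain ⟨rfl, rfl⟩ := h0
    rw [h.functions a ha b hb]; simp
  · obtain ⟨k, hk⟩ : ∃ k, p + q = k + 1 := ⟨p + q - 1, by omega⟩
    rw [invol_of_mem_real (h.mem p q k hk a ha b hb), hk, pow_succ]
    simp

set_option maxHeartbeats 1000000 in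
/-- The graded Jacobi identity for brackets derived from an operator of square zero. -/
theorem IsDerivedGenerator.gradedJacobi {D : AnchoredBracket R E}
    {c : ExteriorAlgebra R E →ₐ[ℝ] 𝓔} {Δ : 𝓔} (h : D.IsDerivedGenerator c Δ) (hΔ : Δ * Δ = 0) :
    GradedJacobi D.gerstenhaber := by
  intro p q a ha b hb z
  have hB := h.isGerstenhaberExtension
  have hv := h.apply_gerstenhaber
  generalize D.gerstenhaber = B at hB hv
  have hΔ' : ∀ x, Δ * (Δ * x) = 0 := fun x => by rw [← mul_assoc, hΔ, zero_mul]
  induction z using exterior_homogeneous_induction with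
  | add x y hx hy =>
    simp only [map_add, hx, hy, smul_add]; abel
  | mem s z hz =>
    have ia := invol_of_mem_real ha
    have ib := invol_of_mem_real hb
    have iz := invol_of_mem_real hz
    have iab := hB.invol_apply ha hb
    have ibz := hB.invol_apply hb hz
    have iaz := hB.invol_apply ha hz
    have hab := hv a b
    have hbz := hv b z
    have haz := hv a z
    apply h.injective
    rw [map_add, map_smul, hv, hv, hv]
    -- Only parities enter the signs, so there are eight cases.
    rcases neg_one_pow_cases p with hp | hp <;> rcases neg_one_pow_cases q with hq | hq <;>
    rcases neg_one_pow_cases s with hs | hs <;>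
    simp only [hp, hq, hs, one_smul, neg_smul, pow_add, mul_one, mul_neg, neg_neg]
      at ia ib iz iab ibz iaz <;>
    simp only [pow_mul, pow_succ, hp, hq, mul_neg, mul_one, neg_neg, one_pow, one_smul,
      neg_smul] <;>
    simp only [derivedBracket_even c Δ, derivedBracket_odd c Δ, ia, ib, iz, map_neg]
      at hab hbz haz <;>
    simp only [derivedBracket_even c Δ, derivedBracket_odd c Δ, ia, ib, iab, iaz, ibz, iz, map_neg]
    -- Because Δ² = 0, the map a ↦ [c a, Δ] sends the derived bracket to the graded commutator up to
    -- sign. The four alternatives are this statement for the four parities of (a, b); afterwards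
    -- only the Jacobi identity for commutators is left.
    all_goals
      first
      | have hL : c (B a b) * Δ + Δ * c (B a b) =
            (c a * Δ - Δ * c a) * (c b * Δ - Δ * c b) +
            (c b * Δ - Δ * c b) * (c a * Δ - Δ * c a) := by
          rw [hab]
          simp only [mul_sub, sub_mul, mul_assoc, hΔ, hΔ', mul_zero, neg_mul, mul_neg]
          abel
        rw [hL]
      | have hL : c (B a b) * Δ - Δ * c (B a b) =
            (c a * Δ - Δ * c a) * (c b * Δ + Δ * c b) -
            (c b * Δ + Δ * c b) * (c a * Δ - Δ * c a) := by
          rw [hab]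
          simp only [mul_sub, sub_mul, mul_add, add_mul, mul_assoc, hΔ, hΔ', mul_zero, neg_mul,
            mul_neg]
          abel
        rw [hL]
      | have hL : c (B a b) * Δ - Δ * c (B a b) =
            (c a * Δ + Δ * c a) * (c b * Δ - Δ * c b) -
            (c b * Δ - Δ * c b) * (c a * Δ + Δ * c a) := by
          rw [hab]
          simp only [mul_sub, sub_mul, mul_add, add_mul, mul_assoc, hΔ, hΔ', mul_zero]
          abel
        rw [hL]
      | have hL : c (B a b) * Δ + Δ * c (B a b) =
            (c a * Δ + Δ * c a) * (c b * Δ + Δ * c b) -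
            (c b * Δ + Δ * c b) * (c a * Δ + Δ * c a) := by
          rw [hab]
          simp only [mul_sub, sub_mul, mul_add, add_mul, mul_assoc, hΔ, hΔ', mul_zero]
          abel
        rw [hL]
    all_goals
      rw [hbz, haz]
      clear hab hbz haz
      generalize c a * Δ - Δ * c a = x
      generalize c a * Δ + Δ * c a = x'
      generalize c b * Δ - Δ * c b = y
      generalize c b * Δ + Δ * c b = y'
      simp only [mul_sub, sub_mul, mul_add, add_mul, mul_assoc, neg_mul, mul_neg]
      abel

end DerivedBracket

end AnchoredBracket
end

noncomputable section

set_option linter.unusedSectionVars false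

namespace AnchoredBracket

/-! ### Interior products of forms by multivectors -/

section Interior

variable {R L : Type*} [CommRing R] [AddCommGroup L] [Module R L]

@[simp] theorem interior_ι (X : L) (w : ExteriorAlgebra R (Module.Dual R L)) :
    interior (ExteriorAlgebra.ι R X) w = ctr LinearMap.id X w := by
  rw [interior, ExteriorAlgebra.lift_ι_apply]; rfl

theorem interior_algebraMap (r : R) (w : ExteriorAlgebra R (Module.Dual R L)) :
    interior (algebraMap R (ExteriorAlgebra R L) r) w = r • w := by
  rw [AlgHom.commutes]; rfl

theorem interior_mul (V W : ExteriorAlgebra R L) (w : ExteriorAlgebra R (Module.Dual R L)) :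
    interior (V * W) w = interior V (interior W w) := by
  rw [map_mul]; rfl

theorem ctr_id_ι_mul (X : L) (α : Module.Dual R L) (w : ExteriorAlgebra R (Module.Dual R L)) :
    ctr LinearMap.id X (ExteriorAlgebra.ι R α * w) =
      α X • w - ExteriorAlgebra.ι R α * ctr LinearMap.id X w := ctr_ι_mul _ _ _

/-- The commutation relation between exterior multiplication by a `1`-form and interior products. -/
theorem ι_mul_interior (α : Module.Dual R L) (V : ExteriorAlgebra R L)
    (w : ExteriorAlgebra R (Module.Dual R L)) :
    ExteriorAlgebra.ι R α * interior V w =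
      interior (contract α V) w + interior (invol V) (ExteriorAlgebra.ι R α * w) := by
  induction V using exterior_left_induction with
  | algebraMap r => simp
  | add x y hx hy => simp only [map_add, LinearMap.add_apply, mul_add, hx, hy]; abel
  | ι_mul X V h =>
    have e := ctr_id_ι_mul X α (interior V w)
    rw [h] at e
    rw [interior_mul, interior_ι, contract_ι_mul, map_mul invol, invol_ι, map_sub, map_smul,
      LinearMap.sub_apply, LinearMap.smul_apply, interior_mul, interior_ι, neg_mul, map_neg,
      LinearMap.neg_apply, interior_mul, interior_ι]
    rw [map_add] at e
    rw [eq_sub_iff_add_eq] at e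
    rw [← e]; abel

theorem interior_invol (V : ExteriorAlgebra R L) (w : ExteriorAlgebra R (Module.Dual R L)) :
    interior (invol V) (invol w) = invol (interior V w) := by
  induction V using exterior_left_induction with
  | algebraMap r => simp
  | add x y hx hy => simp only [map_add, LinearMap.add_apply, hx, hy]
  | ι_mul X V h =>
    rw [map_mul, invol_ι, neg_mul, map_neg, LinearMap.neg_apply, interior_mul, interior_ι, h,
      interior_mul, interior_ι, ctr, contract_invol, neg_neg]

theorem algebraMapInv_invol (V : ExteriorAlgebra R L) :
    ExteriorAlgebra.algebraMapInv (invol V) = ExteriorAlgebra.algebraMapInv V := by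
  induction V using exterior_left_induction with
  | algebraMap r => simp
  | add x y hx hy => simp [hx, hy]
  | ι_mul X V h => simp [ExteriorAlgebra.algebraMapInv]

theorem interior_one_apply (V : ExteriorAlgebra R L) :
    interior V (1 : ExteriorAlgebra R (Module.Dual R L)) =
      algebraMap R _ (ExteriorAlgebra.algebraMapInv V) := by
  induction V using exterior_left_induction with
  | algebraMap r =>
    rw [interior_algebraMap, ExteriorAlgebra.algebraMap_leftInverse, Algebra.algebraMap_eq_smul_one]
  | add x y hx hy => simp only [map_add, LinearMap.add_apply, hx, hy]
  | ι_mul X V h =>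
    rw [interior_mul, h, interior_ι, ctr_algebraMap, map_mul]
    simp [ExteriorAlgebra.algebraMapInv]

theorem interior_mem {p q r : ℕ} (h : p + r = q) {V : ExteriorAlgebra R L} (hV : V ∈ ⋀[R]^p L)
    {w : ExteriorAlgebra R (Module.Dual R L)} (hw : w ∈ ⋀[R]^q (Module.Dual R L)) :
    interior V w ∈ ⋀[R]^r (Module.Dual R L) := by
  suffices H : ∀ q r, p + r = q → ∀ w, w ∈ ⋀[R]^q (Module.Dual R L) →
      interior V w ∈ ⋀[R]^r (Module.Dual R L) from H _ _ h _ hw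
  clear h hw w q r
  refine exteriorPower_left_induction (p := fun p V => ∀ q r, p + r = q → ∀ w,
    w ∈ ⋀[R]^q (Module.Dual R L) → interior V w ∈ ⋀[R]^r (Module.Dual R L)) ?_ ?_ ?_ p V hV
  · intro f q r h w hw
    obtain rfl : q = r := by omega
    rw [interior_algebraMap]; exact Submodule.smul_mem _ _ hw
  · intro p x y hx hy q r h w hw
    rw [map_add, LinearMap.add_apply]
    exact Submodule.add_mem _ (hx q r h w hw) (hy q r h w hw)
  · intro p X V _ hV q r h w hw
    rw [interior_mul, interior_ι]
    exact ctr_mem X (hV q (r + 1) (by omega) w hw)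

theorem interior_eq_zero_of_lt {p q : ℕ} (h : q < p) {V : ExteriorAlgebra R L}
    (hV : V ∈ ⋀[R]^p L) {w : ExteriorAlgebra R (Module.Dual R L)}
    (hw : w ∈ ⋀[R]^q (Module.Dual R L)) : interior V w = 0 := by
  suffices H : ∀ q, q < p → ∀ w, w ∈ ⋀[R]^q (Module.Dual R L) → interior V w = 0 from H _ h _ hw
  clear h hw w q
  refine exteriorPower_left_induction (p := fun p V => ∀ q, q < p → ∀ w,
    w ∈ ⋀[R]^q (Module.Dual R L) → interior V w = 0) ?_ ?_ ?_ p V hV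
  · intro f q h; omega
  · intro p x y hx hy q h w hw
    rw [map_add, LinearMap.add_apply, hx q h w hw, hy q h w hw, add_zero]
  · intro p X V hVp hV q h w hw
    rw [interior_mul, interior_ι]
    rcases Nat.lt_or_ge q p with h' | h'
    · rw [hV q h' w hw, map_zero]
    · obtain rfl : q = p := by omega
      exact contract_mem_zero _ (interior_mem (r := 0) rfl hVp hw)

theorem contract_sharp (P : ⋀[R]^2 L) (α : Module.Dual R L) :
    contract α (P : ExteriorAlgebra R L) = ExteriorAlgebra.ι R (sharp P α) := by
  obtain ⟨X, hX⟩ := exists_ι_of_mem (contract_mem α P.2)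
  have : sharp P α = X := by
    change ExteriorAlgebra.ιInv (contract α (P : ExteriorAlgebra R L)) = X
    rw [hX, ExteriorAlgebra.ι_leftInverse]
  rw [hX, this]

theorem ι_mul_interior_bivector (P : ⋀[R]^2 L) (α : Module.Dual R L)
    (w : ExteriorAlgebra R (Module.Dual R L)) :
    ExteriorAlgebra.ι R α * interior (P : ExteriorAlgebra R L) w =
      ctr LinearMap.id (sharp P α) w +
        interior (P : ExteriorAlgebra R L) (ExteriorAlgebra.ι R α * w) := by
  rw [ι_mul_interior, contract_sharp, interior_ι, invol_of_mem P.2]; simp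

end Interior

section NonDegenerate

variable {R E E' : Type*} [CommRing R] [Algebra ℝ R]
  [AddCommGroup E] [Module R E] [Module ℝ E] [IsScalarTower ℝ R E]
  [AddCommGroup E'] [Module R E'] [Module ℝ E'] [IsScalarTower ℝ R E']
  {ev : E' →ₗ[R] Module.Dual R E} {n : ℕ}

theorem formEval_of_ne : ∀ {p q : ℕ} (_ : p ≠ q) {w : ExteriorAlgebra R E'} (_ : w ∈ ⋀[R]^p E')
    (a : Fin q → E), formEval ev q w a = 0
  | 0, 0, h, _, _, _ => absurd rfl h
  | p + 1, 0, _, w, hw, a => by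
    rw [formEval_zero]
    rw [ExteriorAlgebra.exteriorPower, pow_succ'] at hw
    refine Submodule.mul_induction_on hw ?_ ?_
    · rintro _ ⟨m, rfl⟩ x _
      rw [map_mul]; simp [ExteriorAlgebra.algebraMapInv]
    · intro x y hx hy; rw [map_add, hx, hy, add_zero]
  | 0, q + 1, _, w, hw, a => by
    rw [formEval_succ, ctr, contract_mem_zero _ hw, map_zero]; rfl
  | p + 1, q + 1, h, w, hw, a => by
    rw [formEval_succ, formEval_of_ne (fun e => h (by rw [e])) (ctr_mem _ hw)]

theorem DualFrame.eq_zero_of_forall_formEval (F : DualFrame ev n) {w : ExteriorAlgebra R E'}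
    (h : ∀ q a, formEval ev q w a = 0) : w = 0 := by
  classical
  have hq : ∀ q, ((DirectSum.decompose (fun i : ℕ => ⋀[R]^i E') w q : ⋀[R]^q E') :
      ExteriorAlgebra R E') = 0 := by
    intro q
    refine F.eq_zero_of_formEval (SetLike.coe_mem _) fun a => ?_
    have := h q a
    rw [← DirectSum.sum_support_decompose (fun i : ℕ => ⋀[R]^i E') w, map_sum,
      Finset.sum_apply] at this
    rw [Finset.sum_eq_single q] at this
    · exact this
    · intro p _ hp
      exact formEval_of_ne hp (SetLike.coe_mem _) a
    · intro hq
      rw [DFinsupp.notMem_support_iff.mp hq]; simp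
  rw [← DirectSum.sum_support_decompose (fun i : ℕ => ⋀[R]^i E') w]
  exact Finset.sum_eq_zero fun q _ => hq q

end NonDegenerate

/-! ### The isomorphism defined by a volume form -/

section Volume

variable {R L : Type*} [CommRing R] [Algebra ℝ R] [AddCommGroup L] [Module R L] [Module ℝ L]
  [IsScalarTower ℝ R L] {n N : ℕ}

/-- The dual of a dual frame. -/
def DualFrame.symm (F : DualFrame (LinearMap.id : Module.Dual R L →ₗ[R] Module.Dual R L) n) :
    DualFrame (Module.Dual.eval R L) n where
  x := F.ξ
  ξ := F.x
  sum_x := F.sum_ξ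
  sum_ξ := F.sum_x

/-- A top degree form together with a multivector dual to it. -/
structure IsDualVolume (lam : ⋀[R]^N (Module.Dual R L)) (Lam : ExteriorAlgebra R L) : Prop where
  mem : Lam ∈ ⋀[R]^N L
  top : ∀ w ∈ ⋀[R]^(N + 1) (Module.Dual R L), w = 0
  interior : interior Lam (lam : ExteriorAlgebra R (Module.Dual R L)) = 1

variable {lam : ⋀[R]^N (Module.Dual R L)} {Lam : ExteriorAlgebra R L}

theorem star_apply (lam : ⋀[R]^N (Module.Dual R L)) (V : ExteriorAlgebra R L) :
    star lam V = interior V (lam : ExteriorAlgebra R (Module.Dual R L)) := rfl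

namespace IsDualVolume

variable (hl : IsDualVolume lam Lam)
include hl

theorem ι_mul (α : Module.Dual R L) :
    ExteriorAlgebra.ι R α * (lam : ExteriorAlgebra R (Module.Dual R L)) = 0 :=
  hl.top _ (exteriorPower_mul_mem (add_comm _ _) (ι_mem α) lam.2)

/-- As α ∧ λ = 0 for degree reasons, only the contraction term of the commutation relation survives.
-/
theorem ι_mul_star (α : Module.Dual R L) (V : ExteriorAlgebra R L) :
    ExteriorAlgebra.ι R α * star lam V = star lam (contract α V) := by
  rw [star_apply, ι_mul_interior, hl.ι_mul, map_zero, add_zero, star_apply]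

/-- Graded commutativity moves `Lam` next to λ, where i_Λ λ = 1; then i_V 1 is the degree zero part
of V. The parity sign affects only the other components. -/
theorem interior_star (V : ExteriorAlgebra R L) : AnchoredBracket.interior Lam (star lam V) =
    algebraMap R _ (ExteriorAlgebra.algebraMapInv V) := by
  rw [star_apply, ← interior_mul]
  have h1 := invol_of_mem_real hl.mem
  rcases neg_one_pow_cases N with h | h <;> rw [h] at h1
  · rw [← mul_eq_of_invol_eq (by simpa using h1), interior_mul, hl.interior, interior_one_apply]
  · have := mul_eq_of_invol_eq_neg (by simpa using h1) (invol V)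
    rw [invol_invol] at this
    rw [← this, interior_mul, hl.interior, interior_one_apply, algebraMapInv_invol]

/-- The kernel is stable under contractions by 1-forms, and its elements have no degree zero part;
iterated contractions therefore show that all their values vanish. -/
theorem star_injective (F : DualFrame (LinearMap.id : Module.Dual R L →ₗ[R] Module.Dual R L) n) :
    Function.Injective (star lam) := by
  rw [injective_iff_map_eq_zero]
  intro V hV
  refine F.symm.eq_zero_of_forall_formEval fun q a => ?_
  induction q generalizing V with
  | zero =>
    have := hl.interior_star V
    rw [hV, map_zero] at this
    exact ((ExteriorAlgebra.algebraMap_eq_zero_iff _ _).mp this.symm)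
  | succ q ih =>
    rw [formEval_succ]
    refine ih _ ?_ _
    have := hl.ι_mul_star (a 0) V
    rw [hV, mul_zero] at this
    exact this.symm

/-- The image contains 1 = *Λ and is stable under exterior multiplication by 1-forms. -/
theorem star_surjective : Function.Surjective (star lam) := by
  intro w
  induction w using exterior_left_induction with
  | algebraMap r =>
    exact ⟨r • Lam, by rw [map_smul, star_apply, hl.interior, Algebra.algebraMap_eq_smul_one]⟩
  | add x y hx hy =>
    obtain ⟨V, rfl⟩ := hx
    obtain ⟨W, rfl⟩ := hy
    exact ⟨V + W, map_add _ _ _⟩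
  | ι_mul α w h =>
    obtain ⟨V, rfl⟩ := h
    exact ⟨_, (hl.ι_mul_star α V).symm⟩

theorem interior_injective
    (F : DualFrame (LinearMap.id : Module.Dual R L →ₗ[R] Module.Dual R L) n) :
    Function.Injective (AnchoredBracket.interior (R := R) (L := L)) := fun V W h =>
  hl.star_injective F (by rw [star_apply, star_apply, h])

/-- Written as *V, such a form has V killed by all contractions, so V is a function. -/
theorem eq_smul_of_forall_ι_mul
    (F : DualFrame (LinearMap.id : Module.Dual R L →ₗ[R] Module.Dual R L) n)
    {w : ExteriorAlgebra R (Module.Dual R L)}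
    (hw : ∀ α : Module.Dual R L, ExteriorAlgebra.ι R α * w = 0) :
    ∃ r : R, w = r • (lam : ExteriorAlgebra R (Module.Dual R L)) := by
  obtain ⟨V, rfl⟩ := hl.star_surjective w
  have hV : ∀ α, contract α V = 0 := by
    intro α
    apply hl.star_injective F
    rw [map_zero, ← hl.ι_mul_star, hw]
  refine ⟨ExteriorAlgebra.algebraMapInv V, ?_⟩
  have h : V = algebraMap R _ (ExteriorAlgebra.algebraMapInv V) := by
    rw [← sub_eq_zero]
    refine F.symm.eq_zero_of_forall_formEval fun q a => ?_
    cases q with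
    | zero => simp [formEval_zero]
    | succ q =>
      rw [formEval_succ]
      have : ctr (Module.Dual.eval R L) (a 0) V = 0 := hV (a 0)
      rw [map_sub, this, ctr_algebraMap, sub_zero, map_zero]; rfl
  conv_lhs => rw [h]
  rw [star_apply, interior_algebraMap]

/-- Forms of top degree are multiples of the volume form. -/
theorem eq_smul_of_mem (F : DualFrame (LinearMap.id : Module.Dual R L →ₗ[R] Module.Dual R L) n)
    {w : ExteriorAlgebra R (Module.Dual R L)} (hw : w ∈ ⋀[R]^N (Module.Dual R L)) :
    ∃ r : R, w = r • (lam : ExteriorAlgebra R (Module.Dual R L)) :=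
  hl.eq_smul_of_forall_ι_mul F fun α => hl.top _ (exteriorPower_mul_mem (add_comm _ _) (ι_mem α) hw)

end IsDualVolume

end Volume

end AnchoredBracket
end

noncomputable section

set_option linter.unusedSectionVars false

namespace AnchoredBracket

variable {R L : Type*} [CommRing R] [Algebra ℝ R] [AddCommGroup L] [Module R L] [Module ℝ L]
  [IsScalarTower ℝ R L] {n N : ℕ}

/-! ### The differential of forms -/

section FormDifferential

variable (F : DualFrame (LinearMap.id : Module.Dual R L →ₗ[R] Module.Dual R L) n)
  (D : AnchoredBracket R L)

include F

theorem DualFrame.ι_dFunction (f : R) : F.dFunction D f = D.dFun f :=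
  LinearMap.ext fun X => F.ev_dFunction D f X

theorem DualFrame.existsUnique_differential :
    ∃! d, D.IsDifferential (LinearMap.id : Module.Dual R L →ₗ[R] Module.Dual R L) d := by
  obtain ⟨d, -, -, -, h⟩ := F.exists_differential D
  exact ⟨d, h.isDifferential, fun d' h' => IsDifferential.unique F h' h.isDifferential⟩

theorem DualFrame.dA_spec :
    (∀ a b, D.dA (a * b) = D.dA a * b + invol a * D.dA b) ∧
      (∀ f, D.dA (algebraMap R _ f) = ExteriorAlgebra.ι R (F.dFunction D f)) ∧
      (∀ X Y ζ, ctr LinearMap.id Y (ctr LinearMap.id X (D.dA (ExteriorAlgebra.ι R ζ))) =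
        algebraMap R _ (D.dOneValue LinearMap.id ζ X Y)) ∧
      D.IsCartanDifferential LinearMap.id D.dA := by
  obtain ⟨d, h1, h2, h3, h⟩ := F.exists_differential D
  have : D.dA = d := IsDifferential.unique F (Classical.epsilon_spec ⟨d, h.isDifferential⟩)
    h.isDifferential
  rw [this]
  exact ⟨h1, h2, h3, h⟩

theorem DualFrame.dA_mul (a b : ExteriorAlgebra R (Module.Dual R L)) :
    D.dA (a * b) = D.dA a * b + invol a * D.dA b := (F.dA_spec D).1 a b

theorem DualFrame.dA_algebraMap (f : R) :
    D.dA (algebraMap R _ f) = ExteriorAlgebra.ι R (D.dFun f) := by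
  rw [(F.dA_spec D).2.1, F.ι_dFunction]

theorem DualFrame.dA_ι_mul (α : Module.Dual R L) (w : ExteriorAlgebra R (Module.Dual R L)) :
    D.dA (ExteriorAlgebra.ι R α * w) =
      D.dA (ExteriorAlgebra.ι R α) * w - ExteriorAlgebra.ι R α * D.dA w := by
  rw [F.dA_mul, invol_ι, neg_mul, sub_eq_add_neg]

theorem DualFrame.isCartanDifferential_dA : D.IsCartanDifferential LinearMap.id D.dA :=
  (F.dA_spec D).2.2.2

theorem DualFrame.dA_invol (w : ExteriorAlgebra R (Module.Dual R L)) :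
    D.dA (invol w) = - invol (D.dA w) := by
  induction w using exterior_homogeneous_induction with
  | add x y hx hy => rw [map_add, map_add, hx, hy, map_add, map_add, neg_add]
  | mem q w hw =>
    rw [invol_of_mem_real hw, invol_of_mem_real ((F.isCartanDifferential_dA D).mem q w hw), map_smul,
      pow_succ]
    simp

theorem DualFrame.dA_one : D.dA 1 = 0 := by
  have := F.dA_algebraMap D 1
  rw [map_one] at this
  rw [this, ← map_zero (ExteriorAlgebra.ι R)]
  congr 1
  ext X
  simp [dFun]

/-- Cartan's formula for the Lie derivative of a `1`-form. -/
theorem DualFrame.ι_lieOneForm (X : L) (β : Module.Dual R L) :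
    ExteriorAlgebra.ι R (D.lieOneForm X β) =
      ctr LinearMap.id X (D.dA (ExteriorAlgebra.ι R β)) +
        ExteriorAlgebra.ι R (D.dFun (β X)) := by
  have hm := (F.isCartanDifferential_dA D).mem 1 _ (ι_mem β)
  rw [← sub_eq_zero]
  refine F.eq_zero_of_ctr (q := 0) (Submodule.sub_mem _ (ι_mem _)
    (Submodule.add_mem _ (ctr_mem X hm) (ι_mem _))) fun Y => ?_
  rw [map_sub, map_add, (F.dA_spec D).2.2.1, ctr_ι, ctr_ι, dOneValue_apply, ← map_add, ← map_sub,
    ← map_zero (algebraMap R (ExteriorAlgebra R (Module.Dual R L)))]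
  congr 1
  simp only [lieOneForm, dFun, LinearMap.coe_mk, AddHom.coe_mk, LinearMap.id_apply]
  ring

variable {D}

theorem DualFrame.dA_dA (hD : D.IsLie) (w : ExteriorAlgebra R (Module.Dual R L)) :
    D.dA (D.dA w) = 0 := by
  obtain ⟨h1, h2, h3, h⟩ := F.dA_spec D
  exact F.differential_sq hD h1 h2 h3 h w

end FormDifferential

/-! ### Operators on forms -/

section Operators

variable (R L) in
/-- The ring of `ℝ`-linear operators on forms. -/
def FormOp : Type _ := Module.End ℝ (ExteriorAlgebra R (Module.Dual R L))

namespace FormOp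

instance : Ring (FormOp R L) :=
  inferInstanceAs (Ring (Module.End ℝ (ExteriorAlgebra R (Module.Dual R L))))

instance : Algebra ℝ (FormOp R L) :=
  inferInstanceAs (Algebra ℝ (Module.End ℝ (ExteriorAlgebra R (Module.Dual R L))))

instance : FunLike (FormOp R L) (ExteriorAlgebra R (Module.Dual R L))
    (ExteriorAlgebra R (Module.Dual R L)) :=
  inferInstanceAs (FunLike (ExteriorAlgebra R (Module.Dual R L) →ₗ[ℝ]
    ExteriorAlgebra R (Module.Dual R L)) _ _)

instance : LinearMapClass (FormOp R L) ℝ (ExteriorAlgebra R (Module.Dual R L))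
    (ExteriorAlgebra R (Module.Dual R L)) :=
  inferInstanceAs (LinearMapClass (ExteriorAlgebra R (Module.Dual R L) →ₗ[ℝ]
    ExteriorAlgebra R (Module.Dual R L)) ℝ _ _)

/-- A linear operator as an element of the ring of operators. -/
def of : (ExteriorAlgebra R (Module.Dual R L) →ₗ[ℝ] ExteriorAlgebra R (Module.Dual R L)) ≃ₗ[ℝ]
    FormOp R L := LinearEquiv.refl ℝ _

variable (S T : FormOp R L) (w : ExteriorAlgebra R (Module.Dual R L))

theorem mul_apply : (S * T) w = S (T w) := rfl
theorem add_apply : (S + T) w = S w + T w := rfl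
theorem sub_apply : (S - T) w = S w - T w := rfl

@[ext] theorem ext {S T : FormOp R L} (h : ∀ w, S w = T w) : S = T := DFunLike.ext _ _ h

end FormOp

/-- The differential as an operator. -/
def dOp (D : AnchoredBracket R L) : FormOp R L := FormOp.of D.dA

theorem dOp_apply (D : AnchoredBracket R L) (w : ExteriorAlgebra R (Module.Dual R L)) :
    D.dOp w = D.dA w := rfl

/-- Interior products as a homomorphism to the `ℝ`-linear operators on forms. -/
def iOp : ExteriorAlgebra R L →ₐ[ℝ] FormOp R L where
  toFun V := FormOp.of ((interior V).restrictScalars ℝ)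
  map_one' := by
    ext w; exact LinearMap.congr_fun (map_one (interior (R := R) (L := L))) w
  map_mul' V W := by
    ext w; exact LinearMap.congr_fun (map_mul (interior (R := R) (L := L)) V W) w
  map_zero' := by
    ext w; exact LinearMap.congr_fun (map_zero (interior (R := R) (L := L))) w
  map_add' V W := by
    ext w; exact LinearMap.congr_fun (map_add (interior (R := R) (L := L)) V W) w
  commutes' r := by
    ext w
    rw [IsScalarTower.algebraMap_apply ℝ R]
    change interior (algebraMap R _ (algebraMap ℝ R r)) w = r • w
    rw [interior_algebraMap, algebraMap_smul]

/-- Exterior products as a homomorphism to the `ℝ`-linear operators on forms. -/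
def eOp : ExteriorAlgebra R (Module.Dual R L) →ₐ[ℝ] FormOp R L where
  toFun a := FormOp.of (LinearMap.mulLeft ℝ a)
  map_one' := by ext w; exact one_mul w
  map_mul' a b := by ext w; exact mul_assoc a b w
  map_zero' := by ext w; exact zero_mul w
  map_add' a b := by ext w; exact add_mul a b w
  commutes' r := by ext w; exact (Algebra.smul_def r w).symm

theorem iOp_apply (V : ExteriorAlgebra R L) (w : ExteriorAlgebra R (Module.Dual R L)) :
    iOp V w = interior V w := rfl

theorem eOp_apply (a w : ExteriorAlgebra R (Module.Dual R L)) : eOp a w = a * w := rfl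

theorem eOp_injective : Function.Injective (eOp (R := R) (L := L)) := fun a b h => by
  have := DFunLike.congr_fun h 1
  rwa [eOp_apply, eOp_apply, mul_one, mul_one] at this

theorem eOp_algebraMap (f : R) :
    eOp (algebraMap R (ExteriorAlgebra R (Module.Dual R L)) f) = iOp (algebraMap R _ f) := by
  ext w
  rw [eOp_apply, iOp_apply, interior_algebraMap, Algebra.smul_def]

theorem iOp_algebraMap_mul (f : R) {T : FormOp R L}
    (hT : ∀ w, T (f • w) = f • T w) :
    iOp (algebraMap R (ExteriorAlgebra R L) f) * T = T * iOp (algebraMap R _ f) := by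
  ext w
  simp only [FormOp.mul_apply, iOp_apply, interior_algebraMap, hT]

theorem iOp_algebraMap_mul_iOp (f : R) (V : ExteriorAlgebra R L) :
    iOp (algebraMap R (ExteriorAlgebra R L) f) * iOp V = iOp V * iOp (algebraMap R _ f) :=
  iOp_algebraMap_mul f fun w => map_smul (interior V) f w

theorem iOp_algebraMap_mul_eOp (f : R) (a : ExteriorAlgebra R (Module.Dual R L)) :
    iOp (algebraMap R (ExteriorAlgebra R L) f) * eOp a = eOp a * iOp (algebraMap R _ f) :=
  iOp_algebraMap_mul f fun w => by rw [eOp_apply, eOp_apply, mul_smul_comm]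

/-- Contraction of multivectors becomes the graded commutator with e_α; this lets operators on
multivectors be studied inside the operators on forms. -/
theorem iOp_contract (α : Module.Dual R L) (V : ExteriorAlgebra R L) :
    iOp (contract α V) =
      eOp (ExteriorAlgebra.ι R α) * iOp V - iOp (invol V) * eOp (ExteriorAlgebra.ι R α) := by
  rw [eq_sub_iff_add_eq]
  ext w
  exact (ι_mul_interior α V w).symm

theorem iOp_ι_mul_iOp (Z : L) (V : ExteriorAlgebra R L) :
    iOp (ExteriorAlgebra.ι R Z) * iOp V = iOp (invol V) * iOp (ExteriorAlgebra.ι R Z) := by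
  rw [← map_mul, ι_mul_eq, map_mul]

theorem iOp_bivector_mul (P : ⋀[R]^2 L) (V : ExteriorAlgebra R L) :
    iOp V * iOp (P : ExteriorAlgebra R L) = iOp (P : ExteriorAlgebra R L) * iOp V := by
  rw [← map_mul, mul_eq_of_invol_eq (by rw [invol_of_mem P.2]; simp), map_mul]

theorem eOp_ι_mul_bivector (P : ⋀[R]^2 L) (α : Module.Dual R L) :
    eOp (ExteriorAlgebra.ι R α) * iOp (P : ExteriorAlgebra R L) =
      iOp (P : ExteriorAlgebra R L) * eOp (ExteriorAlgebra.ι R α) +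
        iOp (ExteriorAlgebra.ι R (sharp P α)) := by
  rw [← contract_sharp, iOp_contract, invol_of_mem P.2]; simp

theorem iOp_ι_mul_eOp (X : L) (a : ExteriorAlgebra R (Module.Dual R L)) :
    iOp (ExteriorAlgebra.ι R X) * eOp a =
      eOp (ctr LinearMap.id X a) + eOp (invol a) * iOp (ExteriorAlgebra.ι R X) := by
  ext w
  simp only [FormOp.mul_apply, FormOp.add_apply, iOp_apply, eOp_apply, interior_ι, ctr_mul]

theorem iOp_ι_mul_eOp_ι (X : L) (α : Module.Dual R L) :
    iOp (ExteriorAlgebra.ι R X) * eOp (ExteriorAlgebra.ι R α) =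
      iOp (algebraMap R _ (α X)) - eOp (ExteriorAlgebra.ι R α) * iOp (ExteriorAlgebra.ι R X) := by
  rw [iOp_ι_mul_eOp, ctr_ι, invol_ι, map_neg, neg_mul, eOp_algebraMap, sub_eq_add_neg]; rfl

variable (F : DualFrame (LinearMap.id : Module.Dual R L →ₗ[R] Module.Dual R L) n)
  {D : AnchoredBracket R L}

include F

theorem DualFrame.dA_mul_eOp (a : ExteriorAlgebra R (Module.Dual R L)) :
    D.dOp * eOp a =
      eOp (D.dA a) + eOp (invol a) * D.dOp := by
  ext w
  exact F.dA_mul D a w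

theorem DualFrame.dA_mul_eOp_ι (α : Module.Dual R L) :
    D.dOp * eOp (ExteriorAlgebra.ι R α) =
      eOp (D.dA (ExteriorAlgebra.ι R α)) - eOp (ExteriorAlgebra.ι R α) * D.dOp := by
  rw [F.dA_mul_eOp, invol_ι, map_neg, neg_mul, sub_eq_add_neg]

theorem DualFrame.dA_mul_iOp_algebraMap (f : R) :
    D.dOp * iOp (algebraMap R _ f) =
      iOp (algebraMap R _ f) * D.dOp + eOp (ExteriorAlgebra.ι R (D.dFun f)) := by
  rw [← eOp_algebraMap, F.dA_mul_eOp, AlgHom.commutes, F.dA_algebraMap, add_comm]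

/-- The Lie derivative of functions. -/
theorem DualFrame.lie_mul_iOp_algebraMap (X : L) (f : R) :
    (iOp (ExteriorAlgebra.ι R X) * D.dOp + D.dOp * iOp (ExteriorAlgebra.ι R X)) *
        iOp (algebraMap R _ f) -
      iOp (algebraMap R _ f) * (iOp (ExteriorAlgebra.ι R X) * D.dOp +
        D.dOp * iOp (ExteriorAlgebra.ι R X)) =
      iOp (algebraMap R _ (D.anchor X f)) := by
  have h1 := F.dA_mul_iOp_algebraMap (D := D) f
  have h2 := iOp_algebraMap_mul_iOp f (ExteriorAlgebra.ι R X)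
  have h3 := iOp_ι_mul_eOp_ι X (D.dFun f)
  have h4 : D.dFun f X = D.anchor X f := rfl
  rw [h4] at h3
  set i := iOp (ExteriorAlgebra.ι R X)
  set m := iOp (algebraMap R (ExteriorAlgebra R L) f)
  linear_combination (norm := noncomm_ring) i * h1 + h1 * i - h2 * D.dOp - D.dOp * h2 + h3

/-- The Lie derivative of `1`-forms. -/
theorem DualFrame.lie_mul_eOp_ι (X : L) (β : Module.Dual R L) :
    (iOp (ExteriorAlgebra.ι R X) * D.dOp + D.dOp * iOp (ExteriorAlgebra.ι R X)) *
        eOp (ExteriorAlgebra.ι R β) -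
      eOp (ExteriorAlgebra.ι R β) * (iOp (ExteriorAlgebra.ι R X) * D.dOp +
        D.dOp * iOp (ExteriorAlgebra.ι R X)) =
      eOp (ExteriorAlgebra.ι R (D.lieOneForm X β)) := by
  have h1 := F.dA_mul_eOp_ι (D := D) β
  have h2 := iOp_ι_mul_eOp_ι X β
  have h3 := F.dA_mul_iOp_algebraMap (D := D) (β X)
  have h4 := iOp_ι_mul_eOp X (D.dA (ExteriorAlgebra.ι R β))
  have h5 : invol (D.dA (ExteriorAlgebra.ι R β)) = D.dA (ExteriorAlgebra.ι R β) := by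
    rw [invol_of_mem ((F.isCartanDifferential_dA D).mem 1 _ (ι_mem β))]; simp
  rw [h5] at h4
  rw [F.ι_lieOneForm, map_add]
  set i := iOp (ExteriorAlgebra.ι R X)
  set e := eOp (ExteriorAlgebra.ι R β)
  linear_combination (norm := noncomm_ring) i * h1 + h4 - h2 * D.dOp + D.dOp * h2 - h1 * i + h3

/-- The bracket of multivectors is derived from d through V ↦ i_V: on sections this is Cartan's
[L_X, i_Y] = i_{[X,Y]}. The volume form serves to make V ↦ i_V injective. -/
theorem DualFrame.isDerivedGenerator_dA {lam : ⋀[R]^N (Module.Dual R L)}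
    {Lam : ExteriorAlgebra R L} (hl : IsDualVolume lam Lam) : D.IsDerivedGenerator iOp D.dOp where
  injective V W h := hl.interior_injective F (LinearMap.ext fun w => DFunLike.congr_fun h w)
  sections X Y := by
    rw [derivedBracket_odd _ _ (invol_ι X)]
    ext w
    have := (F.isCartanDifferential_dA D).cartan X Y w
    simpa [iOp_apply, FormOp.mul_apply, FormOp.add_apply, FormOp.sub_apply, dOp_apply] using this
  anchor X f := by
    rw [derivedBracket_odd _ _ (invol_ι X)]
    exact F.lie_mul_iOp_algebraMap X f
  functions f g := by
    rw [derivedBracket_even _ _ (AlgHom.commutes _ _), AlgHom.commutes]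
    have h1 := F.dA_mul_iOp_algebraMap (D := D) f
    have h2 := iOp_algebraMap_mul_eOp g (ExteriorAlgebra.ι R (D.dFun f))
    set m := iOp (algebraMap R (ExteriorAlgebra R L) f)
    set m' := iOp (algebraMap R (ExteriorAlgebra R L) g)
    linear_combination (norm := noncomm_ring) m' * h1 - h1 * m' + h2

end Operators

end AnchoredBracket
end

noncomputable section

set_option linter.unusedSectionVars false

namespace AnchoredBracket

/-! ### The operators defined by ψ^(2), and their commutators -/

section Induction

variable {R E : Type*} [CommRing R] [AddCommGroup E] [Module R E]

theorem exteriorPower_three_induction {p : ⋀[R]^3 E → Prop}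
    (add : ∀ x y, p x → p y → p (x + y))
    (mul : ∀ a b c, p (exteriorPower.ιMulti R 3 ![a, b, c])) (w : ⋀[R]^3 E) : p w := by
  have h : w ∈ Submodule.span R (Set.range (exteriorPower.ιMulti R 3 (M := E))) := by
    rw [exteriorPower.ιMulti_span]; trivial
  rw [Submodule.mem_span_set'] at h
  obtain ⟨n, f, g, rfl⟩ := h
  have hz : p 0 := by
    rw [← (exteriorPower.ιMulti R 3 (M := E)).map_coord_zero (m := ![0, 0, 0]) 0 rfl]
    exact mul 0 0 0
  refine Finset.sum_induction _ p add hz fun i _ => ?_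
  obtain ⟨v, hv⟩ := (g i).2
  rw [← hv]
  have e : v = ![v 0, v 1, v 2] := by ext j; fin_cases j <;> rfl
  have := (exteriorPower.ιMulti R 3 (M := E)).map_update_smul v 0 (f i) (v 0)
  rw [Function.update_eq_self] at this
  rw [← this]
  convert mul (f i • v 0) (v 1) (v 2) using 2
  ext j; fin_cases j <;> rfl

theorem coe_ιMulti_three (a b c : E) :
    ((exteriorPower.ιMulti R 3 ![a, b, c] : ⋀[R]^3 E) : ExteriorAlgebra R E) =
      ExteriorAlgebra.ι R a * (ExteriorAlgebra.ι R b * ExteriorAlgebra.ι R c) := by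
  simp [ExteriorAlgebra.ιMulti_apply]

end Induction

section

variable {R L : Type*} [CommRing R] [AddCommGroup L] [Module R L]
  (P : ⋀[R]^2 L)

theorem psiTwoTensor_add (ψ ψ' : ⋀[R]^3 (Module.Dual R L)) :
    psiTwoTensor P (ψ + ψ') = psiTwoTensor P ψ + psiTwoTensor P ψ' := map_add _ _ _

theorem psiTwoTensor_ιMulti (α β γ : Module.Dual R L) :
    psiTwoTensor P (exteriorPower.ιMulti R 3 ![α, β, γ]) =
      α ⊗ₜ (ExteriorAlgebra.ι R (sharp P β) * ExteriorAlgebra.ι R (sharp P γ)) +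
      β ⊗ₜ (ExteriorAlgebra.ι R (sharp P γ) * ExteriorAlgebra.ι R (sharp P α)) +
      γ ⊗ₜ (ExteriorAlgebra.ι R (sharp P α) * ExteriorAlgebra.ι R (sharp P β)) := by
  rw [psiTwoTensor, exteriorPower.alternatingMapLinearEquiv_apply_ιMulti]; rfl

/-- Reduces additive identities for ψ^(2) to tensors ξ ⊗ X ∧ Y, where the operator on forms is e_ξ
i_X i_Y. -/
theorem psiTwoTensor_induction {p : Module.Dual R L ⊗[R] ExteriorAlgebra R L → Prop}
    (add : ∀ x y, p x → p y → p (x + y))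
    (tmul : ∀ ξ X Y, p (ξ ⊗ₜ (ExteriorAlgebra.ι R X * ExteriorAlgebra.ι R Y)))
    (ψ : ⋀[R]^3 (Module.Dual R L)) : p (psiTwoTensor P ψ) := by
  refine exteriorPower_three_induction (p := fun ψ => p (psiTwoTensor P ψ)) ?_ ?_ ψ
  · intro x y hx hy; rw [psiTwoTensor_add]; exact add _ _ hx hy
  · intro α β γ
    rw [psiTwoTensor_ιMulti]
    exact add _ _ (add _ _ (tmul _ _ _) (tmul _ _ _)) (tmul _ _ _)

theorem sectionY_add (ψ ψ' : ⋀[R]^3 (Module.Dual R L)) :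
    sectionY P (ψ + ψ') = sectionY P ψ + sectionY P ψ' := by
  simp only [sectionY, Submodule.coe_add, map_add, neg_add]

theorem interior_bivector_ι_mul (α : Module.Dual R L) (w : ExteriorAlgebra R (Module.Dual R L)) :
    interior (P : ExteriorAlgebra R L) (ExteriorAlgebra.ι R α * w) =
      ExteriorAlgebra.ι R α * interior (P : ExteriorAlgebra R L) w -
        ctr LinearMap.id (sharp P α) w := by
  rw [ι_mul_interior_bivector]; abel

theorem interior_bivector_ι (α : Module.Dual R L) :
    interior (P : ExteriorAlgebra R L) (ExteriorAlgebra.ι R α) = 0 :=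
  interior_eq_zero_of_lt one_lt_two P.2 (ι_mem α)

theorem interior_bivector_ι_mul_ι (α β : Module.Dual R L) :
    interior (P : ExteriorAlgebra R L) (ExteriorAlgebra.ι R α * ExteriorAlgebra.ι R β) =
      - algebraMap R _ (β (sharp P α)) := by
  rw [interior_bivector_ι_mul, interior_bivector_ι, mul_zero, zero_sub, ctr_ι]; rfl

theorem sectionY_ιMulti (α β γ : Module.Dual R L) :
    sectionY P (exteriorPower.ιMulti R 3 ![α, β, γ]) =
      γ (sharp P β) • sharp P α + β (sharp P α) • sharp P γ - γ (sharp P α) • sharp P β := by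
  have : interior (P : ExteriorAlgebra R L)
      ((exteriorPower.ιMulti R 3 ![α, β, γ] : ⋀[R]^3 (Module.Dual R L)) :
        ExteriorAlgebra R (Module.Dual R L)) =
      ExteriorAlgebra.ι R (-(γ (sharp P β) • α + β (sharp P α) • γ - γ (sharp P α) • β)) := by
    rw [coe_ιMulti_three, interior_bivector_ι_mul, interior_bivector_ι_mul_ι, ctr_ι_mul, ctr_ι]
    simp only [map_neg, map_sub, map_add, map_smul, Algebra.smul_def, LinearMap.id_apply, mul_neg,
      Algebra.commutes]
    abel
  rw [sectionY, this, ExteriorAlgebra.ι_leftInverse]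
  simp only [map_neg, map_sub, map_add, map_smul, neg_neg]

end

section

variable {R L : Type*} [CommRing R] [Algebra ℝ R] [AddCommGroup L] [Module R L] [Module ℝ L]
  [IsScalarTower ℝ R L] {n N : ℕ} (P : ⋀[R]^2 L) (ψ : ⋀[R]^3 (Module.Dual R L))

theorem eOp_ι_add_mul_swap (α β : Module.Dual R L) :
    eOp (ExteriorAlgebra.ι R α) * eOp (ExteriorAlgebra.ι R β) +
      eOp (ExteriorAlgebra.ι R β) * eOp (ExteriorAlgebra.ι R α) = 0 := by
  rw [← map_mul eOp, ← map_mul eOp, ← map_add, ExteriorAlgebra.ι_add_mul_swap, map_zero]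

theorem iOp_ι_add_mul_swap (X Y : L) :
    iOp (ExteriorAlgebra.ι R X) * iOp (ExteriorAlgebra.ι R Y) +
      iOp (ExteriorAlgebra.ι R Y) * iOp (ExteriorAlgebra.ι R X) = 0 := by
  rw [← map_mul iOp, ← map_mul iOp, ← map_add, ExteriorAlgebra.ι_add_mul_swap, map_zero]

/-- The operator on forms defined by a form-valued multivector. -/
def formTensorEnd : Module.Dual R L ⊗[R] ExteriorAlgebra R L →ₗ[R]
    Module.End R (ExteriorAlgebra R (Module.Dual R L)) :=
  TensorProduct.lift ((LinearMap.mul R (Module.End R (ExteriorAlgebra R (Module.Dual R L)))).compl₁₂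
    ((LinearMap.mul R (ExteriorAlgebra R (Module.Dual R L))) ∘ₗ ExteriorAlgebra.ι R)
    (interior (R := R) (L := L)).toLinearMap)

/-- The operator on forms defined by a form-valued multivector, as an `ℝ`-linear operator. -/
def formTensorOp : Module.Dual R L ⊗[R] ExteriorAlgebra R L →+ FormOp R L :=
  AddMonoidHom.mk' (fun t => FormOp.of ((formTensorEnd t).restrictScalars ℝ)) fun s t => by
    rw [map_add formTensorEnd s t]; rfl

/-- The operator `∂̲`. -/
def uOp : FormOp R L := formTensorOp (psiTwoTensor P ψ)

theorem formTensorOp_tmul (ξ : Module.Dual R L) (Q : ExteriorAlgebra R L) :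
    formTensorOp (ξ ⊗ₜ Q) = eOp (ExteriorAlgebra.ι R ξ) * iOp Q := by
  ext w; rfl

/-- The operator on multivectors defined by a vector-valued form. -/
def vectorTensorOp : Module.Dual R L ⊗[R] ExteriorAlgebra R L →ₗ[R]
    Module.End R (ExteriorAlgebra R L) :=
  TensorProduct.lift (((LinearMap.mul R (Module.End R (ExteriorAlgebra R L))).compl₁₂
    (LinearMap.mul R (ExteriorAlgebra R L))
    (CliffordAlgebra.contractLeft (Q := (0 : QuadraticForm R L)))).flip)

theorem vectorTensorOp_tmul (ξ : Module.Dual R L) (Q V : ExteriorAlgebra R L) :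
    vectorTensorOp (ξ ⊗ₜ Q) V = Q * contract ξ V := rfl

theorem dUnderline_apply (V : ExteriorAlgebra R L) :
    dUnderline P ψ V = vectorTensorOp (psiTwoTensor P ψ) V := rfl

theorem dUnderline_mem {q : ℕ} {V : ExteriorAlgebra R L} (hV : V ∈ ⋀[R]^q L) :
    dUnderline P ψ V ∈ ⋀[R]^(q + 1) L := by
  rw [dUnderline_apply]
  refine psiTwoTensor_induction P (p := fun t => vectorTensorOp t V ∈ ⋀[R]^(q + 1) L) ?_ ?_ ψ
  · intro x y hx hy
    rw [map_add, LinearMap.add_apply]; exact Submodule.add_mem _ hx hy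
  · intro ξ X Y
    rw [vectorTensorOp_tmul]
    cases q with
    | zero => rw [contract_mem_zero ξ hV, mul_zero]; exact Submodule.zero_mem _
    | succ q =>
      exact exteriorPower_mul_mem (by omega)
        (exteriorPower_mul_mem (r := 2) rfl (ι_mem X) (ι_mem Y)) (contract_mem ξ hV)

/-- For ξ ⊗ Q, the even factor i_Q commutes with interior products, so the commutator with i_V
involves only [e_ξ, i_V], which is an interior product again. -/
theorem iOp_dUnderline (V : ExteriorAlgebra R L) :
    iOp (dUnderline P ψ V) = uOp P ψ * iOp V - iOp (invol V) * uOp P ψ := by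
  rw [dUnderline_apply, uOp]
  refine psiTwoTensor_induction P (p := fun t => iOp (vectorTensorOp t V) =
    formTensorOp t * iOp V - iOp (invol V) * formTensorOp t) ?_ ?_ ψ
  · intro x y hx hy
    rw [map_add, LinearMap.add_apply, map_add, hx, hy, map_add]; noncomm_ring
  · intro ξ X Y
    rw [vectorTensorOp_tmul, formTensorOp_tmul, map_mul, iOp_contract]
    have h1 := iOp_ι_mul_eOp_ι X ξ
    have h2 := iOp_ι_mul_eOp_ι Y ξ
    have h3 := iOp_ι_mul_iOp X V
    have h4 := iOp_ι_mul_iOp Y V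
    have h3' := iOp_ι_mul_iOp X (invol V)
    have h4' := iOp_ι_mul_iOp Y (invol V)
    rw [invol_invol] at h3' h4'
    have h5 := iOp_algebraMap_mul_iOp (ξ X) (ExteriorAlgebra.ι R Y)
    have h6 := iOp_algebraMap_mul_iOp (ξ Y) (invol V)
    have h7 := iOp_algebraMap_mul_iOp (ξ X) (invol V)
    have h8 := iOp_algebraMap_mul_iOp (ξ Y) (ExteriorAlgebra.ι R X)
    rw [map_mul]
    set a := iOp (ExteriorAlgebra.ι R X)
    set b := iOp (ExteriorAlgebra.ι R Y)
    set e := eOp (ExteriorAlgebra.ι R ξ)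
    set v := iOp V
    set v' := iOp (invol V)
    set x := iOp (algebraMap R (ExteriorAlgebra R L) (ξ X))
    set y := iOp (algebraMap R (ExteriorAlgebra R L) (ξ Y))
    -- Moving i_X i_Y past e_ξ leaves an interior product by a vector; `k3` says that it
    -- graded-commutes with i_V, so it drops out.
    have k1 : a * b * e = a * y - x * b + e * a * b := by
      linear_combination (norm := noncomm_ring) a * h2 - h1 * b
    have k2 : a * b * v' = v' * a * b := by
      linear_combination (norm := noncomm_ring) a * h4' + h3 * b
    have k3 : (a * y - x * b) * v = v' * (a * y - x * b) := by
      linear_combination (norm := noncomm_ring) - h8 * v + y * h3 + h6 * a + v' * h8 - x * h4 - h7 * b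
    linear_combination (norm := noncomm_ring) k1 * v - k2 * e - v' * k1 + k3

/-- The contraction of `ψ^(2)` with `α` and `β`, as a `1`-form. -/
theorem uOp_bracket (α β : Module.Dual R L) :
    (eOp (ExteriorAlgebra.ι R α) * uOp P ψ + uOp P ψ * eOp (ExteriorAlgebra.ι R α)) *
        eOp (ExteriorAlgebra.ι R β) -
      eOp (ExteriorAlgebra.ι R β) * (eOp (ExteriorAlgebra.ι R α) * uOp P ψ +
        uOp P ψ * eOp (ExteriorAlgebra.ι R α)) =
      - eOp (ExteriorAlgebra.ι R (psiTwo P ψ α β)) := by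
  let T : Module.Dual R L ⊗[R] ExteriorAlgebra R L →ₗ[R] Module.Dual R L :=
    TensorProduct.lift ((LinearMap.lsmul R (Module.Dual R L)).flip.compl₂
      (ExteriorAlgebra.algebraMapInv.toLinearMap ∘ₗ contract β ∘ₗ contract α))
  have hT : T (psiTwoTensor P ψ) = psiTwo P ψ α β := by
    ext Z
    rw [← psiTwoTensor_value]
    suffices h : Module.Dual.eval R L Z ∘ₗ T = TensorProduct.lift ((LinearMap.lsmul R R).compl₁₂
        (Module.Dual.eval R L Z)
        (ExteriorAlgebra.algebraMapInv.toLinearMap ∘ₗ contract β ∘ₗ contract α)) from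
      LinearMap.congr_fun h _
    refine TensorProduct.ext' fun ξ Q => ?_
    simp [T, mul_comm]
  rw [← hT, uOp]
  refine psiTwoTensor_induction P (p := fun t => (eOp (ExteriorAlgebra.ι R α) * formTensorOp t +
      formTensorOp t * eOp (ExteriorAlgebra.ι R α)) * eOp (ExteriorAlgebra.ι R β) -
      eOp (ExteriorAlgebra.ι R β) * (eOp (ExteriorAlgebra.ι R α) * formTensorOp t +
        formTensorOp t * eOp (ExteriorAlgebra.ι R α)) =
      - eOp (ExteriorAlgebra.ι R (T t))) ?_ ?_ ψ
  · intro x y hx hy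
    simp only [map_add, neg_add]
    rw [← hx, ← hy]; noncomm_ring
  · intro ξ X Y
    have hv : T (ξ ⊗ₜ (ExteriorAlgebra.ι R X * ExteriorAlgebra.ι R Y)) =
        (α X * β Y - α Y * β X) • ξ := by
      simp [T, contract_ι_mul, ExteriorAlgebra.algebraMapInv]
      ring_nf
    have hs : ∀ (r : R), eOp (ExteriorAlgebra.ι R (r • ξ)) =
        eOp (ExteriorAlgebra.ι R ξ) * iOp (algebraMap R _ r) := fun r => by
      rw [map_smul, Algebra.smul_def, map_mul, eOp_algebraMap, iOp_algebraMap_mul_eOp]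
    rw [hv, formTensorOp_tmul, hs, map_sub, map_mul, map_mul, map_sub, map_mul, map_mul, map_mul]
    have h1 := eOp_ι_add_mul_swap α ξ
    have h2 := eOp_ι_add_mul_swap β ξ
    have h3 := iOp_ι_mul_eOp_ι X α
    have h4 := iOp_ι_mul_eOp_ι X β
    have h5 := iOp_ι_mul_eOp_ι Y α
    have h6 := iOp_ι_mul_eOp_ι Y β
    have h7 := iOp_algebraMap_mul_iOp (α X) (ExteriorAlgebra.ι R Y)
    have h8 := iOp_algebraMap_mul_iOp (α Y) (ExteriorAlgebra.ι R X)
    have h9 := iOp_algebraMap_mul_eOp (α X) (ExteriorAlgebra.ι R β)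
    have h10 := iOp_algebraMap_mul_eOp (α Y) (ExteriorAlgebra.ι R β)
    have h11 := iOp_algebraMap_mul_iOp (α Y) (algebraMap R (ExteriorAlgebra R L) (β X))
    have h12 := iOp_algebraMap_mul_eOp (α Y) (ExteriorAlgebra.ι R ξ)
    set a := iOp (ExteriorAlgebra.ι R X)
    set b := iOp (ExteriorAlgebra.ι R Y)
    set e := eOp (ExteriorAlgebra.ι R ξ)
    set eα := eOp (ExteriorAlgebra.ι R α)
    set eβ := eOp (ExteriorAlgebra.ι R β)
    set αX := iOp (algebraMap R (ExteriorAlgebra R L) (α X))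
    set βX := iOp (algebraMap R (ExteriorAlgebra R L) (β X))
    set αY := iOp (algebraMap R (ExteriorAlgebra R L) (α Y))
    set βY := iOp (algebraMap R (ExteriorAlgebra R L) (β Y))
    -- The commutator with e_α contracts X ∧ Y once, that with e_β once more; what remains is a
    -- function times e_ξ.
    have k1 : eα * (e * (a * b)) + e * (a * b) * eα = e * (αY * a - αX * b) := by
      linear_combination (norm := noncomm_ring) h1 * (a * b) + e * a * h5 - e * h3 * b - e * h8
    have k2 : (αY * a - αX * b) * eβ + eβ * (αY * a - αX * b) = αY * βX - αX * βY := by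
      linear_combination (norm := noncomm_ring) αY * h4 - αX * h6 - h10 * a + h9 * b
    rw [k1]
    linear_combination (norm := noncomm_ring) e * k2 - h2 * (αY * a - αX * b)

theorem invol_uOp (w : ExteriorAlgebra R (Module.Dual R L)) :
    uOp P ψ (invol w) = - invol (uOp P ψ w) := by
  rw [uOp]
  refine psiTwoTensor_induction P (p := fun t => formTensorOp t (invol w) =
    - invol (formTensorOp t w)) ?_ ?_ ψ
  · intro x y hx hy
    rw [map_add, FormOp.add_apply, FormOp.add_apply, hx, hy, map_add, neg_add]
  · intro ξ X Y
    rw [formTensorOp_tmul, FormOp.mul_apply, FormOp.mul_apply, eOp_apply, eOp_apply, iOp_apply,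
      iOp_apply, map_mul invol, invol_ι, interior_mul, interior_mul, ← interior_invol,
      ← interior_invol]
    simp

/-! ### Iterated commutators with `i_P` -/

/-- On α ∧ β ∧ γ, each commutator with i_P replaces one exterior factor e_α by -i_{P^♯α}. After two
replacements, moving the interior products to the right yields ∂̲, and the contractions met on the
way add up to i_Y. This is the origin of Y. -/
theorem commutator_commutator_eOp :
    iOp (P : ExteriorAlgebra R L) * (iOp (P : ExteriorAlgebra R L) *
        eOp (ψ : ExteriorAlgebra R (Module.Dual R L)) - eOp (ψ : ExteriorAlgebra R (Module.Dual R L)) *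
        iOp (P : ExteriorAlgebra R L)) -
      (iOp (P : ExteriorAlgebra R L) * eOp (ψ : ExteriorAlgebra R (Module.Dual R L)) -
        eOp (ψ : ExteriorAlgebra R (Module.Dual R L)) * iOp (P : ExteriorAlgebra R L)) *
        iOp (P : ExteriorAlgebra R L) =
      (uOp P ψ + iOp (ExteriorAlgebra.ι R (sectionY P ψ))) +
        (uOp P ψ + iOp (ExteriorAlgebra.ι R (sectionY P ψ))) := by
  induction ψ using exteriorPower_three_induction with
  | add x y hx hy =>
    have h : ∀ z : ⋀[R]^3 (Module.Dual R L), uOp P z = formTensorOp (psiTwoTensor P z) := fun _ => rfl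
    rw [h] at hx hy ⊢
    simp only [psiTwoTensor_add, sectionY_add, map_add, Submodule.coe_add]
    linear_combination (norm := noncomm_ring) hx + hy
  | mul α β γ =>
    rw [coe_ιMulti_three, sectionY_ιMulti, uOp, psiTwoTensor_ιMulti]
    simp only [map_add, map_sub, map_mul, formTensorOp_tmul]
    have hs : ∀ (r : R) (X : L), iOp (ExteriorAlgebra.ι R (r • X)) =
        iOp (algebraMap R _ r) * iOp (ExteriorAlgebra.ι R X) := fun r X => by
      rw [map_smul, Algebra.smul_def, map_mul]
    simp only [hs]
    have h1 := eOp_ι_mul_bivector P α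
    have h2 := eOp_ι_mul_bivector P β
    have h3 := eOp_ι_mul_bivector P γ
    have g1 := iOp_bivector_mul P (ExteriorAlgebra.ι R (sharp P α))
    have g2 := iOp_bivector_mul P (ExteriorAlgebra.ι R (sharp P β))
    have g3 := iOp_bivector_mul P (ExteriorAlgebra.ι R (sharp P γ))
    have k1 := iOp_ι_mul_eOp_ι (sharp P β) γ
    have k2 := iOp_ι_mul_eOp_ι (sharp P α) γ
    have k3 := iOp_ι_mul_eOp_ι (sharp P α) β
    have l1 := iOp_algebraMap_mul_iOp (γ (sharp P β)) (ExteriorAlgebra.ι R (sharp P α))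
    have l2 := iOp_ι_add_mul_swap (R := R) (sharp P α) (sharp P γ)
    set p := iOp (P : ExteriorAlgebra R L)
    set a := eOp (ExteriorAlgebra.ι R α)
    set b := eOp (ExteriorAlgebra.ι R β)
    set c := eOp (ExteriorAlgebra.ι R γ)
    set A := iOp (ExteriorAlgebra.ι R (sharp P α))
    set B := iOp (ExteriorAlgebra.ι R (sharp P β))
    set C := iOp (ExteriorAlgebra.ι R (sharp P γ))
    have e1 : p * (a * (b * c)) - a * (b * c) * p = -(A * b * c + a * B * c + a * b * C) := by
      linear_combination (norm := noncomm_ring) - h1 * b * c - a * h2 * c - a * b * h3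
    rw [e1]
    have e2 : p * (A * b * c + a * B * c + a * b * C) - (A * b * c + a * B * c + a * b * C) * p =
      -(2 : ℤ) • (A * B * c + A * b * C + a * B * C) := by
      linear_combination (norm := noncomm_ring)
        - g1 * b * c - A * h2 * c - A * b * h3 - h1 * B * c - a * g2 * c - a * B * h3 -
          h1 * b * C - a * h2 * C - a * b * g3
    have e3 : A * B * c + A * b * C + a * B * C = iOp (algebraMap R _ (γ (sharp P β))) * A +
        iOp (algebraMap R _ (β (sharp P α))) * C - iOp (algebraMap R _ (γ (sharp P α))) * B +
        (a * (B * C) + b * (C * A) + c * (A * B)) := by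
      linear_combination (norm := noncomm_ring) A * k1 - k2 * B + k3 * C - l1 - b * l2
    linear_combination (norm := noncomm_ring) - e2 + (2 : ℤ) • e3

/-- The third replacement: i_P commutes with i_Y, and each of the three terms of ∂̲ turns its
remaining exterior factor into an interior product, which gives the factor 3. -/
theorem commutator_iOp_map_sharp :
    iOp (P : ExteriorAlgebra R L) * (uOp P ψ + iOp (ExteriorAlgebra.ι R (sectionY P ψ))) -
      (uOp P ψ + iOp (ExteriorAlgebra.ι R (sectionY P ψ))) * iOp (P : ExteriorAlgebra R L) =
    -(3 : ℤ) • iOp (ExteriorAlgebra.map (sharp P) (ψ : ExteriorAlgebra R (Module.Dual R L))) := by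
  rw [mul_add, add_mul, iOp_bivector_mul]
  suffices h : iOp (P : ExteriorAlgebra R L) * uOp P ψ - uOp P ψ * iOp (P : ExteriorAlgebra R L) =
    -(3 : ℤ) • iOp (ExteriorAlgebra.map (sharp P) (ψ : ExteriorAlgebra R (Module.Dual R L))) by
    rw [← h]; abel
  induction ψ using exteriorPower_three_induction with
  | add x y hx hy =>
    have h : ∀ z : ⋀[R]^3 (Module.Dual R L), uOp P z = formTensorOp (psiTwoTensor P z) := fun _ => rfl
    rw [h] at hx hy ⊢
    simp only [psiTwoTensor_add, map_add, Submodule.coe_add]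
    linear_combination (norm := noncomm_ring) hx + hy
  | mul α β γ =>
    rw [coe_ιMulti_three, uOp, psiTwoTensor_ιMulti]
    simp only [map_add, map_mul, formTensorOp_tmul, ExteriorAlgebra.map_apply_ι]
    have h1 := eOp_ι_mul_bivector P α
    have h2 := eOp_ι_mul_bivector P β
    have h3 := eOp_ι_mul_bivector P γ
    have g1 := iOp_bivector_mul P (ExteriorAlgebra.ι R (sharp P α))
    have g2 := iOp_bivector_mul P (ExteriorAlgebra.ι R (sharp P β))
    have g3 := iOp_bivector_mul P (ExteriorAlgebra.ι R (sharp P γ))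
    have l1 := iOp_ι_add_mul_swap (R := R) (sharp P α) (sharp P β)
    have l2 := iOp_ι_add_mul_swap (R := R) (sharp P α) (sharp P γ)
    have l3 := iOp_ι_add_mul_swap (R := R) (sharp P β) (sharp P γ)
    set p := iOp (P : ExteriorAlgebra R L)
    set a := eOp (ExteriorAlgebra.ι R α)
    set b := eOp (ExteriorAlgebra.ι R β)
    set c := eOp (ExteriorAlgebra.ι R γ)
    set A := iOp (ExteriorAlgebra.ι R (sharp P α))
    set B := iOp (ExteriorAlgebra.ι R (sharp P β))
    set C := iOp (ExteriorAlgebra.ι R (sharp P γ))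
    linear_combination (norm := noncomm_ring)
      - h1 * (B * C) - a * g2 * C - a * B * g3 - h2 * (C * A) - b * g3 * A - b * C * g1 -
        h3 * (A * B) - c * g1 * B - c * A * g2 - B * l2 + l1 * C - l2 * B + A * l3

end

end AnchoredBracket
end

noncomputable section

set_option linter.unusedSectionVars false

namespace AnchoredBracket

variable {R L : Type*} [CommRing R] [Algebra ℝ R] [AddCommGroup L] [Module R L] [Module ℝ L]
  [IsScalarTower ℝ R L] {n N : ℕ}

/-! ### The twisted operator -/

/-- The square-zero operator `i_P d - d i_P - ∂̲ - i_Y`, which differs from the generators of the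
twisted bracket by an interior product. -/
def thetaOp (D : AnchoredBracket R L) (P : ⋀[R]^2 L) (ψ : ⋀[R]^3 (Module.Dual R L)) : FormOp R L :=
  iOp (P : ExteriorAlgebra R L) * D.dOp - D.dOp * iOp (P : ExteriorAlgebra R L) -
    (uOp P ψ + iOp (ExteriorAlgebra.ι R (sectionY P ψ)))

/-- The consequences of the Maurer–Cartan equation, in an abstract ring. -/
theorem sq_eq_zero_of_commutators {𝓔 : Type*} [Ring 𝓔] [Algebra ℝ 𝓔] {p d e v j : 𝓔}
    (hd : d * d = 0) (he : e * e = 0) (hde : d * e + e * d = 0)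
    (hv : p * (p * e - e * p) - (p * e - e * p) * p = v + v)
    (hj : p * v - v * p = -(3 : ℤ) • j) (hpj : p * j = j * p)
    (hpd : (p * d - d * p) * p - p * (p * d - d * p) = (2 : ℤ) • j) :
    (p * d - d * p - v) * (p * d - d * p - v) = 0 := by
  -- The relations `d2`, `f3`, `g4` arise by applying [p, ·] two, three and four times to d² = 0, de
  -- + ed = 0 and e² = 0. With weights 1/2!, -1/3!, 1/4!, their sum is the lowest component of the
  -- square of exp(p)(d - e)exp(-p); clearing denominators gives the coefficients 12, -4, 1 and the
  -- factor 24.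
  obtain ⟨e', he'⟩ : ∃ e', e' = p * e - e * p := ⟨_, rfl⟩
  obtain ⟨l, hl⟩ : ∃ l, l = p * d - d * p := ⟨_, rfl⟩
  rw [← he'] at hv
  rw [← hl] at hpd ⊢
  have d1 : l * d + d * l = 0 := by
    rw [hl]; linear_combination (norm := noncomm_ring) p * hd - hd * p
  have d2 : (2 : ℤ) • (l * l) = (2 : ℤ) • (j * d + d * j) := by
    linear_combination (norm := noncomm_ring) p * d1 - d1 * p + l * hl + hl * l + hpd * d + d * hpd
  have f1 : l * e + d * e' + e' * d + e * l = 0 := by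
    rw [hl, he']; linear_combination (norm := noncomm_ring) p * hde - hde * p
  have f2 : -(2 : ℤ) • (j * e) + (2 : ℤ) • (l * e') + (d * v + d * v) + (v * d + v * d) +
      (2 : ℤ) • (e' * l) - (2 : ℤ) • (e * j) = 0 := by
    linear_combination (norm := noncomm_ring) p * f1 - f1 * p + hpd * e + l * he' + hl * e' - d * hv
      - hv * d + e' * hl + he' * l + e * hpd
  have f3 : (6 : ℤ) • (l * v + v * l) =
      (6 : ℤ) • (j * e' + e' * j) + (6 : ℤ) • (d * j + j * d) := by
    linear_combination (norm := noncomm_ring) p * f2 - f2 * p + (2 : ℤ) • (hpj * e) -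
      (2 : ℤ) • (j * he') - (2 : ℤ) • (he' * j) + (2 : ℤ) • (e * hpj) + (2 : ℤ) • (hpd * e') -
      (2 : ℤ) • (l * hv) - (2 : ℤ) • (hv * l) + (2 : ℤ) • (e' * hpd) + (2 : ℤ) • (hl * v) +
      (2 : ℤ) • (v * hl) - (2 : ℤ) • (d * hj) - (2 : ℤ) • (hj * d)
  have g1 : e' * e + e * e' = 0 := by
    rw [he']; linear_combination (norm := noncomm_ring) p * he - he * p
  have g2 : (2 : ℤ) • (v * e + e' * e' + e * v) = 0 := by
    linear_combination (norm := noncomm_ring) p * g1 - g1 * p - hv * e + e' * he' + he' * e' - e * hv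
  have g3 : (6 : ℤ) • (v * e' + e' * v) = (6 : ℤ) • (j * e + e * j) := by
    linear_combination (norm := noncomm_ring) p * g2 - g2 * p - (2 : ℤ) • (hj * e) +
      (2 : ℤ) • (v * he') - (2 : ℤ) • (hv * e') - (2 : ℤ) • (e' * hv) + (2 : ℤ) • (he' * v) -
      (2 : ℤ) • (e * hj)
  have g4 : (24 : ℤ) • (v * v) = (24 : ℤ) • (j * e' + e' * j) := by
    linear_combination (norm := noncomm_ring) p * g3 - g3 * p - (6 : ℤ) • (hj * e') -
      (6 : ℤ) • (v * hv) - (6 : ℤ) • (hv * v) - (6 : ℤ) • (e' * hj) + (6 : ℤ) • (hpj * e) -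
      (6 : ℤ) • (j * he') - (6 : ℤ) • (he' * j) + (6 : ℤ) • (e * hpj)
  have h : (24 : ℤ) • ((l - v) * (l - v)) = 0 := by
    linear_combination (norm := noncomm_ring) (12 : ℤ) • d2 - (4 : ℤ) • f3 + g4
  have h' : (24 : ℝ) • ((l - v) * (l - v)) = 0 := by
    rw [← h, ← Int.cast_smul_eq_zsmul ℝ]; norm_num
  exact (smul_eq_zero.mp h').resolve_left (by norm_num)

variable (F : DualFrame (LinearMap.id : Module.Dual R L →ₗ[R] Module.Dual R L) n)
  {D : AnchoredBracket R L} {P : ⋀[R]^2 L} {ψ : ⋀[R]^3 (Module.Dual R L)}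
  {lam : ⋀[R]^N (Module.Dual R L)} {Lam : ExteriorAlgebra R L}

theorem invol_bivector (P : ⋀[R]^2 L) : invol (P : ExteriorAlgebra R L) = P := by
  rw [invol_of_mem P.2]; simp

include F

theorem DualFrame.iOp_gerstenhaber_bivector (hl : IsDualVolume lam Lam) (V : ExteriorAlgebra R L) :
    iOp (D.gerstenhaber (P : ExteriorAlgebra R L) V) =
      (iOp (P : ExteriorAlgebra R L) * D.dOp - D.dOp * iOp (P : ExteriorAlgebra R L)) * iOp V -
      iOp (invol V) *
        (iOp (P : ExteriorAlgebra R L) * D.dOp - D.dOp * iOp (P : ExteriorAlgebra R L)) := by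
  rw [(F.isDerivedGenerator_dA hl).apply_gerstenhaber, derivedBracket_even _ _ (invol_bivector P)]

/-- Closedness of ψ gives de_ψ + e_ψ d = 0, its odd degree gives e_ψ² = 0, and the equation for
[P,P], read through the derived bracket, gives the double commutator of d with i_P. -/
theorem DualFrame.thetaOp_sq (hD : D.IsLie) (hl : IsDualVolume lam Lam)
    (hP : D.IsTwistedPoisson P ψ) : thetaOp D P ψ * thetaOp D P ψ = 0 := by
  refine sq_eq_zero_of_commutators (e := eOp (ψ : ExteriorAlgebra R (Module.Dual R L)))
    (j := iOp (ExteriorAlgebra.map (sharp P) (ψ : ExteriorAlgebra R (Module.Dual R L)))) ?_ ?_ ?_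
    (commutator_commutator_eOp P ψ) (commutator_iOp_map_sharp P ψ) (iOp_bivector_mul P _).symm ?_
  · ext w
    exact F.dA_dA hD w
  · have : invol (ψ : ExteriorAlgebra R (Module.Dual R L)) = -ψ := by
      rw [invol_of_mem ψ.2, show (-1 : R) ^ 3 = -1 by norm_num]; simp
    have h := mul_eq_of_invol_eq_neg this (ψ : ExteriorAlgebra R (Module.Dual R L))
    rw [this, mul_neg, eq_neg_iff_add_eq_zero, ← two_smul ℝ] at h
    rw [← map_mul eOp, (smul_eq_zero.mp h).resolve_left two_ne_zero, map_zero]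
  · have : invol (ψ : ExteriorAlgebra R (Module.Dual R L)) = -ψ := by
      rw [invol_of_mem ψ.2, show (-1 : R) ^ 3 = -1 by norm_num]; simp
    rw [F.dA_mul_eOp, hP.closed, this, map_zero, map_neg]
    noncomm_ring
  · have h := F.iOp_gerstenhaber_bivector (D := D) (P := P) hl P
    have h2 : D.gerstenhaber (P : ExteriorAlgebra R L) (P : ExteriorAlgebra R L) = (2 : ℤ) •
        ExteriorAlgebra.map (sharp P) (ψ : ExteriorAlgebra R (Module.Dual R L)) := by
      rw [← hP.twisted, ← Int.cast_smul_eq_zsmul ℝ, smul_smul]; norm_num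
    rw [invol_bivector, h2, map_zsmul] at h
    exact h.symm

/-- The operator `[e_α, i_P d - d i_P]`. -/
theorem DualFrame.eOp_ι_lOp (α : Module.Dual R L) :
    eOp (ExteriorAlgebra.ι R α) *
        (iOp (P : ExteriorAlgebra R L) * D.dOp - D.dOp * iOp (P : ExteriorAlgebra R L)) +
      (iOp (P : ExteriorAlgebra R L) * D.dOp - D.dOp * iOp (P : ExteriorAlgebra R L)) *
        eOp (ExteriorAlgebra.ι R α) =
    iOp (ExteriorAlgebra.ι R (sharp P α)) * D.dOp + D.dOp * iOp (ExteriorAlgebra.ι R (sharp P α)) +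
      (iOp (P : ExteriorAlgebra R L) * eOp (D.dA (ExteriorAlgebra.ι R α)) -
        eOp (D.dA (ExteriorAlgebra.ι R α)) * iOp (P : ExteriorAlgebra R L)) := by
  have h1 := F.dA_mul_eOp_ι (D := D) α
  have h2 := eOp_ι_mul_bivector P α
  set p := iOp (P : ExteriorAlgebra R L)
  set e := eOp (ExteriorAlgebra.ι R α)
  linear_combination (norm := noncomm_ring) h2 * D.dOp + D.dOp * h2 + p * h1 - h1 * p

/-- The exact part of L_{P^♯β} α cancels against d(P(α, β)), since P is skew. -/
theorem DualFrame.ι_twistedDual_bracket (α β : Module.Dual R L) :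
    ExteriorAlgebra.ι R ((D.twistedDual P ψ).bracket α β) =
      ExteriorAlgebra.ι R (D.lieOneForm (sharp P α) β) -
        ctr LinearMap.id (sharp P β) (D.dA (ExteriorAlgebra.ι R α)) +
        ExteriorAlgebra.ι R (psiTwo P ψ α β) := by
  have h : (D.twistedDual P ψ).bracket α β = D.lieOneForm (sharp P α) β -
      D.lieOneForm (sharp P β) α - D.dFun (β (sharp P α)) + psiTwo P ψ α β := rfl
  have h' : D.dFun (β (sharp P α)) = - D.dFun (α (sharp P β)) := by
    rw [apply_sharp_swap]
    ext X
    simp [dFun]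
  rw [h, h', map_add, map_sub, map_sub, F.ι_lieOneForm D (sharp P β), map_neg]
  abel

/-- In [[e_α, θ], e_β], the term [i_P, d] contributes L_{P^♯α} β - i_{P^♯β} dα and -∂̲ contributes
ψ^(2)(α, β). The term i_Y disappears because [e_α, i_Y] is multiplication by the function α(Y). Only
this identification is at stake here, not θ² = 0. -/
theorem DualFrame.isDerivedGenerator_thetaOp :
    (D.twistedDual P ψ).IsDerivedGenerator eOp (thetaOp D P ψ) where
  injective := eOp_injective
  sections α β := by
    rw [derivedBracket_odd _ _ (invol_ι α), thetaOp, F.ι_twistedDual_bracket]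
    have h1 := F.eOp_ι_lOp (D := D) (P := P) α
    have h2 := F.lie_mul_eOp_ι (D := D) (sharp P α) β
    have h3 := uOp_bracket P ψ α β
    have h4 := iOp_ι_mul_eOp_ι (sectionY P ψ) α
    have h5 := iOp_algebraMap_mul_eOp (α (sectionY P ψ)) (ExteriorAlgebra.ι R β)
    have h6 := eOp_ι_mul_bivector P β
    have h7 := iOp_ι_mul_eOp (sharp P β) (D.dA (ExteriorAlgebra.ι R α))
    have h8 : invol (D.dA (ExteriorAlgebra.ι R α)) = D.dA (ExteriorAlgebra.ι R α) := by
      rw [invol_of_mem ((F.isCartanDifferential_dA D).mem 1 _ (ι_mem α))]; simp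
    have h9 : eOp (D.dA (ExteriorAlgebra.ι R α)) * eOp (ExteriorAlgebra.ι R β) =
        eOp (ExteriorAlgebra.ι R β) * eOp (D.dA (ExteriorAlgebra.ι R α)) := by
      rw [← map_mul, ← mul_eq_of_invol_eq h8, map_mul]
    rw [h8] at h7
    rw [map_add, map_sub]
    set p := iOp (P : ExteriorAlgebra R L)
    set e := eOp (ExteriorAlgebra.ι R α)
    set f := eOp (ExteriorAlgebra.ι R β)
    set y := iOp (ExteriorAlgebra.ι R (sectionY P ψ))
    set w := eOp (D.dA (ExteriorAlgebra.ι R α))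
    set A := iOp (ExteriorAlgebra.ι R (sharp P α))
    set B := iOp (ExteriorAlgebra.ι R (sharp P β))
    linear_combination (norm := noncomm_ring) h1 * f - f * h1 + h2 - h3 - h4 * f + f * h4 - h5 +
      w * h6 - h6 * w - h7 + p * h9 - h9 * p
  anchor α f := by
    rw [derivedBracket_odd _ _ (invol_ι α), thetaOp, eOp_algebraMap, eOp_algebraMap]
    have h1 := F.eOp_ι_lOp (D := D) (P := P) α
    have h2 := F.lie_mul_iOp_algebraMap (D := D) (sharp P α) f
    have h3 := iOp_algebraMap_mul_eOp f (ExteriorAlgebra.ι R α)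
    have h4 := iOp_algebraMap_mul_iOp f (ExteriorAlgebra.ι R (sectionY P ψ))
    have h5 : iOp (algebraMap R _ f) * uOp P ψ = uOp P ψ * iOp (algebraMap R _ f) :=
      iOp_algebraMap_mul f fun w => map_smul (partialUnderline P ψ) f w
    have h6 := iOp_algebraMap_mul_iOp f (P : ExteriorAlgebra R L)
    have h7 := iOp_algebraMap_mul_eOp f (D.dA (ExteriorAlgebra.ι R α))
    change _ = iOp (algebraMap R _ (D.anchor (sharp P α) f))
    set p := iOp (P : ExteriorAlgebra R L)
    set e := eOp (ExteriorAlgebra.ι R α)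
    set m := iOp (algebraMap R (ExteriorAlgebra R L) f)
    set y := iOp (ExteriorAlgebra.ι R (sectionY P ψ))
    set w := eOp (D.dA (ExteriorAlgebra.ι R α))
    set u := uOp P ψ
    linear_combination (norm := noncomm_ring) h1 * m - m * h1 + h2 - h6 * w - p * h7 + h7 * p + w * h6
      + h3 * (u + y) + e * h4 + e * h5 + h4 * e + h5 * e + (u + y) * h3
  functions f g := by
    rw [derivedBracket_even _ _ (AlgHom.commutes _ _), AlgHom.commutes, thetaOp, eOp_algebraMap,
      eOp_algebraMap]
    have h1 := F.dA_mul_iOp_algebraMap (D := D) f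
    have h2 := iOp_algebraMap_mul_iOp f (P : ExteriorAlgebra R L)
    have h3 := iOp_algebraMap_mul_iOp g (P : ExteriorAlgebra R L)
    have h4 := iOp_algebraMap_mul_eOp g (ExteriorAlgebra.ι R (D.dFun f))
    have h5 := iOp_algebraMap_mul_iOp f (ExteriorAlgebra.ι R (sectionY P ψ))
    have h6 : iOp (algebraMap R _ f) * uOp P ψ = uOp P ψ * iOp (algebraMap R _ f) :=
      iOp_algebraMap_mul f fun w => map_smul (partialUnderline P ψ) f w
    set p := iOp (P : ExteriorAlgebra R L)
    set m := iOp (algebraMap R (ExteriorAlgebra R L) f)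
    set m' := iOp (algebraMap R (ExteriorAlgebra R L) g)
    set y := iOp (ExteriorAlgebra.ι R (sectionY P ψ))
    set w := eOp (ExteriorAlgebra.ι R (D.dFun f))
    set u := uOp P ψ
    have k : m * (p * D.dOp - D.dOp * p - (u + y)) - (p * D.dOp - D.dOp * p - (u + y)) * m =
        w * p - p * w := by
      linear_combination (norm := noncomm_ring) h2 * D.dOp - D.dOp * h2 - h5 - h6 - p * h1 + h1 * p
    rw [k]
    linear_combination (norm := noncomm_ring) - h4 * p - w * h3 + h3 * w + p * h4

end AnchoredBracket
end

noncomputable section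

set_option linter.unusedSectionVars false

namespace AnchoredBracket

variable {R L : Type*} [CommRing R] [Algebra ℝ R] [AddCommGroup L] [Module R L] [Module ℝ L]
  [IsScalarTower ℝ R L] {n N : ℕ}
  (F : DualFrame (LinearMap.id : Module.Dual R L →ₗ[R] Module.Dual R L) n)
  {D : AnchoredBracket R L} {P : ⋀[R]^2 L} {ψ : ⋀[R]^3 (Module.Dual R L)}
  {lam : ⋀[R]^N (Module.Dual R L)} {Lam : ExteriorAlgebra R L}

/-! ### The differential of the twisted bracket -/

section Differential

theorem iOp_invol_contract (α : Module.Dual R L) (V : ExteriorAlgebra R L) :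
    iOp (invol (contract α V)) =
      iOp V * eOp (ExteriorAlgebra.ι R α) - eOp (ExteriorAlgebra.ι R α) * iOp (invol V) := by
  have h := iOp_contract α (invol V)
  rw [contract_invol, map_neg, invol_invol] at h
  linear_combination (norm := noncomm_ring) - h

include F

/-- [i_P, d] gives the bracket with P and ∂̲ gives d̲; i_Y graded-commutes with i_V, so its presence
in θ does not matter. -/
theorem DualFrame.iOp_dTwisted (hl : IsDualVolume lam Lam) (V : ExteriorAlgebra R L) :
    iOp (D.dTwisted P ψ V) = thetaOp D P ψ * iOp V - iOp (invol V) * thetaOp D P ψ := by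
  change iOp (D.gerstenhaber (P : ExteriorAlgebra R L) V - dUnderline P ψ V) = _
  rw [map_sub, F.iOp_gerstenhaber_bivector hl, iOp_dUnderline, thetaOp]
  have h := iOp_ι_mul_iOp (sectionY P ψ) V
  linear_combination (norm := noncomm_ring) h

theorem DualFrame.dTwisted_mem (hl : IsDualVolume lam Lam) {q : ℕ} {V : ExteriorAlgebra R L}
    (hV : V ∈ ⋀[R]^q L) : D.dTwisted P ψ V ∈ ⋀[R]^(q + 1) L :=
  Submodule.sub_mem _
    ((F.isDerivedGenerator_dA (D := D) hl).isGerstenhaberExtension.mem 2 q (q + 1) (by omega) _ P.2 _ hV)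
    (dUnderline_mem P ψ hV)

theorem DualFrame.dTwisted_invol (hl : IsDualVolume lam Lam) (V : ExteriorAlgebra R L) :
    D.dTwisted P ψ (invol V) = - invol (D.dTwisted P ψ V) := by
  induction V using exterior_homogeneous_induction with
  | add x y hx hy => rw [map_add, map_add, hx, hy, map_add, map_add, neg_add]
  | mem q w hw =>
    rw [invol_of_mem_real hw, invol_of_mem_real (F.dTwisted_mem hl hw), map_smul, pow_succ]
    simp

theorem DualFrame.iOp_invol_dTwisted (hl : IsDualVolume lam Lam) (V : ExteriorAlgebra R L) :
    iOp (invol (D.dTwisted P ψ V)) =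
      iOp V * thetaOp D P ψ - thetaOp D P ψ * iOp (invol V) := by
  rw [← neg_eq_iff_eq_neg.mpr (F.dTwisted_invol hl V), map_neg, F.iOp_dTwisted hl, invol_invol]
  abel

theorem DualFrame.dTwisted_dTwisted (hD : D.IsLie) (hl : IsDualVolume lam Lam)
    (hP : D.IsTwistedPoisson P ψ) (V : ExteriorAlgebra R L) :
    D.dTwisted P ψ (D.dTwisted P ψ V) = 0 := by
  apply (F.isDerivedGenerator_dA (D := D) hl).injective
  rw [F.iOp_dTwisted hl, F.iOp_dTwisted hl, F.iOp_invol_dTwisted hl, map_zero]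
  have h := F.thetaOp_sq hD hl hP
  linear_combination (norm := noncomm_ring) h * iOp V - iOp V * h

/-- After embedding multivectors by V ↦ i_V, both d_{P,ψ} and the contractions are commutators, with
θ and e_α. The relations then follow from [[e_α, θ], e_β] = e_{[α,β]} by the Jacobi identity for
commutators. -/
theorem DualFrame.isCartanDifferential_dTwisted (hl : IsDualVolume lam Lam) :
    (D.twistedDual P ψ).IsCartanDifferential (Module.Dual.eval R L) (D.dTwisted P ψ) where
  mem q w hw := F.dTwisted_mem hl hw
  functions α f := by
    apply (F.isDerivedGenerator_dA (D := D) hl).injective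
    change iOp (contract α (D.dTwisted P ψ (algebraMap R _ f))) = _
    have h := (F.isDerivedGenerator_thetaOp (D := D) (P := P) (ψ := ψ)).anchor α f
    rw [derivedBracket_odd _ _ (invol_ι α), eOp_algebraMap, eOp_algebraMap] at h
    rw [iOp_contract, F.iOp_dTwisted hl, F.iOp_invol_dTwisted hl, AlgHom.commutes, ← h]
    have h1 := iOp_algebraMap_mul_eOp f (ExteriorAlgebra.ι R α)
    linear_combination (norm := noncomm_ring) h1 * thetaOp D P ψ + thetaOp D P ψ * h1
  cartan α β w := by
    apply (F.isDerivedGenerator_dA (D := D) hl).injective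
    change iOp (contract α (D.dTwisted P ψ (contract β w)) +
      D.dTwisted P ψ (contract α (contract β w)) - contract β (contract α (D.dTwisted P ψ w) +
        D.dTwisted P ψ (contract α w))) = iOp (contract ((D.twistedDual P ψ).bracket α β) w)
    have h := (F.isDerivedGenerator_thetaOp (D := D) (P := P) (ψ := ψ)).sections α β
    rw [derivedBracket_odd _ _ (invol_ι α)] at h
    rw [iOp_contract ((D.twistedDual P ψ).bracket α β), ← h]
    simp only [map_add, map_sub, iOp_contract, iOp_invol_contract, F.iOp_dTwisted hl,
      F.iOp_invol_dTwisted hl]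
    noncomm_ring

end Differential

/-! ### The volume form -/

section Volume

theorem lieDerivative_eq (X : L) (w : ExteriorAlgebra R (Module.Dual R L)) :
    D.lieDerivative X w = ctr LinearMap.id X (D.dA w) + D.dA (ctr LinearMap.id X w) := by
  rw [lieDerivative, interior_ι, interior_ι]

/-- On α ∧ β both sides reduce to α ∧ i_{P^♯β} λ, which is found by contracting α ∧ λ = 0. -/
theorem interior_bivector_mul_mem_two {w : ExteriorAlgebra R (Module.Dual R L)}
    (hl : IsDualVolume lam Lam) (hw : w ∈ ⋀[R]^2 (Module.Dual R L)) :
    w * interior (P : ExteriorAlgebra R L) (lam : ExteriorAlgebra R (Module.Dual R L)) =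
      interior (P : ExteriorAlgebra R L) w * lam := by
  rw [ExteriorAlgebra.exteriorPower, pow_two] at hw
  refine Submodule.mul_induction_on hw ?_ ?_
  · rintro _ ⟨α, rfl⟩ _ ⟨β, rfl⟩
    have h : ctr LinearMap.id (sharp P β) (ExteriorAlgebra.ι R α * (lam : ExteriorAlgebra R _)) = 0 := by
      rw [hl.ι_mul, map_zero]
    rw [ctr_ι_mul] at h
    rw [interior_bivector_ι_mul_ι, mul_assoc, ι_mul_interior_bivector, hl.ι_mul, map_zero, add_zero,
      ← sub_eq_zero.mp h, LinearMap.id_apply, apply_sharp_swap, neg_smul, Algebra.smul_def, neg_mul]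
  · intro x y hx hy
    rw [add_mul, hx, hy, map_add, add_mul]

variable (D P) in
/-- The operator `∂_P`. -/
theorem partialBivector_eq (w : ExteriorAlgebra R (Module.Dual R L)) :
    D.partialBivector P w = (D.dOp * iOp (P : ExteriorAlgebra R L) -
      iOp (P : ExteriorAlgebra R L) * D.dOp) w := rfl

include F

theorem IsDualVolume.dA_lam (hl : IsDualVolume lam Lam) :
    D.dA (lam : ExteriorAlgebra R (Module.Dual R L)) = 0 :=
  hl.top _ ((F.isCartanDifferential_dA D).mem N _ lam.2)

/-- The Leibniz rule applied to α ∧ i_P λ = i_{P^♯α} λ. It shows that the expression defining X is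
linear over functions in α. -/
theorem IsDualVolume.ι_mul_partialBivector (hl : IsDualVolume lam Lam) (α : Module.Dual R L) :
    ExteriorAlgebra.ι R α * D.partialBivector P lam =
      -(D.lieDerivative (sharp P α) lam -
        AnchoredBracket.interior (P : ExteriorAlgebra R L) (D.dA (ExteriorAlgebra.ι R α)) * lam) := by
  have h := F.dA_ι_mul D α (AnchoredBracket.interior (P : ExteriorAlgebra R L) (lam : ExteriorAlgebra R _))
  rw [ι_mul_interior_bivector, hl.ι_mul, map_zero, add_zero, interior_bivector_mul_mem_two hl
    ((F.isCartanDifferential_dA D).mem 1 _ (ι_mem α))] at h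
  rw [partialBivector, lieDerivative_eq, hl.dA_lam F, map_zero, map_zero, sub_zero, zero_add, h]
  abel

theorem IsDualVolume.exists_lieDerivative (hl : IsDualVolume lam Lam) (α : Module.Dual R L) :
    ∃ r : R, D.lieDerivative (sharp P α) lam -
      AnchoredBracket.interior (P : ExteriorAlgebra R L) (D.dA (ExteriorAlgebra.ι R α)) * lam =
        r • (lam : ExteriorAlgebra R (Module.Dual R L)) := by
  apply hl.eq_smul_of_mem F
  refine Submodule.sub_mem _ ?_ ?_
  · rw [lieDerivative_eq, hl.dA_lam F, map_zero, zero_add]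
    cases N with
    | zero => rw [ctr, contract_mem_zero _ lam.2, map_zero]; exact Submodule.zero_mem _
    | succ N => exact (F.isCartanDifferential_dA D).mem N _ (ctr_mem _ lam.2)
  · exact exteriorPower_mul_mem (zero_add N) (interior_mem (p := 2) rfl P.2
      ((F.isCartanDifferential_dA D).mem 1 _ (ι_mem α))) lam.2

theorem IsDualVolume.isSectionX_iff (hl : IsDualVolume lam Lam) (X : L) :
    D.IsSectionX P lam X ↔ ∀ α, (α X) • (lam : ExteriorAlgebra R (Module.Dual R L)) =
      - (ExteriorAlgebra.ι R α * D.partialBivector P lam) := by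
  simp only [hl.ι_mul_partialBivector F, neg_neg]; rfl

/-- The coefficient of λ on the right-hand side, extracted by i_Λ, is a linear functional of α; the
frame turns it into a section. -/
theorem IsDualVolume.existsUnique_sectionX (hl : IsDualVolume lam Lam) :
    ∃! X, D.IsSectionX P lam X := by
  have e : ∀ X, D.IsSectionX P lam X ↔ ∀ α, (α X) • (lam : ExteriorAlgebra R (Module.Dual R L)) =
      - (ExteriorAlgebra.ι R α * D.partialBivector P lam) := hl.isSectionX_iff F
  let κ : Module.Dual R (ExteriorAlgebra R (Module.Dual R L)) :=
    ExteriorAlgebra.algebraMapInv.toLinearMap ∘ₗ AnchoredBracket.interior Lam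
  have hκ : ∀ r : R, κ (r • (lam : ExteriorAlgebra R (Module.Dual R L))) = r := fun r => by
    simp [κ, hl.interior]
  let θ : Module.Dual R (Module.Dual R L) :=
    - (κ ∘ₗ LinearMap.mulRight R (D.partialBivector P lam) ∘ₗ ExteriorAlgebra.ι R)
  have hθ : ∀ α, θ α = κ (- (ExteriorAlgebra.ι R α * D.partialBivector P lam)) := fun α => by
    rw [map_neg]; rfl
  refine ⟨∑ i, θ (F.ξ i) • F.x i, (e _).mpr fun α => ?_, fun X hX => ?_⟩
  · have : α (∑ i, θ (F.ξ i) • F.x i) = θ α := by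
      conv_rhs => rw [← F.sum_ξ α]
      simp [mul_comm]
    rw [this, hθ, hl.ι_mul_partialBivector F, neg_neg]
    obtain ⟨r, hr⟩ := hl.exists_lieDerivative F (D := D) (P := P) α
    rw [hr, hκ]
  · rw [← F.sum_x X]
    refine Finset.sum_congr rfl fun i _ => ?_
    rw [hθ, ← (e X).mp hX (F.ξ i), hκ]; rfl

/-- The exterior products with every 1-form vanish for the sum `z` of ∂_P λ and i_X λ, so `z` is a
multiple of λ. Its parity is opposite to that of λ, hence it is zero; using parity spares a case
distinction on N = 0. -/
theorem IsDualVolume.partialBivector_lam (hl : IsDualVolume lam Lam) {X : L}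
    (hX : D.IsSectionX P lam X) :
    D.partialBivector P lam = - ctr LinearMap.id X (lam : ExteriorAlgebra R (Module.Dual R L)) := by
  rw [← add_eq_zero_iff_eq_neg]
  set z := D.partialBivector P lam + ctr LinearMap.id X (lam : ExteriorAlgebra R (Module.Dual R L))
    with hz
  have h0 : ∀ α, ExteriorAlgebra.ι R α * z = 0 := fun α => by
    have h := ctr_ι_mul (ev := (LinearMap.id : Module.Dual R L →ₗ[R] _)) X α
      (lam : ExteriorAlgebra R (Module.Dual R L))
    rw [hl.ι_mul, map_zero, eq_comm, sub_eq_zero] at h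
    rw [mul_add, ← h, LinearMap.id_apply, (hl.isSectionX_iff F X).mp hX, add_neg_cancel]
  obtain ⟨r, hr⟩ := hl.eq_smul_of_forall_ι_mul F h0
  have h1 : invol z = - ((-1 : ℝ) ^ N • z) := by
    have hP : invol (D.partialBivector P lam) = - D.partialBivector P (invol lam) := by
      rw [partialBivector, partialBivector, map_sub, ← neg_eq_iff_eq_neg.mpr (F.dA_invol D _),
        ← interior_invol, invol_bivector, F.dA_invol, ← interior_invol, invol_bivector, map_neg]
      abel
    have hX' := contract_invol ((LinearMap.id : Module.Dual R L →ₗ[R] _).flip X)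
      (lam : ExteriorAlgebra R (Module.Dual R L))
    rw [eq_neg_iff_add_eq_zero, add_comm, ← eq_neg_iff_add_eq_zero] at hX'
    have hsm : D.partialBivector P ((-1 : ℝ) ^ N • (lam : ExteriorAlgebra R (Module.Dual R L))) =
        (-1 : ℝ) ^ N • D.partialBivector P lam := by
      rw [partialBivector_eq, partialBivector_eq, map_smul]
    rw [hz, map_add, hP, ctr, hX', invol_of_mem_real lam.2, hsm, ← algebraMap_smul R ((-1 : ℝ) ^ N)
      (lam : ExteriorAlgebra R (Module.Dual R L)), map_smul, algebraMap_smul, smul_add, neg_add]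
  have h2 : invol z = (-1 : ℝ) ^ N • z := by
    rw [hr, map_smul, invol_of_mem_real lam.2, smul_comm]
  rw [h2, eq_neg_iff_add_eq_zero, ← two_smul ℝ, smul_smul] at h1
  exact (smul_eq_zero.mp h1).resolve_left (mul_ne_zero two_ne_zero (pow_ne_zero _ (by norm_num)))

end Volume

end AnchoredBracket
end

noncomputable section

set_option linter.unusedSectionVars false

namespace AnchoredBracket

variable {R L : Type*} [CommRing R] [Algebra ℝ R] [AddCommGroup L] [Module R L] [Module ℝ L]
  [IsScalarTower ℝ R L] {n N : ℕ}
  {D : AnchoredBracket R L} {P : ⋀[R]^2 L} {ψ : ⋀[R]^3 (Module.Dual R L)}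
  {lam : ⋀[R]^N (Module.Dual R L)} {Lam : ExteriorAlgebra R L}

/-! ### The generator of the twisted bracket -/

/-- Since ξ ∧ λ = 0, e_ξ i_X i_Y λ = ξ(X) i_Y λ - ξ(Y) i_X λ. Over the three terms of ψ^(2) each
coefficient occurs twice, hence -2 i_Y. -/
theorem IsDualVolume.uOp_lam (hl : IsDualVolume lam Lam) :
    uOp P ψ (lam : ExteriorAlgebra R (Module.Dual R L)) =
      -(ctr LinearMap.id (sectionY P ψ) (lam : ExteriorAlgebra R (Module.Dual R L)) +
        ctr LinearMap.id (sectionY P ψ) (lam : ExteriorAlgebra R (Module.Dual R L))) := by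
  have hadd : ∀ X Y : L, ctr (LinearMap.id : Module.Dual R L →ₗ[R] _) (X + Y) =
      ctr LinearMap.id X + ctr LinearMap.id Y := fun X Y => by
    rw [ctr, map_add, contract_add]; rfl
  have hsub : ∀ X Y : L, ctr (LinearMap.id : Module.Dual R L →ₗ[R] _) (X - Y) =
      ctr LinearMap.id X - ctr LinearMap.id Y := fun X Y => by
    rw [eq_sub_iff_add_eq, ← hadd, sub_add_cancel]
  have hsmul : ∀ (r : R) (X : L), ctr (LinearMap.id : Module.Dual R L →ₗ[R] _) (r • X) =
      r • ctr LinearMap.id X := fun r X => by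
    rw [ctr, map_smul, contract_smul]; rfl
  induction ψ using exteriorPower_three_induction with
  | add x y hx hy =>
    have h : ∀ z : ⋀[R]^3 (Module.Dual R L), uOp P z = formTensorOp (psiTwoTensor P z) := fun _ => rfl
    rw [h] at hx hy ⊢
    rw [psiTwoTensor_add, sectionY_add, map_add, FormOp.add_apply, hx, hy, hadd, LinearMap.add_apply]
    abel
  | mul α β γ =>
    have key : ∀ (ξ : Module.Dual R L) (X Y : L),
        (eOp (ExteriorAlgebra.ι R ξ) * iOp (ExteriorAlgebra.ι R X * ExteriorAlgebra.ι R Y))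
          (lam : ExteriorAlgebra R (Module.Dual R L)) =
        ξ X • ctr LinearMap.id Y (lam : ExteriorAlgebra R (Module.Dual R L)) -
          ξ Y • ctr LinearMap.id X (lam : ExteriorAlgebra R (Module.Dual R L)) := by
      intro ξ X Y
      rw [FormOp.mul_apply, eOp_apply, iOp_apply, ι_mul_interior, hl.ι_mul, map_zero, add_zero,
        contract_ι_mul, contract_ι, map_sub, map_smul, ← Algebra.commutes, ← Algebra.smul_def,
        map_smul, LinearMap.sub_apply, LinearMap.smul_apply, LinearMap.smul_apply, interior_ι,
        interior_ι]
    rw [uOp, psiTwoTensor_ιMulti, sectionY_ιMulti]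
    simp only [map_add, formTensorOp_tmul, FormOp.add_apply, key, hadd, hsub, hsmul,
      LinearMap.add_apply, LinearMap.sub_apply, LinearMap.smul_apply]
    rw [apply_sharp_swap P γ α, apply_sharp_swap P β α, apply_sharp_swap P γ β]
    module

theorem uOp_one : uOp P ψ (1 : ExteriorAlgebra R (Module.Dual R L)) = 0 := by
  rw [uOp]
  refine psiTwoTensor_induction P (p := fun t => formTensorOp t
    (1 : ExteriorAlgebra R (Module.Dual R L)) = 0) ?_ ?_ ψ
  · intro x y hx hy
    rw [map_add, FormOp.add_apply, hx, hy, add_zero]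
  · intro ξ X Y
    rw [formTensorOp_tmul, FormOp.mul_apply, eOp_apply, iOp_apply, interior_one_apply]
    simp [ExteriorAlgebra.algebraMapInv]

variable (F : DualFrame (LinearMap.id : Module.Dual R L →ₗ[R] Module.Dual R L) n)

include F

theorem DualFrame.thetaOp_one :
    thetaOp D P ψ (1 : ExteriorAlgebra R (Module.Dual R L)) = 0 := by
  have h1 : interior (P : ExteriorAlgebra R L) (1 : ExteriorAlgebra R (Module.Dual R L)) = 0 :=
    interior_eq_zero_of_lt two_pos P.2 (by rw [← map_one (algebraMap R _)]; exact algebraMap_mem 1)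
  rw [thetaOp, FormOp.sub_apply, FormOp.sub_apply, FormOp.add_apply, FormOp.mul_apply,
    FormOp.mul_apply, iOp_apply, iOp_apply, iOp_apply, dOp_apply, dOp_apply, h1, F.dA_one, map_zero,
    map_zero, uOp_one, interior_ι, ctr, contract_one]
  simp

theorem DualFrame.thetaOp_invol (w : ExteriorAlgebra R (Module.Dual R L)) :
    thetaOp D P ψ (invol w) = - invol (thetaOp D P ψ w) := by
  have hi : ∀ w : ExteriorAlgebra R (Module.Dual R L),
      interior (P : ExteriorAlgebra R L) (invol w) = invol (interior (P : ExteriorAlgebra R L) w) :=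
    fun w => by rw [← interior_invol, invol_bivector]
  simp only [thetaOp, FormOp.sub_apply, FormOp.add_apply, FormOp.mul_apply, iOp_apply, dOp_apply,
    interior_ι, F.dA_invol, hi, invol_uOp, ctr, contract_invol, map_neg, map_sub, map_add]
  abel

variable {F}

/-- The terms are i_X λ from -∂_P, 2 i_Y λ from -∂̲, and -i_Y λ. -/
theorem IsDualVolume.thetaOp_lam (hl : IsDualVolume lam Lam) {X : L} (hX : D.IsSectionX P lam X) :
    thetaOp D P ψ (lam : ExteriorAlgebra R (Module.Dual R L)) =
      AnchoredBracket.interior (ExteriorAlgebra.ι R (X + sectionY P ψ))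
        (lam : ExteriorAlgebra R (Module.Dual R L)) := by
  have h : thetaOp D P ψ (lam : ExteriorAlgebra R (Module.Dual R L)) =
      - D.partialBivector P lam - (uOp P ψ lam + AnchoredBracket.interior
        (ExteriorAlgebra.ι R (sectionY P ψ)) (lam : ExteriorAlgebra R (Module.Dual R L))) := by
    rw [partialBivector, neg_sub]; rfl
  rw [h, hl.partialBivector_lam F hX, hl.uOp_lam, map_add, map_add, LinearMap.add_apply, interior_ι,
    interior_ι]
  abel

theorem IsDualVolume.partialVolume_star (hl : IsDualVolume lam Lam) (V : ExteriorAlgebra R L) :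
    D.partialVolume P ψ lam (star lam V) = - star lam (D.dTwisted P ψ V) := by
  rw [partialVolume, Function.leftInverse_invFun (hl.star_injective F)]

/-- Apply i_{d_{P,ψ} V} = [θ, i_V] to λ: θλ = i_Z λ, and i_Z moves past i_V at the cost of the
grading involution. -/
theorem IsDualVolume.partialVolume_eq (hl : IsDualVolume lam Lam) {X : L}
    (hX : D.IsSectionX P lam X) (w : ExteriorAlgebra R (Module.Dual R L)) :
    D.partialVolume P ψ lam w = - thetaOp D P ψ w +
      AnchoredBracket.interior (ExteriorAlgebra.ι R (X + sectionY P ψ)) w := by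
  obtain ⟨V, rfl⟩ := hl.star_surjective w
  have h := DFunLike.congr_fun (F.iOp_dTwisted (D := D) (P := P) (ψ := ψ) hl V)
    (lam : ExteriorAlgebra R (Module.Dual R L))
  have h2 := DFunLike.congr_fun (iOp_ι_mul_iOp (X + sectionY P ψ) V)
    (lam : ExteriorAlgebra R (Module.Dual R L))
  rw [FormOp.sub_apply, FormOp.mul_apply, FormOp.mul_apply, hl.thetaOp_lam (F := F) hX] at h
  rw [FormOp.mul_apply, FormOp.mul_apply] at h2
  rw [hl.partialVolume_star (F := F)]
  change - iOp (D.dTwisted P ψ V) _ = - thetaOp D P ψ (iOp V _) +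
    iOp (ExteriorAlgebra.ι R (X + sectionY P ψ)) (iOp V _)
  rw [h, h2, neg_sub, sub_eq_neg_add]; rfl

theorem IsDualVolume.partialVolume_sub (hl : IsDualVolume lam Lam) {X : L}
    (hX : D.IsSectionX P lam X) (w : ExteriorAlgebra R (Module.Dual R L)) :
    D.partialVolume P ψ lam w - (D.partialBivector P w + partialUnderline P ψ w +
      AnchoredBracket.interior (ExteriorAlgebra.ι _ (sectionY P ψ)) w) =
      AnchoredBracket.interior (ExteriorAlgebra.ι _ (X + sectionY P ψ)) w := by
  have h : thetaOp D P ψ w = - D.partialBivector P w - (partialUnderline P ψ w +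
      AnchoredBracket.interior (ExteriorAlgebra.ι R (sectionY P ψ)) w) := by
    rw [partialBivector, neg_sub]; rfl
  rw [hl.partialVolume_eq (F := F) hX, h]
  abel

/-- The operator e_{[a,b]} is evaluated at 1. As θ(1) = 0, the double commutator collapses to the
failure of θ to be a derivation. -/
theorem DualFrame.gerstenhaber_eq_thetaOp {p : ℕ} {a : ExteriorAlgebra R (Module.Dual R L)}
    (ha : a ∈ ⋀[R]^p (Module.Dual R L)) (b : ExteriorAlgebra R (Module.Dual R L)) :
    (D.twistedDual P ψ).gerstenhaber a b = (-1 : ℝ) ^ p • (thetaOp D P ψ a * b +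
      (-1 : ℝ) ^ p • (a * thetaOp D P ψ b) - thetaOp D P ψ (a * b)) := by
  have h := DFunLike.congr_fun ((F.isDerivedGenerator_thetaOp (D := D) (P := P)
    (ψ := ψ)).apply_gerstenhaber a b) 1
  rw [eOp_apply, mul_one] at h
  have ia := invol_of_mem_real ha
  have hθ := F.thetaOp_invol (D := D) (P := P) (ψ := ψ) a
  rcases neg_one_pow_cases p with hp | hp <;> rw [hp] at ia ⊢
  · rw [one_smul] at ia
    rw [ia, eq_comm, neg_eq_iff_eq_neg] at hθ
    have hc := mul_eq_of_invol_eq_neg hθ (invol b)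
    rw [invol_invol] at hc
    rw [derivedBracket_even _ _ ia] at h
    simp only [FormOp.sub_apply, FormOp.mul_apply, eOp_apply, mul_one, F.thetaOp_one, mul_zero,
      zero_sub, mul_neg, hc] at h
    rw [h, one_smul, one_smul]; abel
  · rw [neg_one_smul] at ia
    rw [ia, map_neg, neg_inj] at hθ
    have hc := mul_eq_of_invol_eq hθ.symm b
    rw [derivedBracket_odd _ _ ia] at h
    simp only [FormOp.sub_apply, FormOp.add_apply, FormOp.mul_apply, eOp_apply, mul_one,
      F.thetaOp_one, mul_zero, zero_add, hc] at h
    rw [h, neg_one_smul, neg_one_smul]; abel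

/-- The generator is -θ + i_Z: -θ generates the bracket and i_Z is an odd derivation, which
contributes nothing. Conjugation by *_λ carries d_{P,ψ}² = 0 over. -/
theorem IsDualVolume.isSquareZeroGenerator (hD : D.IsLie) (hl : IsDualVolume lam Lam)
    (hP : D.IsTwistedPoisson P ψ) :
    IsSquareZeroGenerator (D.twistedDual P ψ).gerstenhaber (D.partialVolume P ψ lam) := by
  obtain ⟨X, hX, -⟩ := hl.existsUnique_sectionX F (D := D) (P := P)
  have hu := hl.partialVolume_eq (F := F) (ψ := ψ) hX
  refine ⟨⟨fun x y => ?_, fun c x => ?_⟩, fun p a ha b => ?_, fun a => ?_⟩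
  · rw [hu, hu, hu, map_add, map_add]; abel
  · rw [hu, hu, map_smul, ← algebraMap_smul R c x, map_smul, algebraMap_smul, smul_add, smul_neg]
  · rw [F.gerstenhaber_eq_thetaOp ha, hu, hu, hu, interior_ι, interior_ι, interior_ι, ctr_mul,
      invol_of_mem_real ha]
    congr 1
    simp only [add_mul, mul_add, neg_mul, mul_neg, smul_add, smul_neg, smul_mul_assoc]
    abel
  · obtain ⟨V, rfl⟩ := hl.star_surjective a
    have hlin : ∀ x, D.partialVolume P ψ lam (-x) = - D.partialVolume P ψ lam x := fun x => by
      rw [hu, hu, map_neg, map_neg, neg_add]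
    rw [hl.partialVolume_star (F := F), hlin, hl.partialVolume_star (F := F),
      F.dTwisted_dTwisted hD hl hP, map_zero, neg_zero, neg_zero]

end AnchoredBracket
end

noncomputable section

set_option linter.unusedSectionVars false

namespace AnchoredBracket

/-! ### From vector bundles to algebra: fibrewise values and separating 1-forms -/

section Geometry

variable {E : Type*} [NormedAddCommGroup E] [NormedSpace ℝ E] [FiniteDimensional ℝ E]
  {H : Type*} [TopologicalSpace H] {I : ModelWithCorners ℝ E H}
  {M : Type*} [TopologicalSpace M] [ChartedSpace H M] [IsManifold I ∞ M] [T2Space M]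
  {F : Type*} [NormedAddCommGroup F] [NormedSpace ℝ F] [FiniteDimensional ℝ F]
  {A : M → Type*} [TopologicalSpace (TotalSpace F A)] [∀ x, TopologicalSpace (A x)]
  [∀ x, AddCommGroup (A x)] [∀ x, Module ℝ (A x)] [FiberBundle F A] [VectorBundle ℝ F A]
  [ContMDiffVectorBundle ∞ F A I]

/-! ### Sections and their values at a point -/

/-- The value of a section at a point. -/
def sectionAt (x : M) : Cₛ^∞⟮I; F, A⟯ →ₗ[ℝ] A x where
  toFun X := X x
  map_add' _ _ := rfl
  map_smul' _ _ := rfl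

theorem section_sum_apply {ι : Type*} (s : Finset ι) (X : ι → Cₛ^∞⟮I; F, A⟯) (x : M) :
    (∑ i ∈ s, X i) x = ∑ i ∈ s, X i x := map_sum (sectionAt x) _ _

theorem function_sum_apply {ι : Type*} (s : Finset ι) (f : ι → C^∞⟮I, M; 𝓘(ℝ, ℝ), ℝ⟯) (x : M) :
    (∑ i ∈ s, f i) x = ∑ i ∈ s, f i x :=
  map_sum (ContMDiffMap.evalRingHom x : C^∞⟮I, M; 𝓘(ℝ, ℝ), ℝ⟯ →+* ℝ) _ _

/-- Near a point, sections are combinations of finitely many global sections. -/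
theorem exists_local_sections (x : M) :
    ∃ (b : C^∞⟮I, M; 𝓘(ℝ, ℝ), ℝ⟯) (s : Fin (Module.finrank ℝ F) → Cₛ^∞⟮I; F, A⟯), b x = 1 ∧
      (∀ v : A x, ∃ a : Fin (Module.finrank ℝ F) → ℝ, ∑ k, a k • s k x = v) ∧
      ∀ X : Cₛ^∞⟮I; F, A⟯, ∃ c : Fin (Module.finrank ℝ F) → C^∞⟮I, M; 𝓘(ℝ, ℝ), ℝ⟯,
        (X x = 0 → ∀ k, c k x = 0) ∧ (b * b) • X = ∑ k, c k • s k := by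
  have h1 : ContMDiffVectorBundle 1 F A I := ContMDiffVectorBundle.of_le (n := ∞) (by simp)
  let e := trivializationAt F A x
  let B := Module.finBasis ℝ F
  have hx : x ∈ e.baseSet := FiberBundle.mem_baseSet_trivializationAt' x
  obtain ⟨f, -, hf⟩ := (SmoothBumpFunction.nhds_basis_tsupport (I := I) x).mem_iff.mp
    (e.open_baseSet.mem_nhds hx)
  let b : C^∞⟮I, M; 𝓘(ℝ, ℝ), ℝ⟯ := ⟨f, f.contMDiff⟩
  let s : Fin (Module.finrank ℝ F) → Cₛ^∞⟮I; F, A⟯ := fun k =>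
    ⟨(f : M → ℝ) • e.localFrame B k, ContMDiffOn.smul_section_of_tsupport f.contMDiff.contMDiffOn
      e.open_baseSet hf (e.contMDiffOn_localFrame_baseSet ∞ B k)⟩
  have hs : ∀ k y, s k y = f y • e.localFrame B k y := fun _ _ => rfl
  refine ⟨b, s, f.eq_one, fun v => ⟨fun k => e.localFrameCoeff I B k x v, ?_⟩, fun X => ?_⟩
  · have hk : ∀ k, s k x = e.localFrame B k x := fun k => by rw [hs, f.eq_one, one_smul]
    simp only [hk]
    classical
    have := (e.isLocalFrameOn_localFrame_baseSet I 1 B).coeff_sum_eq (Function.update 0 x v) hx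
    rw [Function.update_self] at this
    exact this.symm
  -- The bump function is used twice, once to extend the frame and once to extend the coefficients,
  -- whence the square in front of X.
  · let c : Fin (Module.finrank ℝ F) → C^∞⟮I, M; 𝓘(ℝ, ℝ), ℝ⟯ := fun k =>
      ⟨fun y => f y * e.localFrameCoeff I B k y (X y), contMDiff_of_tsupport fun y hy => by
        have hy' : y ∈ e.baseSet := hf (closure_mono (Function.support_mul_subset_left _ _) hy)
        exact f.contMDiffAt.mul (contMDiffAt_localFrameCoeff B hy' X.contMDiff.contMDiffAt k)⟩
    refine ⟨c, fun h k => ?_, ?_⟩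
    · change f x * e.localFrameCoeff I B k x (X x) = 0
      rw [h, map_zero, mul_zero]
    · ext y
      rw [section_sum_apply]
      change (f y * f y) • X y =
        ∑ k, (f y * e.localFrameCoeff I B k y (X y)) • (f y • e.localFrame B k y)
      by_cases hy : y ∈ e.baseSet
      · conv_lhs => rw [Trivialization.eq_sum_localFrameCoeff_smul (I := I) (b := B) (s := X) hy]
        rw [Finset.smul_sum]
        refine Finset.sum_congr rfl fun k _ => ?_
        rw [smul_smul, smul_smul]; congr 1; ring
      · have : f y = 0 := by
          by_contra h
          exact hy (hf (subset_tsupport _ h))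
        simp [this]

/-- The value of a `1`-form on a section depends on the value of the section only. -/
theorem dual_apply_eq_zero (α : Module.Dual C^∞⟮I, M; 𝓘(ℝ, ℝ), ℝ⟯ Cₛ^∞⟮I; F, A⟯)
    {X : Cₛ^∞⟮I; F, A⟯} {x : M} (hX : X x = 0) : α X x = 0 := by
  obtain ⟨b, s, hb, -, h⟩ := exists_local_sections (I := I) (F := F) (A := A) x
  obtain ⟨c, hc, e⟩ := h X
  have := congrArg (fun f => f x) (congrArg α e)
  rw [map_smul, map_sum] at this
  simp only [map_smul, smul_eq_mul] at this
  change b x * b x * α X x = _ at this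
  rw [hb, one_mul, one_mul] at this
  rw [this, function_sum_apply]
  exact Finset.sum_eq_zero fun k _ => by
    change c k x * _ = 0
    rw [hc hX, zero_mul]

theorem exists_section_apply_eq (x : M) (v : A x) : ∃ X : Cₛ^∞⟮I; F, A⟯, X x = v := by
  obtain ⟨b, s, -, h, -⟩ := exists_local_sections (I := I) (F := F) (A := A) x
  obtain ⟨a, ha⟩ := h v
  refine ⟨∑ k, a k • s k, ?_⟩
  rw [← ha, section_sum_apply]
  rfl

theorem sectionAt_surjective (x : M) :
    Function.Surjective (sectionAt (I := I) (F := F) (A := A) x) := exists_section_apply_eq x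

/-- The value of a `1`-form at a point. -/
def dualAt (α : Module.Dual C^∞⟮I, M; 𝓘(ℝ, ℝ), ℝ⟯ Cₛ^∞⟮I; F, A⟯) (x : M) : Module.Dual ℝ (A x) :=
  (LinearMap.ker (sectionAt (I := I) (F := F) (A := A) x)).liftQ
    { toFun := fun X => α X x
      map_add' := fun X Y => by rw [map_add]; rfl
      map_smul' := fun c X => by
        rw [← algebraMap_smul C^∞⟮I, M; 𝓘(ℝ, ℝ), ℝ⟯ c X, map_smul]; rfl }
    (fun X hX => dual_apply_eq_zero α hX) ∘ₗ
  ((sectionAt (I := I) (F := F) (A := A) x).quotKerEquivOfSurjective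
    (sectionAt_surjective x)).symm.toLinearMap

theorem dualAt_apply (α : Module.Dual C^∞⟮I, M; 𝓘(ℝ, ℝ), ℝ⟯ Cₛ^∞⟮I; F, A⟯) (X : Cₛ^∞⟮I; F, A⟯)
    (x : M) : dualAt α x (X x) = α X x := by
  have : ((sectionAt (I := I) (F := F) (A := A) x).quotKerEquivOfSurjective
      (sectionAt_surjective x)).symm (X x) = Submodule.Quotient.mk X := by
    rw [LinearEquiv.symm_apply_eq]; rfl
  rw [dualAt, LinearMap.comp_apply, LinearEquiv.coe_coe, this]; rfl

/-- The value of an alternating form on sections, one of which is at a point a combination of the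
others. -/
theorem alternating_update_apply {q : ℕ}
    (f : Cₛ^∞⟮I; F, A⟯ [⋀^Fin q]→ₗ[C^∞⟮I, M; 𝓘(ℝ, ℝ), ℝ⟯] C^∞⟮I, M; 𝓘(ℝ, ℝ), ℝ⟯) {x : M}
    (Y : Fin q → Cₛ^∞⟮I; F, A⟯) (c : Fin q → ℝ) {Z : Cₛ^∞⟮I; F, A⟯}
    (hZ : Z x = ∑ i, c i • Y i x) (j : Fin q) :
    f (Function.update Y j Z) x = c j * f Y x := by
  let l := f.toMultilinearMap.toLinearMap Y j
  have hl : ∀ Z, f (Function.update Y j Z) = l Z := fun _ => rfl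
  rw [hl, ← dualAt_apply, hZ, map_sum, Finset.sum_eq_single j]
  · rw [map_smul, dualAt_apply, ← hl, Function.update_eq_self]; rfl
  · intro i _ hi
    rw [map_smul, dualAt_apply, ← hl, f.map_update_self _ (Ne.symm hi)]
    exact mul_zero _
  · intro h; exact absurd (Finset.mem_univ j) h

/-- The identification of a fibre with the model fibre in a local trivialization. -/
def fiberEquiv (x : M) : A x ≃ₗ[ℝ] F :=
  (trivializationAt F A x).linearEquivAt ℝ x (FiberBundle.mem_baseSet_trivializationAt' x)

/-- An alternating form in more variables than the rank vanishes. -/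
theorem alternating_eq_zero_of_lt {q : ℕ} (hq : Module.finrank ℝ F < q)
    (f : Cₛ^∞⟮I; F, A⟯ [⋀^Fin q]→ₗ[C^∞⟮I, M; 𝓘(ℝ, ℝ), ℝ⟯] C^∞⟮I, M; 𝓘(ℝ, ℝ), ℝ⟯)
    (Y : Fin q → Cₛ^∞⟮I; F, A⟯) : f Y = 0 := by
  ext x
  have := (fiberEquiv (F := F) (A := A) x).symm.finiteDimensional
  have hd : ¬ LinearIndependent ℝ fun i => Y i x := fun h => by
    have := h.fintype_card_le_finrank
    rw [Fintype.card_fin, (fiberEquiv (F := F) x).finrank_eq] at this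
    omega
  rw [Fintype.not_linearIndependent_iff] at hd
  obtain ⟨c, hc, j, hj⟩ := hd
  have h := alternating_update_apply f Y c (Z := 0) (x := x) hc.symm j
  rw [f.map_update_zero] at h
  exact (mul_eq_zero.mp h.symm).resolve_left hj

section VolumeForm

variable {lam : ⋀[C^∞⟮I, M; 𝓘(ℝ, ℝ), ℝ⟯]^(Module.finrank ℝ F)
      (Module.Dual C^∞⟮I, M; 𝓘(ℝ, ℝ), ℝ⟯ Cₛ^∞⟮I; F, A⟯)}

/-- The values of a form, as an alternating map. -/
def evalAlternating {R L : Type*} [CommRing R] [AddCommGroup L] [Module R L] {q : ℕ}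
    (w : ⋀[R]^q (Module.Dual R L)) : L [⋀^Fin q]→ₗ[R] R :=
  (exteriorPower.pairingDual R L q w).compAlternatingMap (exteriorPower.ιMulti R q)

theorem evalAlternating_apply {R L : Type*} [CommRing R] [AddCommGroup L] [Module R L] {q : ℕ}
    (w : ⋀[R]^q (Module.Dual R L)) (X : Fin q → L) : evalAlternating w X = eval w X :=
  (eval_eq w X).symm

theorem linearIndependent_of_eval_ne_zero {Y : Fin (Module.finrank ℝ F) → Cₛ^∞⟮I; F, A⟯} {x : M}
    (h : eval lam Y x ≠ 0) : LinearIndependent ℝ fun i => Y i x := by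
  rw [Fintype.linearIndependent_iff]
  intro c hc j
  have h' := alternating_update_apply (evalAlternating lam) Y c (Z := 0) (x := x) hc.symm j
  rw [AlternatingMap.map_update_zero, evalAlternating_apply] at h'
  exact (mul_eq_zero.mp h'.symm).resolve_right h

theorem exists_combination {Y : Fin (Module.finrank ℝ F) → Cₛ^∞⟮I; F, A⟯} {x : M}
    (h : LinearIndependent ℝ fun i => Y i x) (v : A x) : ∃ c : _ → ℝ, v = ∑ i, c i • Y i x := by
  have := (fiberEquiv (F := F) (A := A) x).symm.finiteDimensional
  have hs := h.span_eq_top_of_card_eq_finrank' (by rw [Fintype.card_fin, (fiberEquiv (F := F) x).finrank_eq])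
  have hv : v ∈ Submodule.span ℝ (Set.range fun i => Y i x) := hs ▸ Submodule.mem_top
  obtain ⟨c, hc⟩ := (Submodule.mem_span_range_iff_exists_fun ℝ).mp hv
  exact ⟨c, hc.symm⟩

/-- A volume form provides finitely many `1`-forms which separate the points of the fibres. -/
theorem exists_separating (hlam : IsVolumeForm lam) :
    ∃ (n : ℕ) (α : Fin n → Module.Dual C^∞⟮I, M; 𝓘(ℝ, ℝ), ℝ⟯ Cₛ^∞⟮I; F, A⟯),
      ∀ (Z : Cₛ^∞⟮I; F, A⟯) (x : M), (∀ k, α k Z x = 0) → Z x = 0 := by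
  -- As an element of an algebraic exterior power, λ is a finite sum of products of 1-forms; their
  -- factors are the required family.
  have h : lam ∈ Submodule.span C^∞⟮I, M; 𝓘(ℝ, ℝ), ℝ⟯ (Set.range (exteriorPower.ιMulti
      C^∞⟮I, M; 𝓘(ℝ, ℝ), ℝ⟯ (Module.finrank ℝ F)
        (M := Module.Dual C^∞⟮I, M; 𝓘(ℝ, ℝ), ℝ⟯ Cₛ^∞⟮I; F, A⟯))) := by
    rw [exteriorPower.ιMulti_span]; trivial
  rw [Submodule.mem_span_set'] at h
  obtain ⟨m, f, g, hm⟩ := h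
  choose v hv using fun i => (g i).2
  let e := Fintype.equivFin (Fin m × Fin (Module.finrank ℝ F))
  refine ⟨_, fun k => v (e.symm k).1 (e.symm k).2, fun Z x hZ => ?_⟩
  have hZ' : ∀ i j, v i j Z x = 0 := fun i j => by simpa using hZ (e (i, j))
  obtain ⟨Y, hY⟩ := hlam x
  obtain ⟨c, hc⟩ := exists_combination (linearIndependent_of_eval_ne_zero hY) (Z x)
  -- If all the factors vanish on Z at x, replacing a basis vector by Z makes a row of every
  -- determinant vanish. By Cramer's rule the coordinates of Z(x) in the basis Y(x) are then zero.
  have hzero : ∀ j, evalAlternating lam (Function.update Y j Z) x = 0 := by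
    intro j
    rw [evalAlternating_apply, eval, ← hm, formValue_eq_formEval, Submodule.coe_sum, map_sum,
      Finset.sum_apply, function_sum_apply]
    refine Finset.sum_eq_zero fun i _ => ?_
    rw [← hv, Submodule.coe_smul, map_smul, exteriorPower.ιMulti_apply_coe, Pi.smul_apply,
      formEval_ιMulti]
    refine mul_eq_zero_of_right (f i x) ?_
    change (ContMDiffMap.evalRingHom x : C^∞⟮I, M; 𝓘(ℝ, ℝ), ℝ⟯ →+* ℝ) (Matrix.det _) = 0
    rw [RingHom.map_det]
    refine Matrix.det_eq_zero_of_row_eq_zero j fun l => ?_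
    simp only [RingHom.mapMatrix_apply, Matrix.map_apply, Matrix.of_apply, Function.update_self]
    exact hZ' i l
  rw [hc]
  refine Finset.sum_eq_zero fun j _ => ?_
  have := alternating_update_apply (evalAlternating lam) Y c hc j
  rw [hzero, evalAlternating_apply] at this
  rw [(mul_eq_zero.mp this.symm).resolve_right hY, zero_smul]

end VolumeForm

end Geometry

end AnchoredBracket
end

noncomputable section

set_option linter.unusedSectionVars false

namespace AnchoredBracket

/-! ### Dual frames and the dual multivector -/

section Multivectors

variable {R L : Type*} [CommRing R] [AddCommGroup L] [Module R L]
  [Algebra ℝ R] [Module ℝ L] [IsScalarTower ℝ R L]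

/-- Evaluation of forms on vectors is the interior product by a multivector. -/
theorem exists_interior_eq_formEval : ∀ {q : ℕ} (a : Fin q → L), ∃ V ∈ ⋀[R]^q L,
    ∀ w ∈ ⋀[R]^q (Module.Dual R L),
      interior V w = algebraMap R _ (formEval LinearMap.id q w a)
  | 0, a => by
    refine ⟨1, ?_, fun w hw => ?_⟩
    · rw [← map_one (algebraMap R _)]; exact algebraMap_mem 1
    · obtain ⟨r, rfl⟩ := exists_algebraMap_of_mem hw
      rw [map_one, Module.End.one_apply, formEval_zero, ExteriorAlgebra.algebraMap_leftInverse]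
  | q + 1, a => by
    obtain ⟨V, hV, h⟩ := exists_interior_eq_formEval (Fin.tail a)
    refine ⟨V * ExteriorAlgebra.ι R (a 0), exteriorPower_mul_mem rfl hV (ι_mem _), fun w hw => ?_⟩
    rw [interior_mul, interior_ι, h _ (ctr_mem _ hw), formEval_succ]

end Multivectors

section Geometry

variable {E : Type*} [NormedAddCommGroup E] [NormedSpace ℝ E] [FiniteDimensional ℝ E]
  {H : Type*} [TopologicalSpace H] {I : ModelWithCorners ℝ E H}
  {M : Type*} [TopologicalSpace M] [ChartedSpace H M] [IsManifold I ∞ M] [T2Space M]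
  {F : Type*} [NormedAddCommGroup F] [NormedSpace ℝ F] [FiniteDimensional ℝ F]
  {A : M → Type*} [TopologicalSpace (TotalSpace F A)] [∀ x, TopologicalSpace (A x)]
  [∀ x, AddCommGroup (A x)] [∀ x, Module ℝ (A x)] [FiberBundle F A] [VectorBundle ℝ F A]
  [ContMDiffVectorBundle ∞ F A I]

/-! ### The fibre metric defined by finitely many `1`-forms -/

section Gram

variable {n : ℕ} (α : Fin n → Module.Dual C^∞⟮I, M; 𝓘(ℝ, ℝ), ℝ⟯ Cₛ^∞⟮I; F, A⟯)

/-- The bilinear form `∑ₖ αₖ ⊗ αₖ` on a fibre. -/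
def gramAt (x : M) : A x →ₗ[ℝ] Module.Dual ℝ (A x) :=
  ∑ k, (dualAt (α k) x).smulRight (dualAt (α k) x)

theorem gramAt_apply (x : M) (v w : A x) :
    gramAt α x v w = ∑ k, dualAt (α k) x v * dualAt (α k) x w := by
  simp [gramAt, LinearMap.sum_apply]

variable {α}
  (hα : ∀ (Z : Cₛ^∞⟮I; F, A⟯) (x : M), (∀ k, α k Z x = 0) → Z x = 0)
include hα

theorem gramAt_self_eq_zero {x : M} {v : A x} (h : gramAt α x v v = 0) : v = 0 := by
  obtain ⟨Z, rfl⟩ := exists_section_apply_eq (I := I) (F := F) x v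
  rw [gramAt_apply, Finset.sum_eq_zero_iff_of_nonneg fun _ _ => mul_self_nonneg _] at h
  refine hα Z x fun k => ?_
  rw [← dualAt_apply]
  exact mul_self_eq_zero.mp (h k (Finset.mem_univ k))

theorem existsUnique_gramAt (x : M) (φ : Module.Dual ℝ (A x)) : ∃! v, gramAt α x v = φ := by
  have := (fiberEquiv (F := F) (A := A) x).symm.finiteDimensional
  have hi : Function.Injective (gramAt α x) := by
    rw [injective_iff_map_eq_zero]
    intro v hv
    exact gramAt_self_eq_zero hα (by rw [hv]; rfl)
  have hb : Function.Bijective (gramAt α x) :=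
    (LinearMap.linearEquivOfInjective (gramAt α x) hi Subspace.dual_finrank_eq.symm).bijective
  exact hb.existsUnique φ

/-- The metric dual of a `1`-form. -/
theorem exists_gram_dual (β : Module.Dual C^∞⟮I, M; 𝓘(ℝ, ℝ), ℝ⟯ Cₛ^∞⟮I; F, A⟯) :
    ∃ X : Cₛ^∞⟮I; F, A⟯, ∀ x, gramAt α x (X x) = dualAt β x := by
  choose v hv hu using fun x => existsUnique_gramAt hα x (dualAt β x)
  dsimp only at hv hu
  refine ⟨⟨v, fun x₀ => ?_⟩, hv⟩
  have := (fiberEquiv (F := F) (A := A) x₀).symm.finiteDimensional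
  let B := Module.finBasis ℝ (A x₀)
  choose Y hY using fun j => exists_section_apply_eq (I := I) (F := F) x₀ (B j)
  -- The Gram matrix of sections forming a basis at x₀. Its determinant is nonzero near x₀, and
  -- there Cramer's rule writes the pointwise dual as a smooth section, which is `W` divided by the
  -- determinant.
  let G : Matrix _ _ C^∞⟮I, M; 𝓘(ℝ, ℝ), ℝ⟯ := Matrix.of fun i j => ∑ k, α k (Y i) * α k (Y j)
  have hG : ∀ i j (x : M), G i j x = gramAt α x (Y i x) (Y j x) := fun i j x => by
    rw [gramAt_apply]
    simp only [dualAt_apply]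
    exact function_sum_apply Finset.univ (fun k => α k (Y i) * α k (Y j)) x
  have hdet : ∀ x, G.det x = (Matrix.of fun i j => gramAt α x (Y i x) (Y j x)).det := fun x => by
    change (ContMDiffMap.evalRingHom x : C^∞⟮I, M; 𝓘(ℝ, ℝ), ℝ⟯ →+* ℝ) G.det = _
    rw [RingHom.map_det]
    congr 1
    ext i j
    exact hG i j x
  have hli : ∀ x, G.det x ≠ 0 → LinearIndependent ℝ fun i => Y i x := by
    intro x hx
    rw [Fintype.linearIndependent_iff]
    intro c hc
    by_contra! hne
    refine hx ?_
    rw [hdet, ← Matrix.exists_vecMul_eq_zero_iff]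
    refine ⟨c, fun h => ?_, ?_⟩
    · obtain ⟨i, hi⟩ := hne
      exact hi (congrFun h i)
    · ext j
      have := congrArg (fun u => gramAt α x u (Y j x)) hc
      simpa [Matrix.vecMul, dotProduct, LinearMap.sum_apply] using this
  have h0 : G.det x₀ ≠ 0 := by
    rw [hdet]
    intro h
    obtain ⟨c, hc, hc'⟩ := Matrix.exists_vecMul_eq_zero_iff.mpr h
    have hz : ∑ i, c i • Y i x₀ = 0 := by
      apply gramAt_self_eq_zero hα
      have : ∀ j, gramAt α x₀ (∑ i, c i • Y i x₀) (Y j x₀) = 0 := fun j => by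
        have := congrFun hc' j
        simpa [Matrix.vecMul, dotProduct, LinearMap.sum_apply] using this
      rw [map_sum (gramAt α x₀ (∑ i, c i • Y i x₀))]
      exact Finset.sum_eq_zero fun j _ => by rw [map_smul, this, smul_zero]
    simp only [hY] at hz
    exact hc (funext (Fintype.linearIndependent_iff.mp B.linearIndependent c hz))
  let a := fun j => β (Y j)
  let W : Cₛ^∞⟮I; F, A⟯ := ∑ i, (Matrix.vecMul a G.adjugate i) • Y i
  have hW : ∀ x, G.det x ≠ 0 → v x = (G.det x)⁻¹ • W x := by
    intro x hx
    have := (fiberEquiv (F := F) (A := A) x).symm.finiteDimensional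
    have hspan := (hli x hx).span_eq_top_of_card_eq_finrank' (by
      rw [Fintype.card_fin, (fiberEquiv (F := F) (A := A) x).finrank_eq,
        (fiberEquiv (F := F) (A := A) x₀).finrank_eq])
    refine (hu x _ ?_).symm
    refine LinearMap.ext_on_range hspan fun j => ?_
    rw [map_smul, LinearMap.smul_apply, dualAt_apply]
    have h1 : gramAt α x (W x) (Y j x) = (Matrix.vecMul (Matrix.vecMul a G.adjugate) G) j x := by
      rw [section_sum_apply, map_sum, LinearMap.sum_apply]
      simp only [Matrix.vecMul, dotProduct]
      rw [function_sum_apply]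
      refine Finset.sum_congr rfl fun i _ => ?_
      rw [section_smul_apply, map_smul, LinearMap.smul_apply, ← hG]; rfl
    rw [h1, Matrix.vecMul_vecMul, Matrix.adjugate_mul, Matrix.vecMul_smul, Matrix.vecMul_one]
    change (G.det x)⁻¹ * (G.det x * a j x) = a j x
    field_simp
  have hnear : ∀ᶠ x in nhds x₀, G.det x ≠ 0 :=
    G.det.contMDiff.continuous.continuousAt.eventually_ne h0
  refine ContMDiffAt.congr_of_eventuallyEq (f := fun x =>
    (⟨x, (G.det x)⁻¹ • W x⟩ : TotalSpace F A)) ?_ (hnear.mono fun x hx => ?_)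
  · exact (G.det.contMDiff.contMDiffAt.inv₀ h0).smul_section W.contMDiff.contMDiffAt
  · change (⟨x, v x⟩ : TotalSpace F A) = _
    rw [hW x hx]

/-- Finitely many `1`-forms separating the points of the fibres are part of a dual frame. -/
theorem nonempty_dualFrame : Nonempty (DualFrame (LinearMap.id :
    Module.Dual C^∞⟮I, M; 𝓘(ℝ, ℝ), ℝ⟯ Cₛ^∞⟮I; F, A⟯ →ₗ[C^∞⟮I, M; 𝓘(ℝ, ℝ), ℝ⟯] _) n) := by
  choose X hX using fun k => exists_gram_dual hα (α k)
  -- Both sections have the same metric dual, the metric being the sum of the squares of the αₖ.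
  have hsum : ∀ Z : Cₛ^∞⟮I; F, A⟯, ∑ k, α k Z • X k = Z := by
    intro Z
    ext x
    obtain ⟨u, -, hu⟩ := existsUnique_gramAt hα x (gramAt α x (Z x))
    rw [hu (Z x) rfl]
    refine hu _ ?_
    dsimp only
    rw [section_sum_apply, map_sum]
    refine LinearMap.ext fun w => ?_
    rw [LinearMap.sum_apply, gramAt_apply]
    refine Finset.sum_congr rfl fun k _ => ?_
    rw [section_smul_apply, map_smul, hX, dualAt_apply]; rfl
  refine ⟨⟨X, α, hsum, fun ζ => LinearMap.ext fun Z => ?_⟩⟩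
  conv_rhs => rw [← hsum Z, map_sum]
  rw [LinearMap.sum_apply]
  refine Finset.sum_congr rfl fun k _ => ?_
  rw [map_smul, LinearMap.smul_apply, LinearMap.id_apply, smul_eq_mul, smul_eq_mul, mul_comm]

end Gram

/-! ### The multivector dual to a volume form -/

variable {lam : ⋀[C^∞⟮I, M; 𝓘(ℝ, ℝ), ℝ⟯]^(Module.finrank ℝ F)
      (Module.Dual C^∞⟮I, M; 𝓘(ℝ, ℝ), ℝ⟯ Cₛ^∞⟮I; F, A⟯)} {n : ℕ}

theorem isUnit_of_forall_ne_zero {f : C^∞⟮I, M; 𝓘(ℝ, ℝ), ℝ⟯} (hf : ∀ x, f x ≠ 0) : IsUnit f := by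
  refine .of_mul_eq_one ⟨fun x => (f x)⁻¹, f.contMDiff.inv₀ hf⟩ ?_
  ext x
  exact mul_inv_cancel₀ (hf x)

/-- The values c_J of λ on tuples of frame sections do not vanish simultaneously, so ∑ c_J² is
invertible. Dividing ∑ c_J V_J by it gives Λ, where V_J is the multivector whose interior product
evaluates on the tuple J. -/
theorem exists_isDualVolume (hlam : IsVolumeForm lam) (Φ : DualFrame (LinearMap.id :
    Module.Dual C^∞⟮I, M; 𝓘(ℝ, ℝ), ℝ⟯ Cₛ^∞⟮I; F, A⟯ →ₗ[C^∞⟮I, M; 𝓘(ℝ, ℝ), ℝ⟯] _) n) :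
    ∃ Lam, IsDualVolume lam Lam := by
  choose V hV hVw using fun J : Fin (Module.finrank ℝ F) → Fin n =>
    exists_interior_eq_formEval (R := C^∞⟮I, M; 𝓘(ℝ, ℝ), ℝ⟯) (fun i => Φ.x (J i))
  let c : (Fin (Module.finrank ℝ F) → Fin n) → C^∞⟮I, M; 𝓘(ℝ, ℝ), ℝ⟯ := fun J =>
    eval lam fun i => Φ.x (J i)
  have hc : ∀ J, interior (V J) (lam : ExteriorAlgebra C^∞⟮I, M; 𝓘(ℝ, ℝ), ℝ⟯ _) =
      algebraMap _ _ (c J) := fun J => by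
    rw [hVw J _ lam.2, ← formValue_eq_formEval]; rfl
  have hne : ∀ x, (∑ J, c J * c J) x ≠ 0 := by
    intro x hx
    rw [function_sum_apply] at hx
    change ∑ J, c J x * c J x = 0 at hx
    have hx' : ∀ J, c J x = 0 := fun J => by
      rw [Finset.sum_eq_zero_iff_of_nonneg fun J _ => mul_self_nonneg (c J x)] at hx
      exact mul_self_eq_zero.mp (hx J (Finset.mem_univ J))
    obtain ⟨Y, hY⟩ := hlam x
    refine hY ?_
    -- By multilinearity λ(Y) is a combination of the c_J, so it would vanish at x.
    rw [← evalAlternating_apply, show Y = fun i => ∑ k, Φ.ξ k (Y i) • Φ.x k from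
      funext fun i => (Φ.sum_x (Y i)).symm]
    have := (evalAlternating lam).toMultilinearMap.map_sum fun i k => Φ.ξ k (Y i) • Φ.x k
    rw [AlternatingMap.coe_multilinearMap] at this
    rw [this, function_sum_apply]
    refine Finset.sum_eq_zero fun J _ => ?_
    have h2 := (evalAlternating lam).toMultilinearMap.map_smul_univ (fun i => Φ.ξ (J i) (Y i))
      fun i => Φ.x (J i)
    rw [AlternatingMap.coe_multilinearMap] at h2
    rw [h2, evalAlternating_apply]
    change _ * c J x = 0
    rw [hx', mul_zero]
  obtain ⟨u, hu⟩ := isUnit_of_forall_ne_zero hne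
  refine ⟨(↑u⁻¹ : C^∞⟮I, M; 𝓘(ℝ, ℝ), ℝ⟯) • ∑ J, c J • V J, ?_, ?_, ?_⟩
  · exact Submodule.smul_mem _ _ (Submodule.sum_mem _ fun J _ => Submodule.smul_mem _ _ (hV J))
  · intro w hw
    refine Φ.eq_zero_of_formEval hw fun a => ?_
    have h := alternating_eq_zero_of_lt (Nat.lt_succ_self _) (evalAlternating ⟨w, hw⟩) a
    rw [evalAlternating_apply, eval, formValue_eq_formEval] at h
    exact h
  · rw [map_smul, LinearMap.smul_apply, map_sum, LinearMap.sum_apply]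
    have h : ∀ J, interior (c J • V J) (lam : ExteriorAlgebra C^∞⟮I, M; 𝓘(ℝ, ℝ), ℝ⟯ _) =
        algebraMap _ _ (c J * c J) := fun J => by
      rw [map_smul, LinearMap.smul_apply, hc, Algebra.smul_def, ← map_mul]
    simp only [h]
    rw [← map_sum, Algebra.smul_def, ← map_mul, ← hu, Units.inv_mul, map_one]

/-! ### The Lie algebroid -/

/-- Comparing the Jacobi identities for Z and for f • Z, the defect of the anchor on f annihilates
every section; evaluating λ shows that it is zero. -/
theorem isLie_toAnchoredBracket (𝔸 : LieAlgebroid I F A) (hlam : IsVolumeForm lam) :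
    𝔸.toAnchoredBracket.IsLie where
  jacobi := 𝔸.jacobi
  anchor X Y f := by
    set D := 𝔸.toAnchoredBracket
    have key : ∀ Z : Cₛ^∞⟮I; F, A⟯,
        (D.anchor (D.bracket X Y) f - (D.anchor X (D.anchor Y f) - D.anchor Y (D.anchor X f))) • Z =
          0 := by
      intro Z
      have h1 : D.bracket X (D.bracket Y (f • Z)) = D.bracket (D.bracket X Y) (f • Z) +
        D.bracket Y (D.bracket X (f • Z)) := 𝔸.jacobi X Y (f • Z)
      have h2 : D.bracket X (D.bracket Y Z) = D.bracket (D.bracket X Y) Z +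
        D.bracket Y (D.bracket X Z) := 𝔸.jacobi X Y Z
      simp only [D.leibniz, map_add, h2, smul_add] at h1
      have h3 : (D.anchor X (D.anchor Y f)) • Z = (D.anchor (D.bracket X Y) f) • Z +
          (D.anchor Y (D.anchor X f)) • Z := by
        rw [← sub_eq_zero] at h1 ⊢
        rw [← h1]; abel
      rw [sub_smul, sub_smul, h3]; abel
    rw [← sub_eq_zero]
    set r := D.anchor (D.bracket X Y) f - (D.anchor X (D.anchor Y f) - D.anchor Y (D.anchor X f))
    -- In rank zero λ has no argument to multiply by `r`, but then all sections, hence all anchors,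
    -- vanish.
    rcases Nat.eq_zero_or_pos (Module.finrank ℝ F) with h0 | h0
    · have hz : ∀ Z : Cₛ^∞⟮I; F, A⟯, Z = 0 := fun Z => by
        have : Subsingleton F := Module.finrank_zero_iff.mp h0
        ext x
        have : Subsingleton (A x) := (fiberEquiv (F := F) (A := A) x).toEquiv.subsingleton
        exact Subsingleton.elim _ _
      simp only [r, hz X, hz Y, map_zero, Derivation.zero_apply, sub_self]
    · ext x
      obtain ⟨Y, hY⟩ := hlam x
      have h := (evalAlternating lam).map_update_smul Y ⟨0, h0⟩ r (Y ⟨0, h0⟩)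
      rw [key, AlternatingMap.map_update_zero, Function.update_eq_self, evalAlternating_apply] at h
      have h' : (0 : ℝ) = r x * eval lam Y x := congrArg (fun g => g x) h
      exact (mul_eq_zero.mp h'.symm).resolve_right hY

end Geometry

end AnchoredBracket

end

/-! ### The proposition -/

theorem mainTheorem5
    {E : Type*} [NormedAddCommGroup E] [NormedSpace ℝ E] [FiniteDimensional ℝ E]
    {H : Type*} [TopologicalSpace H] {I : ModelWithCorners ℝ E H}
    {M : Type*} [TopologicalSpace M] [ChartedSpace H M] [IsManifold I ∞ M]
    [BoundarylessManifold I M] [T2Space M] [SigmaCompactSpace M]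
    {F : Type*} [NormedAddCommGroup F] [NormedSpace ℝ F] [FiniteDimensional ℝ F]
    {A : M → Type*} [TopologicalSpace (TotalSpace F A)] [∀ x, TopologicalSpace (A x)]
    [∀ x, AddCommGroup (A x)] [∀ x, Module ℝ (A x)] [FiberBundle F A] [VectorBundle ℝ F A]
    [ContMDiffVectorBundle ∞ F A I]
    (𝔸 : LieAlgebroid I F A)
    (P : ⋀[C^∞⟮I, M; 𝓘(ℝ, ℝ), ℝ⟯]^2 Cₛ^∞⟮I; F, A⟯)
    (ψ : ⋀[C^∞⟮I, M; 𝓘(ℝ, ℝ), ℝ⟯]^3 (Module.Dual C^∞⟮I, M; 𝓘(ℝ, ℝ), ℝ⟯ Cₛ^∞⟮I; F, A⟯))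
    (hPψ : 𝔸.toAnchoredBracket.IsTwistedPoisson P ψ)
    (lam : ⋀[C^∞⟮I, M; 𝓘(ℝ, ℝ), ℝ⟯]^(Module.finrank ℝ F)
      (Module.Dual C^∞⟮I, M; 𝓘(ℝ, ℝ), ℝ⟯ Cₛ^∞⟮I; F, A⟯))
    (hlam : IsVolumeForm lam) :
    -- the objects below are well defined
    (∃! d, 𝔸.toAnchoredBracket.IsDifferential LinearMap.id d) ∧
    (∃! B, 𝔸.toAnchoredBracket.IsGerstenhaberExtension B) ∧
    Function.Bijective (AnchoredBracket.star lam) ∧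
    -- `(Γ(∧A*), [ , ]_{P,ψ})` is the Gerstenhaber algebra of the Lie algebroid `A*`, and `d_{P,ψ}`
    -- is the differential of that Lie algebroid
    (∃! B, (𝔸.toAnchoredBracket.twistedDual P ψ).IsGerstenhaberExtension B) ∧
    AnchoredBracket.GradedJacobi (𝔸.toAnchoredBracket.twistedDual P ψ).gerstenhaber ∧
    (𝔸.toAnchoredBracket.twistedDual P ψ).IsDifferential (Module.Dual.eval _ _)
      (𝔸.toAnchoredBracket.dTwisted P ψ) ∧
    -- `∂_{P,ψ,λ}` is a generator of square zero
    AnchoredBracket.IsSquareZeroGenerator (𝔸.toAnchoredBracket.twistedDual P ψ).gerstenhaber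
      (𝔸.toAnchoredBracket.partialVolume P ψ lam) ∧
    -- with `Z = X + Y`, its difference with `∂_P + ∂̲_{P,ψ} + i_Y` is `i_Z`
    (∃! X, 𝔸.toAnchoredBracket.IsSectionX P lam X) ∧
    ∀ X, 𝔸.toAnchoredBracket.IsSectionX P lam X → ∀ w,
      𝔸.toAnchoredBracket.partialVolume P ψ lam w -
        (𝔸.toAnchoredBracket.partialBivector P w + AnchoredBracket.partialUnderline P ψ w +
          AnchoredBracket.interior (ExteriorAlgebra.ι _ (AnchoredBracket.sectionY P ψ)) w) =
      AnchoredBracket.interior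
        (ExteriorAlgebra.ι _ (X + AnchoredBracket.sectionY P ψ)) w := by
  obtain ⟨n, α, hα⟩ := AnchoredBracket.exists_separating hlam
  obtain ⟨Φ⟩ := AnchoredBracket.nonempty_dualFrame hα
  obtain ⟨Lam, hl⟩ := AnchoredBracket.exists_isDualVolume hlam Φ
  have hD := AnchoredBracket.isLie_toAnchoredBracket 𝔸 hlam
  refine ⟨Φ.existsUnique_differential _, (Φ.isDerivedGenerator_dA hl).existsUnique,
    ⟨hl.star_injective Φ, hl.star_surjective⟩, Φ.isDerivedGenerator_thetaOp.existsUnique,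
    Φ.isDerivedGenerator_thetaOp.gradedJacobi (Φ.thetaOp_sq hD hl hPψ),
    (Φ.isCartanDifferential_dTwisted hl).isDifferential,
    hl.isSquareZeroGenerator (F := Φ) hD hPψ, hl.existsUnique_sectionX Φ, fun X hX w =>
      hl.partialVolume_sub (F := Φ) hX w⟩
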